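/- Let $\mathrm{sn},\mathrm{cn},\mathrm{dn}$ be the Jacobi elliptic functions of modulus $k$, let $K=K(k)$ be the complete elliptic integral of the first kind, $K'=K(\sqrt{1-k^2})$, and let $w$ be a real number. Put $E^n_j=\prod_{s=0}^{j-1}\frac{\mathrm{sn}(w(n-s))}{\mathrm{sn}(w(s+1))}$ for $0\le j\le n$, and let the cn-polynomials be $\Phi_n(z)=\sum_{s=0}^n W_{n,s}z^s$, where $W_{n,s}=(-1)^s\,\mathrm{dn}(w(n-s))E^n_s$ for even $n$ and $W_{n,s}=(-1)^{s+1}\,\mathrm{cn}(w(n-s))E^n_s$ for odd $n$; write $a_{n-1}=-\Phi_n(0)$ for $n\ge 0$ (so $a_{-1}=-1$). (A) Let $0<k<1$ and suppose that $w/K$ is irrational. For every $n\ge0$ there are unique real polynomials $S_n$ (Delsarte–Genin transform) and $P_n$ (Szegő transform) such that for all complex $t\neq0$, $z\ne 0$ $$S_n\Big(\frac{t+t^{-1}}2\Big)=\frac{t^{-n}\Phi_n(t^2)+t^n\Phi_n(t^{-2})}{2^n(1-a_{n-1})},\qquad P_n\Big(\frac{z+z^{-1}}2\Big)=\frac{z^{-n}\Phi_{2n}(z)+z^n\Phi_{2n}(1/z)}{2^n(1-a_{2n-1})},$$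 and $S_{2n}(x)=2^{-n}P_n(2x^2-1)$. The polynomial $P_n$ is monic of degree $n$. With $$u_n=\tfrac14\,\mathrm{sn}^2(w(2n-1))\,(1-\mathrm{dn}(2wn))\,(1+\mathrm{dn}(2w(n-1))),$$ $$b_n=\tfrac12\big[\mathrm{cn}(w(2n+1))(1+\mathrm{dn}(2wn))-\mathrm{cn}(w(2n-1))(1-\mathrm{dn}(2wn))\big],$$ one has $P_0=1$, $P_1+b_0P_0=xP_0$ and $P_{n+1}+b_nP_n+u_nP_{n-1}=xP_n$ for $n\ge1$. With $T_s$ the Chebyshev polynomials of the first kind, $$P_n(x)=\frac{(-1)^n2^{1-n}}{1+\mathrm{dn}(2wn)}\Big(\mathrm{dn}(wn)E^{2n}_n+\sum_{s=1}^n(-1)^sE^{2n}_{n+s}\big(\mathrm{dn}(w(n-s))+\mathrm{dn}(w(n+s))\big)T_s(x)\Big).$$ For all $n,m\ge0$, with absolutely convergent sums, $$\sum_{s\in\mathbb Z}\rho_sP_n(x_s)P_m(x_s)=H_n\delta_{nm},\qquad H_n=u_1u_2\cdots u_n>0,$$ where $x_s=\cos\big(\pi w(s-\tfrac12)/K\big)$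 and $\rho_s=\frac{\pi}{kK}\,\frac1{q^{s-1/2}+q^{-s+1/2}}$ with $q=e^{-\pi K'/K}$. Moreover $\rho_s>0$ for all $s$, $\sum_s\rho_s=1$, and the points $x_s$ are dense in $[-1,1]$. (B) Let $w\ne0$ be fixed and put $q=e^{-2w}$. Then for every $n\ge0$, as $k\to1^-$, $$u_n\to\frac14\,\frac{(1-q^n)^2(1-q^{2n-1})^2(1+q^{n-1})^2}{(1+q^{2n-1})^2(1+q^{2n})(1+q^{2n-2})},\qquad b_n\to q^{n-1/2}\,\frac{2(q+1)q^n-(1-q)(1-q^{2n})}{(1+q^{2n-1})(1+q^{2n+1})},$$ and $P_n$ converges coefficientwise to the monic Askey–Wilson polynomial $p_n(x;a,b,c,d|q)/\big(2^n(abcd\,q^{n-1};q)_n\big)$ with parameters $a=c=q^{1/2}$, $b=-d=1$, where, for $x=\cos\theta$, $$p_n(x;a,b,c,d|q)=\frac{(ab,ac,ad;q)_n}{a^n}\;{}_4\phi_3\!\left({q^{-n},\ abcd\,q^{n-1},\ ae^{i\theta},\ ae^{-i\theta}\atop ab,\ ac,\ ad};q,q\right).$$ -/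

import Mathlib

open Polynomial Filter Topology

noncomputable section

/-! ### Jacobi elliptic functions of a real argument, with modulus `k` -/

/-- The incomplete elliptic integral of the first kind
`F(φ, k) = ∫₀^φ dt / √(1 - k² sin² t)`. -/
def ellipticF (k φ : ℝ) : ℝ :=
  ∫ t in (0 : ℝ)..φ, (Real.sqrt (1 - k ^ 2 * Real.sin t ^ 2))⁻¹

/-- The complete elliptic integral of the first kind `K(k) = F(π/2, k)`. -/
def ellipticK (k : ℝ) : ℝ := ellipticF k (Real.pi / 2)

/-- The complementary integral `K'(k) = K(√(1 - k²))`. -/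
def ellipticK' (k : ℝ) : ℝ := ellipticK (Real.sqrt (1 - k ^ 2))

/-- The Jacobi amplitude: the inverse function of `φ ↦ F(φ, k)`, which is a bijection of `ℝ`
for `0 < k < 1` (see `ellipticF_bijective`). -/
def jacobiAm (k u : ℝ) : ℝ := Function.invFun (ellipticF k) u

def jacobiSn (k u : ℝ) : ℝ := Real.sin (jacobiAm k u)

def jacobiCn (k u : ℝ) : ℝ := Real.cos (jacobiAm k u)

def jacobiDn (k u : ℝ) : ℝ := Real.sqrt (1 - k ^ 2 * Real.sin (jacobiAm k u) ^ 2)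

theorem ellipticF_integrand_pos {k : ℝ} (hk0 : 0 < k) (hk1 : k < 1) (t : ℝ) :
    0 < 1 - k ^ 2 * Real.sin t ^ 2 := by
  have h1 : Real.sin t ^ 2 ≤ 1 := Real.sin_sq_le_one t
  have h2 : k ^ 2 < 1 := by nlinarith
  nlinarith [sq_nonneg (Real.sin t), sq_nonneg k]

theorem ellipticF_integrand_continuous {k : ℝ} (hk0 : 0 < k) (hk1 : k < 1) :
    Continuous fun t : ℝ => (Real.sqrt (1 - k ^ 2 * Real.sin t ^ 2))⁻¹ := by
  refine Continuous.inv₀ (by fun_prop) fun t => ?_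
  exact (Real.sqrt_pos.2 (ellipticF_integrand_pos hk0 hk1 t)).ne'

theorem le_ellipticF_sub {k : ℝ} (hk0 : 0 < k) (hk1 : k < 1) {a b : ℝ} (hab : a ≤ b) :
    b - a ≤ ellipticF k b - ellipticF k a := by
  have hc := ellipticF_integrand_continuous hk0 hk1
  unfold ellipticF
  rw [intervalIntegral.integral_interval_sub_left (hc.intervalIntegrable _ _)
    (hc.intervalIntegrable _ _)]
  have h : ∫ _ in a..b, (1 : ℝ) ≤ ∫ t in a..b, (Real.sqrt (1 - k ^ 2 * Real.sin t ^ 2))⁻¹ := by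
    refine intervalIntegral.integral_mono hab (by simp) (hc.intervalIntegrable _ _) fun t => ?_
    have hp := ellipticF_integrand_pos hk0 hk1 t
    refine (one_le_inv₀ (Real.sqrt_pos.2 hp)).2 (Real.sqrt_le_one.2 ?_)
    nlinarith [mul_nonneg (sq_nonneg k) (sq_nonneg (Real.sin t))]
  simpa using h

theorem ellipticF_bijective {k : ℝ} (hk0 : 0 < k) (hk1 : k < 1) :
    Function.Bijective (ellipticF k) := by
  have hc : Continuous (ellipticF k) :=
    intervalIntegral.continuous_primitive
      (fun a b => (ellipticF_integrand_continuous hk0 hk1).intervalIntegrable a b) 0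
  have h0 : ellipticF k 0 = 0 := by simp [ellipticF]
  constructor
  · intro a b h
    rcases le_total a b with hab | hab
    · have := le_ellipticF_sub hk0 hk1 hab
      linarith
    · have := le_ellipticF_sub hk0 hk1 hab
      linarith
  · refine hc.surjective ?_ ?_
    · refine tendsto_atTop_mono' _ ?_ tendsto_id
      filter_upwards [eventually_ge_atTop (0 : ℝ)] with x hx
      have := le_ellipticF_sub hk0 hk1 hx
      simp only [id]
      linarith
    · refine tendsto_atBot_mono' _ ?_ tendsto_id
      filter_upwards [eventually_le_atBot (0 : ℝ)] with x hx
      have := le_ellipticF_sub hk0 hk1 hx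
      simp only [id]
      linarith

/-! ### The cn-polynomials on the unit circle -/

/-- The elliptic binomial coefficients `E^n_j = ∏_{s<j} sn(w(n-s)) / sn(w(s+1))` for `0 ≤ j ≤ n`,
and `0` otherwise. -/
def ellipticBinom (k w : ℝ) (n j : ℕ) : ℝ :=
  if j ≤ n then
    ∏ s ∈ Finset.range j, jacobiSn k (w * ((n : ℝ) - s)) / jacobiSn k (w * ((s : ℝ) + 1))
  else 0

/-- The power coefficients `W_{n,s}` of the cn-polynomials. -/
def cnCoeff (k w : ℝ) (n s : ℕ) : ℝ :=
  if Even n then (-1) ^ s * jacobiDn k (w * ((n : ℝ) - s)) * ellipticBinom k w n s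
  else (-1) ^ (s + 1) * jacobiCn k (w * ((n : ℝ) - s)) * ellipticBinom k w n s

/-- The cn-polynomials `Φ_n(z) = ∑_{s=0}^n W_{n,s} z^s`. -/
def cnPoly (k w : ℝ) (n : ℕ) : ℝ[X] :=
  ∑ s ∈ Finset.range (n + 1), C (cnCoeff k w n s) * X ^ s

/-! ### The Delsarte-Genin and Szegő transforms -/

/-- The reflection parameter `a_{n-1} = -Φ_n(0)` (so `a_{-1} = -1` when `Φ_0 = 1`). -/
def prevRefl (Φ : ℕ → ℝ[X]) (n : ℕ) : ℝ := -(Φ n).eval 0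

/-- `S` is the `n`-th Delsarte-Genin transform of `Φ`: with `x = (z^{1/2} + z^{-1/2})/2`,
`S(x) = (z^{-n/2} Φ_n(z) + z^{n/2} Φ_n(1/z)) / (2^n (1 - a_{n-1}))`.
Here `t` stands for `z^{1/2}`. -/
def IsDelsarteGeninTransform (Φ : ℕ → ℝ[X]) (n : ℕ) (S : ℝ[X]) : Prop :=
  ∀ t : ℂ, t ≠ 0 →
    aeval ((t + t⁻¹) / 2) S =
      ((t⁻¹) ^ n * aeval (t ^ 2) (Φ n) + t ^ n * aeval ((t ^ 2)⁻¹) (Φ n)) /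
        (2 ^ n * (1 - (prevRefl Φ n : ℂ)))

/-- `P` is the `n`-th Szegő transform of `Φ`: with `x = (z + z⁻¹)/2`,
`P(x) = (z^{-n} Φ_{2n}(z) + z^n Φ_{2n}(1/z)) / (2^n (1 - a_{2n-1}))`. -/
def IsSzegoTransform (Φ : ℕ → ℝ[X]) (n : ℕ) (P : ℝ[X]) : Prop :=
  ∀ z : ℂ, z ≠ 0 →
    aeval ((z + z⁻¹) / 2) P =
      ((z⁻¹) ^ n * aeval z (Φ (2 * n)) + z ^ n * aeval z⁻¹ (Φ (2 * n))) /
        (2 ^ n * (1 - (prevRefl Φ (2 * n) : ℂ)))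

/-- The symmetric polynomials `S_n` attached to the cn-polynomials: the polynomial which is their
`n`-th Delsarte-Genin transform. -/
def cnSymmPoly (k w : ℝ) (n : ℕ) : ℝ[X] :=
  Classical.epsilon (IsDelsarteGeninTransform (cnPoly k w) n)

/-- The polynomials `P_n` on the interval: the polynomial which is the `n`-th Szegő transform of
the cn-polynomials. -/
def cnIntervalPoly (k w : ℝ) (n : ℕ) : ℝ[X] :=
  Classical.epsilon (IsSzegoTransform (cnPoly k w) n)

/-! ### Recurrence coefficients, spectral points and weights -/

def cnU (k w : ℝ) (n : ℕ) : ℝ :=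
  jacobiSn k (w * (2 * n - 1)) ^ 2 * (1 - jacobiDn k (2 * w * n)) *
    (1 + jacobiDn k (2 * w * ((n : ℝ) - 1))) / 4

def cnB (k w : ℝ) (n : ℕ) : ℝ :=
  (jacobiCn k (w * (2 * n + 1)) * (1 + jacobiDn k (2 * w * n)) -
    jacobiCn k (w * (2 * n - 1)) * (1 - jacobiDn k (2 * w * n))) / 2

/-- The elliptic nome `exp(-π K'/K)`. -/
def ellipticNome (k : ℝ) : ℝ := Real.exp (-Real.pi * ellipticK' k / ellipticK k)

/-- The spectral points `x_s = cos(π w (s - 1/2) / K)`. -/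
def cnPoint (k w : ℝ) (s : ℤ) : ℝ :=
  Real.cos (Real.pi * w * ((s : ℝ) - 1 / 2) / ellipticK k)

/-- The weights `ρ_s = (π / (k K)) / (q^{s-1/2} + q^{-s+1/2})`, `q` the nome. -/
def cnWeight (k : ℝ) (s : ℤ) : ℝ :=
  Real.pi / (k * ellipticK k) *
    (1 / (ellipticNome k ^ ((s : ℝ) - 1 / 2) + ellipticNome k ^ (-(s : ℝ) + 1 / 2)))

/-! ### Askey-Wilson polynomials -/

/-- The `q`-shifted factorial `(a; q)_n`. -/
def qShifted (a q : ℝ) (n : ℕ) : ℝ := ∏ j ∈ Finset.range n, (1 - a * q ^ j)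

/-- The Askey-Wilson polynomial
`p_n(x; a, b, c, d | q) = (ab, ac, ad; q)_n / a^n *
  ₄φ₃(q^{-n}, abcd q^{n-1}, a e^{iθ}, a e^{-iθ}; ab, ac, ad; q, q)`, `x = cos θ`,
as a polynomial in `x`, where
`(a e^{iθ}, a e^{-iθ}; q)_j = ∏_{i<j} (1 - 2 a q^i x + a² q^{2i})`. -/
def askeyWilson (a b c d q : ℝ) (n : ℕ) : ℝ[X] :=
  C (qShifted (a * b) q n * qShifted (a * c) q n * qShifted (a * d) q n / a ^ n) *
    ∑ j ∈ Finset.range (n + 1),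
      C (qShifted (q ^ (-(n : ℤ))) q j * qShifted (a * b * c * d * q ^ ((n : ℤ) - 1)) q j /
          (qShifted (a * b) q j * qShifted (a * c) q j * qShifted (a * d) q j * qShifted q q j) *
          q ^ j) *
        ∏ i ∈ Finset.range j, (1 - C (2 * a * q ^ i) * X + C (a ^ 2 * q ^ (2 * i)))

/-- The monic Askey-Wilson polynomial; the leading coefficient of `p_n` is
`2^n (abcd q^{n-1}; q)_n`. -/
def askeyWilsonMonic (a b c d q : ℝ) (n : ℕ) : ℝ[X] :=
  C (2 ^ n * qShifted (a * b * c * d * q ^ ((n : ℤ) - 1)) q n)⁻¹ * askeyWilson a b c d q n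

/-- The limiting recurrence coefficients at modulus `1`, with `q = e^{-2w}`. -/
def hypU (q : ℝ) (n : ℕ) : ℝ :=
  1 / 4 * ((1 - q ^ n) ^ 2 * (1 - q ^ (2 * (n : ℤ) - 1)) ^ 2 * (1 + q ^ ((n : ℤ) - 1)) ^ 2 /
    ((1 + q ^ (2 * (n : ℤ) - 1)) ^ 2 * (1 + q ^ (2 * n)) * (1 + q ^ (2 * (n : ℤ) - 2))))

def hypB (q : ℝ) (n : ℕ) : ℝ :=
  q ^ ((n : ℝ) - 1 / 2) * ((2 * (q + 1) * q ^ n - (1 - q) * (1 - q ^ (2 * n))) /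
    ((1 + q ^ (2 * (n : ℤ) - 1)) * (1 + q ^ (2 * n + 1))))

end

/-!
The polynomials `P_n` are tied to the discrete measure `∑ ρ_s δ_{x_s}` by the Fourier series of
`cn`: the Chebyshev moments of the measure are `∑ ρ_s T_n(x_s) = ∑ ρ_s cos(π n w (s - 1/2) / K) =
cn(w n)` (`hasSum_cnWeight_mul_eval_T`).

The Fourier coefficients of `cn` come from its pole at `i K'` without complex function theory.
Jacobi's imaginary transformation gives explicit real and imaginary parts `R(x, y)` and `I(x, y)`
of `cn(x + i y)`. For `c = π (s - 1/2) / K`, the integrals `G(y) = ∫ R cos(c x)` and `H(y) = ∫ I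
sin(c x)` over `[-K, K]` satisfy `G' = -c H`, `H' = -c G` by the Cauchy-Riemann equations and an
integration by parts, so `G(y) = G(0) cosh(c y)` (`integral_cnRe_mul_cos`). As `y → K'` the
function `R` concentrates at `x = 0` with mass `π / k` (`tendsto_integral_cnRe_mul_cos`), whence
`G(0) = π / (k cosh(c K'))`. These coefficients are summable, so the series converges to `cn`.

The addition theorems for `sn`, `cn`, `dn` turn into the Szegő recurrence `Φ_{n+1} = z Φ_n - a_n
Φ_n^*` (`aeval_cnPoly_succ`), with `a_n = cn(w (n+1))` for even `n` and `a_n = -dn(w (n+1))` for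
odd `n`. Four steps of it give the three-term recurrence of the `P_n`
(`cnIntervalPoly_recurrence`). Grouping the terms of `Φ_{2n}` symmetrically gives the Chebyshev
expansion, through which the integral of `P_n` becomes a finite sum over values of `cn`. For `n ≥
1` this sum vanishes, since by the addition theorems it is a divided difference of order `n` of a
polynomial of degree `n - 1`, at the nodes `sn²(w i)` (`sum_ellipticBinom_mul_jacobiCn`). The
recurrence then forces orthogonality (`map_mul_of_recurrence`). Irrationality of `w / K` enters
through `sn(w m) ≠ 0` for integers `m ≠ 0`, and in the density of the points `x_s`.

As `k → 1`, the functions `sn`, `cn`, `dn` tend to `tanh`, `1 / cosh`, `1 / cosh`, which gives the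
limits of the recurrence coefficients. The monic Askey-Wilson polynomials satisfy the limiting
recurrence (`askeyWilsonMonic_recurrence`), as a comparison of coefficients in the basis `(a
e^{iθ}, a e^{-iθ}; q)_j` shows. Since the recurrence for `P_n` needs only that finitely many
values `sn(w m)` are nonzero, it holds for `k` near `1`, and coefficientwise convergence follows
by induction on `n`.
-/

section

/-! ### The Jacobi functions, their derivatives and parity -/

theorem ellipticF_zero (k : ℝ) : ellipticF k 0 = 0 := by simp [ellipticF]

theorem ellipticF_strictMono {k : ℝ} (hk0 : 0 < k) (hk1 : k < 1) : StrictMono (ellipticF k) := by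
  intro a b hab
  have := le_ellipticF_sub hk0 hk1 hab.le
  linarith

theorem hasDerivAt_ellipticF {k : ℝ} (hk0 : 0 < k) (hk1 : k < 1) (φ : ℝ) :
    HasDerivAt (ellipticF k) (Real.sqrt (1 - k ^ 2 * Real.sin φ ^ 2))⁻¹ φ := by
  have hc := ellipticF_integrand_continuous hk0 hk1
  exact intervalIntegral.integral_hasDerivAt_right (hc.intervalIntegrable _ _)
    hc.aestronglyMeasurable.stronglyMeasurableAtFilter hc.continuousAt

theorem ellipticF_neg (k φ : ℝ) : ellipticF k (-φ) = -ellipticF k φ := by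
  unfold ellipticF
  have h := intervalIntegral.integral_comp_neg (a := 0) (b := φ)
    (fun t => (Real.sqrt (1 - k ^ 2 * Real.sin t ^ 2))⁻¹)
  simp only [Real.sin_neg, neg_sq, neg_zero] at h
  rw [h, intervalIntegral.integral_symm]

theorem ellipticF_jacobiAm {k : ℝ} (hk0 : 0 < k) (hk1 : k < 1) (u : ℝ) :
    ellipticF k (jacobiAm k u) = u :=
  Function.rightInverse_invFun (ellipticF_bijective hk0 hk1).2 u

theorem jacobiAm_ellipticF {k : ℝ} (hk0 : 0 < k) (hk1 : k < 1) (φ : ℝ) :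
    jacobiAm k (ellipticF k φ) = φ :=
  Function.leftInverse_invFun (ellipticF_bijective hk0 hk1).1 φ

theorem jacobiAm_eq_iff {k : ℝ} (hk0 : 0 < k) (hk1 : k < 1) {u φ : ℝ} :
    jacobiAm k u = φ ↔ u = ellipticF k φ := by
  constructor
  · rintro rfl
    rw [ellipticF_jacobiAm hk0 hk1]
  · rintro rfl
    rw [jacobiAm_ellipticF hk0 hk1]

theorem jacobiAm_strictMono {k : ℝ} (hk0 : 0 < k) (hk1 : k < 1) : StrictMono (jacobiAm k) := by
  intro a b hab
  rw [← (ellipticF_strictMono hk0 hk1).lt_iff_lt]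
  simpa only [ellipticF_jacobiAm hk0 hk1] using hab

theorem jacobiAm_zero {k : ℝ} (hk0 : 0 < k) (hk1 : k < 1) : jacobiAm k 0 = 0 := by
  rw [jacobiAm_eq_iff hk0 hk1, ellipticF_zero]

theorem jacobiAm_neg {k : ℝ} (hk0 : 0 < k) (hk1 : k < 1) (u : ℝ) :
    jacobiAm k (-u) = -jacobiAm k u := by
  rw [jacobiAm_eq_iff hk0 hk1, ellipticF_neg, ellipticF_jacobiAm hk0 hk1]

theorem jacobiAm_continuous {k : ℝ} (hk0 : 0 < k) (hk1 : k < 1) : Continuous (jacobiAm k) :=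
  (jacobiAm_strictMono hk0 hk1).monotone.continuous_of_surjective fun φ =>
    ⟨_, jacobiAm_ellipticF hk0 hk1 φ⟩

theorem jacobiDn_pos {k : ℝ} (hk0 : 0 < k) (hk1 : k < 1) (u : ℝ) : 0 < jacobiDn k u :=
  Real.sqrt_pos.2 (ellipticF_integrand_pos hk0 hk1 _)

theorem hasDerivAt_jacobiAm {k : ℝ} (hk0 : 0 < k) (hk1 : k < 1) (u : ℝ) :
    HasDerivAt (jacobiAm k) (jacobiDn k u) u := by
  have h := HasDerivAt.of_local_left_inverse (jacobiAm_continuous hk0 hk1).continuousAt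
    (hasDerivAt_ellipticF hk0 hk1 (jacobiAm k u)) (inv_ne_zero (jacobiDn_pos hk0 hk1 u).ne')
    (Eventually.of_forall fun v => ellipticF_jacobiAm hk0 hk1 v)
  exact h.congr_deriv (inv_inv _)

theorem jacobiSn_sq_add_jacobiCn_sq (k u : ℝ) : jacobiSn k u ^ 2 + jacobiCn k u ^ 2 = 1 :=
  Real.sin_sq_add_cos_sq _

theorem jacobiDn_sq {k : ℝ} (hk0 : 0 < k) (hk1 : k < 1) (u : ℝ) :
    jacobiDn k u ^ 2 = 1 - k ^ 2 * jacobiSn k u ^ 2 :=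
  Real.sq_sqrt (ellipticF_integrand_pos hk0 hk1 _).le

theorem hasDerivAt_jacobiSn {k : ℝ} (hk0 : 0 < k) (hk1 : k < 1) (u : ℝ) :
    HasDerivAt (jacobiSn k) (jacobiCn k u * jacobiDn k u) u :=
  (hasDerivAt_jacobiAm hk0 hk1 u).sin

theorem hasDerivAt_jacobiCn {k : ℝ} (hk0 : 0 < k) (hk1 : k < 1) (u : ℝ) :
    HasDerivAt (jacobiCn k) (-(jacobiSn k u * jacobiDn k u)) u := by
  exact (hasDerivAt_jacobiAm hk0 hk1 u).cos.congr_deriv (neg_mul _ _)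

theorem hasDerivAt_jacobiDn {k : ℝ} (hk0 : 0 < k) (hk1 : k < 1) (u : ℝ) :
    HasDerivAt (jacobiDn k) (-(k ^ 2 * (jacobiSn k u * jacobiCn k u))) u := by
  have hd := (jacobiDn_pos hk0 hk1 u).ne'
  have h := ((((hasDerivAt_jacobiSn hk0 hk1 u).pow 2).const_mul (k ^ 2)).const_sub 1).sqrt
    (ellipticF_integrand_pos hk0 hk1 _).ne'
  refine h.congr_deriv ?_
  change _ / (2 * jacobiDn k u) = _
  field_simp
  push_cast
  ring

theorem jacobiSn_zero {k : ℝ} (hk0 : 0 < k) (hk1 : k < 1) : jacobiSn k 0 = 0 := by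
  simp [jacobiSn, jacobiAm_zero hk0 hk1]

theorem jacobiCn_zero {k : ℝ} (hk0 : 0 < k) (hk1 : k < 1) : jacobiCn k 0 = 1 := by
  simp [jacobiCn, jacobiAm_zero hk0 hk1]

theorem jacobiDn_zero {k : ℝ} (hk0 : 0 < k) (hk1 : k < 1) : jacobiDn k 0 = 1 := by
  simp [jacobiDn, jacobiAm_zero hk0 hk1]

theorem jacobiSn_neg {k : ℝ} (hk0 : 0 < k) (hk1 : k < 1) (u : ℝ) :
    jacobiSn k (-u) = -jacobiSn k u := by
  simp [jacobiSn, jacobiAm_neg hk0 hk1]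

theorem jacobiCn_neg {k : ℝ} (hk0 : 0 < k) (hk1 : k < 1) (u : ℝ) :
    jacobiCn k (-u) = jacobiCn k u := by
  simp [jacobiCn, jacobiAm_neg hk0 hk1]

theorem jacobiDn_neg {k : ℝ} (hk0 : 0 < k) (hk1 : k < 1) (u : ℝ) :
    jacobiDn k (-u) = jacobiDn k u := by
  simp [jacobiDn, jacobiAm_neg hk0 hk1]

/-! ### Addition theorems -/

theorem one_sub_jacobiSn_mul_pos {k : ℝ} (hk0 : 0 < k) (hk1 : k < 1) (u v : ℝ) :
    0 < 1 - k ^ 2 * jacobiSn k u ^ 2 * jacobiSn k v ^ 2 := by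
  have h1 := jacobiDn_sq hk0 hk1 u
  have h2 := pow_pos (jacobiDn_pos hk0 hk1 u) 2
  have h3 := jacobiSn_sq_add_jacobiCn_sq k v
  nlinarith [sq_nonneg (k * jacobiSn k u * jacobiCn k v)]

theorem eq_of_hasDerivAt_eq_zero {f : ℝ → ℝ} (hf : ∀ x, HasDerivAt f 0 x) (a b : ℝ) :
    f a = f b :=
  is_const_of_deriv_eq_zero (fun x => (hf x).differentiableAt) (fun x => (hf x).deriv) a b

/-- The addition theorem of `sn`: on the line `u + v = c`, the right-hand side has derivative zero
in `u`, so it is equal to its value at `v = 0`. -/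
theorem jacobiSn_add {k : ℝ} (hk0 : 0 < k) (hk1 : k < 1) (u v : ℝ) :
    jacobiSn k (u + v) =
      (jacobiSn k u * jacobiCn k v * jacobiDn k v + jacobiSn k v * jacobiCn k u * jacobiDn k u) /
        (1 - k ^ 2 * jacobiSn k u ^ 2 * jacobiSn k v ^ 2) := by
  set c := u + v with hc
  have key : ∀ x, HasDerivAt (fun x =>
      (jacobiSn k x * jacobiCn k (c - x) * jacobiDn k (c - x) +
        jacobiSn k (c - x) * jacobiCn k x * jacobiDn k x) /
        (1 - k ^ 2 * jacobiSn k x ^ 2 * jacobiSn k (c - x) ^ 2)) 0 x := by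
    intro x
    have s1 := hasDerivAt_jacobiSn hk0 hk1 x
    have c1 := hasDerivAt_jacobiCn hk0 hk1 x
    have d1 := hasDerivAt_jacobiDn hk0 hk1 x
    have s2 := (hasDerivAt_jacobiSn hk0 hk1 (c - x)).comp_const_sub c x
    have c2 := (hasDerivAt_jacobiCn hk0 hk1 (c - x)).comp_const_sub c x
    have d2 := (hasDerivAt_jacobiDn hk0 hk1 (c - x)).comp_const_sub c x
    have h := (((s1.mul c2).mul d2).add ((s2.mul c1).mul d1)).div
      ((((s1.pow 2).const_mul (k ^ 2)).mul (s2.pow 2)).const_sub 1)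
      (one_sub_jacobiSn_mul_pos hk0 hk1 x (c - x)).ne'
    refine h.congr_deriv (div_eq_zero_iff.2 (Or.inl ?_))
    have e1 := jacobiDn_sq hk0 hk1 x
    have e2 := jacobiDn_sq hk0 hk1 (c - x)
    have e3 : jacobiCn k x ^ 2 = 1 - jacobiSn k x ^ 2 := by
      linarith [jacobiSn_sq_add_jacobiCn_sq k x]
    have e4 : jacobiCn k (c - x) ^ 2 = 1 - jacobiSn k (c - x) ^ 2 := by
      linarith [jacobiSn_sq_add_jacobiCn_sq k (c - x)]
    simp only [Pi.mul_apply, Pi.add_apply, Pi.pow_apply]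
    clear s1 s2 c1 c2 d1 d2 h
    generalize jacobiSn k x = S1 at *
    generalize jacobiSn k (c - x) = S2 at *
    generalize jacobiCn k x = C1 at *
    generalize jacobiCn k (c - x) = C2 at *
    generalize jacobiDn k x = D1 at *
    generalize jacobiDn k (c - x) = D2 at *
    push_cast
    grind
  have h := eq_of_hasDerivAt_eq_zero key c u
  simp only [sub_self, jacobiSn_zero hk0 hk1, jacobiCn_zero hk0 hk1, jacobiDn_zero hk0 hk1] at h
  simp only [hc, add_sub_cancel_left] at h
  rw [← h]
  simp [hc]

theorem jacobiCn_add {k : ℝ} (hk0 : 0 < k) (hk1 : k < 1) (u v : ℝ) :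
    jacobiCn k (u + v) =
      (jacobiCn k u * jacobiCn k v - jacobiSn k u * jacobiSn k v * jacobiDn k u * jacobiDn k v) /
        (1 - k ^ 2 * jacobiSn k u ^ 2 * jacobiSn k v ^ 2) := by
  set c := u + v with hc
  have key : ∀ x, HasDerivAt (fun x =>
      (jacobiCn k x * jacobiCn k (c - x) -
        jacobiSn k x * jacobiSn k (c - x) * jacobiDn k x * jacobiDn k (c - x)) /
        (1 - k ^ 2 * jacobiSn k x ^ 2 * jacobiSn k (c - x) ^ 2)) 0 x := by
    intro x
    have s1 := hasDerivAt_jacobiSn hk0 hk1 x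
    have c1 := hasDerivAt_jacobiCn hk0 hk1 x
    have d1 := hasDerivAt_jacobiDn hk0 hk1 x
    have s2 := (hasDerivAt_jacobiSn hk0 hk1 (c - x)).comp_const_sub c x
    have c2 := (hasDerivAt_jacobiCn hk0 hk1 (c - x)).comp_const_sub c x
    have d2 := (hasDerivAt_jacobiDn hk0 hk1 (c - x)).comp_const_sub c x
    have h := ((c1.mul c2).sub (((s1.mul s2).mul d1).mul d2)).div
      ((((s1.pow 2).const_mul (k ^ 2)).mul (s2.pow 2)).const_sub 1)
      (one_sub_jacobiSn_mul_pos hk0 hk1 x (c - x)).ne'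
    refine h.congr_deriv (div_eq_zero_iff.2 (Or.inl ?_))
    have e1 := jacobiDn_sq hk0 hk1 x
    have e2 := jacobiDn_sq hk0 hk1 (c - x)
    have e3 : jacobiCn k x ^ 2 = 1 - jacobiSn k x ^ 2 := by
      linarith [jacobiSn_sq_add_jacobiCn_sq k x]
    have e4 : jacobiCn k (c - x) ^ 2 = 1 - jacobiSn k (c - x) ^ 2 := by
      linarith [jacobiSn_sq_add_jacobiCn_sq k (c - x)]
    simp only [Pi.mul_apply, Pi.sub_apply, Pi.pow_apply]
    clear s1 s2 c1 c2 d1 d2 h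
    generalize jacobiSn k x = S1 at *
    generalize jacobiSn k (c - x) = S2 at *
    generalize jacobiCn k x = C1 at *
    generalize jacobiCn k (c - x) = C2 at *
    generalize jacobiDn k x = D1 at *
    generalize jacobiDn k (c - x) = D2 at *
    push_cast
    grind
  have h := eq_of_hasDerivAt_eq_zero key c u
  simp only [sub_self, jacobiSn_zero hk0 hk1, jacobiCn_zero hk0 hk1, jacobiDn_zero hk0 hk1] at h
  simp only [hc, add_sub_cancel_left] at h
  rw [← h]
  simp [hc]

theorem jacobiDn_add {k : ℝ} (hk0 : 0 < k) (hk1 : k < 1) (u v : ℝ) :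
    jacobiDn k (u + v) =
      (jacobiDn k u * jacobiDn k v -
        k ^ 2 * (jacobiSn k u * jacobiSn k v * jacobiCn k u * jacobiCn k v)) /
        (1 - k ^ 2 * jacobiSn k u ^ 2 * jacobiSn k v ^ 2) := by
  set c := u + v with hc
  have key : ∀ x, HasDerivAt (fun x =>
      (jacobiDn k x * jacobiDn k (c - x) -
        k ^ 2 * (jacobiSn k x * jacobiSn k (c - x) * jacobiCn k x * jacobiCn k (c - x))) /
        (1 - k ^ 2 * jacobiSn k x ^ 2 * jacobiSn k (c - x) ^ 2)) 0 x := by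
    intro x
    have s1 := hasDerivAt_jacobiSn hk0 hk1 x
    have c1 := hasDerivAt_jacobiCn hk0 hk1 x
    have d1 := hasDerivAt_jacobiDn hk0 hk1 x
    have s2 := (hasDerivAt_jacobiSn hk0 hk1 (c - x)).comp_const_sub c x
    have c2 := (hasDerivAt_jacobiCn hk0 hk1 (c - x)).comp_const_sub c x
    have d2 := (hasDerivAt_jacobiDn hk0 hk1 (c - x)).comp_const_sub c x
    have h := ((d1.mul d2).sub ((((s1.mul s2).mul c1).mul c2).const_mul (k ^ 2))).div
      ((((s1.pow 2).const_mul (k ^ 2)).mul (s2.pow 2)).const_sub 1)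
      (one_sub_jacobiSn_mul_pos hk0 hk1 x (c - x)).ne'
    refine h.congr_deriv (div_eq_zero_iff.2 (Or.inl ?_))
    have e1 := jacobiDn_sq hk0 hk1 x
    have e2 := jacobiDn_sq hk0 hk1 (c - x)
    have e3 : jacobiCn k x ^ 2 = 1 - jacobiSn k x ^ 2 := by
      linarith [jacobiSn_sq_add_jacobiCn_sq k x]
    have e4 : jacobiCn k (c - x) ^ 2 = 1 - jacobiSn k (c - x) ^ 2 := by
      linarith [jacobiSn_sq_add_jacobiCn_sq k (c - x)]
    simp only [Pi.mul_apply, Pi.sub_apply, Pi.pow_apply]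
    clear s1 s2 c1 c2 d1 d2 h
    generalize jacobiSn k x = S1 at *
    generalize jacobiSn k (c - x) = S2 at *
    generalize jacobiCn k x = C1 at *
    generalize jacobiCn k (c - x) = C2 at *
    generalize jacobiDn k x = D1 at *
    generalize jacobiDn k (c - x) = D2 at *
    push_cast
    grind
  have h := eq_of_hasDerivAt_eq_zero key c u
  simp only [sub_self, jacobiSn_zero hk0 hk1, jacobiCn_zero hk0 hk1, jacobiDn_zero hk0 hk1] at h
  simp only [hc, add_sub_cancel_left] at h
  rw [← h]
  simp [hc]

end

section

/-! ### Periodicity, zeros, and identities with two arguments -/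

theorem ellipticK_pos {k : ℝ} (hk0 : 0 < k) (hk1 : k < 1) : 0 < ellipticK k := by
  have := ellipticF_strictMono hk0 hk1 Real.pi_div_two_pos
  rwa [ellipticF_zero] at this

theorem ellipticF_add_pi {k : ℝ} (hk0 : 0 < k) (hk1 : k < 1) (φ : ℝ) :
    ellipticF k (φ + Real.pi) = ellipticF k φ + 2 * ellipticK k := by
  have key : ∀ x, HasDerivAt (fun x => ellipticF k (x + Real.pi) - ellipticF k x) 0 x := by
    intro x
    have h := ((hasDerivAt_ellipticF hk0 hk1 (x + Real.pi)).comp_add_const x Real.pi).sub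
      (hasDerivAt_ellipticF hk0 hk1 x)
    refine h.congr_deriv ?_
    rw [Real.sin_add_pi, neg_sq, sub_self]
  have h := eq_of_hasDerivAt_eq_zero key φ (-(Real.pi / 2))
  simp only [ellipticF_neg] at h
  rw [show -(Real.pi / 2) + Real.pi = Real.pi / 2 by ring] at h
  change _ = ellipticK k - -ellipticK k at h
  linarith

theorem jacobiAm_add_two_mul_ellipticK {k : ℝ} (hk0 : 0 < k) (hk1 : k < 1) (u : ℝ) :
    jacobiAm k (u + 2 * ellipticK k) = jacobiAm k u + Real.pi := by
  rw [jacobiAm_eq_iff hk0 hk1, ellipticF_add_pi hk0 hk1, ellipticF_jacobiAm hk0 hk1]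

theorem jacobiCn_add_two_mul_ellipticK {k : ℝ} (hk0 : 0 < k) (hk1 : k < 1) (u : ℝ) :
    jacobiCn k (u + 2 * ellipticK k) = -jacobiCn k u := by
  simp [jacobiCn, jacobiAm_add_two_mul_ellipticK hk0 hk1, Real.cos_add_pi]

theorem jacobiAm_ellipticK {k : ℝ} (hk0 : 0 < k) (hk1 : k < 1) :
    jacobiAm k (ellipticK k) = Real.pi / 2 := by
  rw [jacobiAm_eq_iff hk0 hk1, ellipticK]

theorem jacobiSn_ellipticK {k : ℝ} (hk0 : 0 < k) (hk1 : k < 1) :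
    jacobiSn k (ellipticK k) = 1 := by
  simp [jacobiSn, jacobiAm_ellipticK hk0 hk1]

theorem jacobiCn_ellipticK {k : ℝ} (hk0 : 0 < k) (hk1 : k < 1) :
    jacobiCn k (ellipticK k) = 0 := by
  simp [jacobiCn, jacobiAm_ellipticK hk0 hk1]

theorem ellipticF_int_mul_pi {k : ℝ} (hk0 : 0 < k) (hk1 : k < 1) (j : ℤ) :
    ellipticF k (j * Real.pi) = 2 * j * ellipticK k := by
  induction j using Int.induction_on with
  | zero => simp [ellipticF_zero]
  | succ i ih =>
    push_cast at ih ⊢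
    rw [add_mul, one_mul, ellipticF_add_pi hk0 hk1, ih]
    ring
  | pred i ih =>
    have h := ellipticF_add_pi hk0 hk1 ((-(i : ℤ) - 1 : ℤ) * Real.pi)
    push_cast at ih h ⊢
    rw [show (-(i : ℝ) - 1) * Real.pi + Real.pi = -i * Real.pi by ring, ih] at h
    linarith

theorem exists_eq_of_jacobiSn_eq_zero {k : ℝ} (hk0 : 0 < k) (hk1 : k < 1) {u : ℝ}
    (h : jacobiSn k u = 0) : ∃ j : ℤ, u = 2 * j * ellipticK k := by
  obtain ⟨j, hj⟩ := Real.sin_eq_zero_iff.1 h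
  refine ⟨j, ?_⟩
  rw [← ellipticF_int_mul_pi hk0 hk1, hj, ellipticF_jacobiAm hk0 hk1]

theorem jacobiSn_mul_ne_zero {k w : ℝ} (hk0 : 0 < k) (hk1 : k < 1)
    (hw : Irrational (w / ellipticK k)) {m : ℤ} (hm : m ≠ 0) : jacobiSn k (w * m) ≠ 0 := by
  intro h
  obtain ⟨j, hj⟩ := exists_eq_of_jacobiSn_eq_zero hk0 hk1 h
  apply hw
  have hK := (ellipticK_pos hk0 hk1).ne'
  have hm' : (m : ℝ) ≠ 0 := by exact_mod_cast hm
  refine ⟨2 * j / m, ?_⟩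
  push_cast
  field_simp
  linarith

/-- The identity behind the Szegő recurrence from even to odd degree. -/
theorem jacobiCn_mul_jacobiSn_add {k : ℝ} (hk0 : 0 < k) (hk1 : k < 1) (u v : ℝ) :
    jacobiCn k v * jacobiSn k (u + v) =
      jacobiDn k v * jacobiSn k u + jacobiCn k (u + v) * jacobiDn k u * jacobiSn k v := by
  rw [jacobiSn_add hk0 hk1, jacobiCn_add hk0 hk1]
  have h := (one_sub_jacobiSn_mul_pos hk0 hk1 u v).ne'
  have e1 := jacobiDn_sq hk0 hk1 u
  have e4 := jacobiSn_sq_add_jacobiCn_sq k v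
  field_simp
  grind

/-- The identity behind the Szegő recurrence from odd to even degree. -/
theorem jacobiDn_mul_jacobiSn_add {k : ℝ} (hk0 : 0 < k) (hk1 : k < 1) (u v : ℝ) :
    jacobiDn k v * jacobiSn k (u + v) =
      jacobiCn k v * jacobiSn k u + jacobiDn k (u + v) * jacobiCn k u * jacobiSn k v := by
  rw [jacobiSn_add hk0 hk1, jacobiDn_add hk0 hk1]
  have h := (one_sub_jacobiSn_mul_pos hk0 hk1 u v).ne'
  have e2 := jacobiDn_sq hk0 hk1 v
  have e3 := jacobiSn_sq_add_jacobiCn_sq k u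
  field_simp
  grind

theorem jacobiSn_add_mul_jacobiSn_sub {k : ℝ} (hk0 : 0 < k) (hk1 : k < 1) (u v : ℝ) :
    jacobiSn k (u + v) * jacobiSn k (u - v) =
      (jacobiSn k u ^ 2 - jacobiSn k v ^ 2) /
        (1 - k ^ 2 * jacobiSn k u ^ 2 * jacobiSn k v ^ 2) := by
  rw [sub_eq_add_neg u v, jacobiSn_add hk0 hk1, jacobiSn_add hk0 hk1, jacobiSn_neg hk0 hk1,
    jacobiCn_neg hk0 hk1, jacobiDn_neg hk0 hk1]
  have h := (one_sub_jacobiSn_mul_pos hk0 hk1 u v).ne'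
  have e1 := jacobiDn_sq hk0 hk1 u
  have e2 := jacobiDn_sq hk0 hk1 v
  have e3 := jacobiSn_sq_add_jacobiCn_sq k u
  have e4 := jacobiSn_sq_add_jacobiCn_sq k v
  rw [neg_sq]
  field_simp
  grind

theorem jacobiDn_add_add_jacobiDn_sub {k : ℝ} (hk0 : 0 < k) (hk1 : k < 1) (u v : ℝ) :
    jacobiDn k (u + v) + jacobiDn k (u - v) =
      2 * jacobiDn k u * jacobiDn k v /
        (1 - k ^ 2 * jacobiSn k u ^ 2 * jacobiSn k v ^ 2) := by
  rw [sub_eq_add_neg u v, jacobiDn_add hk0 hk1, jacobiDn_add hk0 hk1, jacobiSn_neg hk0 hk1,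
    jacobiCn_neg hk0 hk1, jacobiDn_neg hk0 hk1]
  have h := (one_sub_jacobiSn_mul_pos hk0 hk1 u v).ne'
  rw [neg_sq]
  field_simp
  ring

theorem jacobiSn_continuous {k : ℝ} (hk0 : 0 < k) (hk1 : k < 1) : Continuous (jacobiSn k) :=
  Real.continuous_sin.comp (jacobiAm_continuous hk0 hk1)

theorem jacobiCn_continuous {k : ℝ} (hk0 : 0 < k) (hk1 : k < 1) : Continuous (jacobiCn k) :=
  Real.continuous_cos.comp (jacobiAm_continuous hk0 hk1)

theorem jacobiDn_continuous {k : ℝ} (hk0 : 0 < k) (hk1 : k < 1) : Continuous (jacobiDn k) :=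
  continuous_iff_continuousAt.2 fun u => (hasDerivAt_jacobiDn hk0 hk1 u).continuousAt

end

section

/-! ### The Fourier series of `cn` -/

/-- Differentiation under the integral sign for a jointly continuous derivative. -/
theorem hasDerivAt_intervalIntegral_of_continuousOn {F F' : ℝ → ℝ → ℝ} {U : Set ℝ}
    (hU : IsOpen U) (a b : ℝ)
    (hF : ∀ y ∈ U, Continuous (F y))
    (hF' : ContinuousOn (Function.uncurry F') (U ×ˢ Set.univ))
    (hd : ∀ y ∈ U, ∀ x, HasDerivAt (fun y => F y x) (F' y x) y) {y : ℝ} (hy : y ∈ U) :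
    HasDerivAt (fun y => ∫ x in a..b, F y x) (∫ x in a..b, F' y x) y := by
  obtain ⟨r, hr, hrU⟩ := Metric.isOpen_iff.1 hU y hy
  have hsub : Metric.closedBall y (r / 2) ⊆ U :=
    (Metric.closedBall_subset_ball (by linarith)).trans hrU
  obtain ⟨M, hM⟩ := ((isCompact_closedBall y (r / 2)).prod
    (isCompact_uIcc (a := a) (b := b))).exists_bound_of_continuousOn
    (hF'.mono (Set.prod_mono hsub (Set.subset_univ _)))
  have hcont : Continuous (F' y) := by
    have : Continuous fun x : ℝ => (y, x) := by fun_prop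
    exact hF'.comp_continuous this fun x => ⟨hy, trivial⟩
  refine (intervalIntegral.hasDerivAt_integral_of_dominated_loc_of_deriv_le
    (bound := fun _ => M)
    (Metric.closedBall_mem_nhds y (half_pos hr)) ?_ ((hF y hy).intervalIntegrable _ _)
    hcont.aestronglyMeasurable ?_ intervalIntegrable_const ?_).2
  · filter_upwards [hU.mem_nhds hy] with z hz
    exact (hF z hz).aestronglyMeasurable
  · exact Eventually.of_forall fun x hx z hz => hM (z, x) ⟨hz, Set.uIoc_subset_uIcc hx⟩
  · exact Eventually.of_forall fun x _ z hz => hd z (hsub hz) x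

/-- The common denominator of the real and imaginary parts of `cn (x + i y)`, where `l` is the
complementary modulus. -/
noncomputable def cnDenom (k l y x : ℝ) : ℝ := 1 - jacobiDn k x ^ 2 * jacobiSn l y ^ 2

/-- The real part of `cn (x + i y)`, given by Jacobi's imaginary transformation; `l` is the
complementary modulus. -/
noncomputable def cnRe (k l y x : ℝ) : ℝ := jacobiCn k x * jacobiCn l y / cnDenom k l y x

/-- The imaginary part of `cn (x + i y)`; `l` is the complementary modulus. -/
noncomputable def cnIm (k l y x : ℝ) : ℝ :=
  -(jacobiSn k x * jacobiDn k x * (jacobiSn l y * jacobiDn l y)) / cnDenom k l y x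

theorem cnDenom_eq {k l : ℝ} (hk0 : 0 < k) (hk1 : k < 1) (y x : ℝ) :
    cnDenom k l y x =
      jacobiCn l y ^ 2 + k ^ 2 * jacobiSn l y ^ 2 * jacobiSn k x ^ 2 := by
  rw [cnDenom, jacobiDn_sq hk0 hk1]
  linarith [jacobiSn_sq_add_jacobiCn_sq l y]

theorem cnDenom_pos {k l : ℝ} (hk0 : 0 < k) (hk1 : k < 1) {y : ℝ} (hy : jacobiCn l y ≠ 0)
    (x : ℝ) : 0 < cnDenom k l y x := by
  rw [cnDenom_eq hk0 hk1]
  positivity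

/-- The derivative of `cnRe` in `y`; by the Cauchy-Riemann equations also minus the derivative of
`cnIm` in `x`. -/
noncomputable def cnReDerivY (k l y x : ℝ) : ℝ :=
  jacobiCn k x * jacobiSn l y * jacobiDn l y *
    (2 * jacobiDn k x ^ 2 - 1 - jacobiDn k x ^ 2 * jacobiSn l y ^ 2) / cnDenom k l y x ^ 2

/-- The derivative of `cnRe` in `x`; by the Cauchy-Riemann equations also the derivative of
`cnIm` in `y`. -/
noncomputable def cnReDerivX (k l y x : ℝ) : ℝ :=
  -(jacobiSn k x * jacobiDn k x * jacobiCn l y *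
    (1 + jacobiDn k x ^ 2 * jacobiSn l y ^ 2 - 2 * l ^ 2 * jacobiSn l y ^ 2)) /
      cnDenom k l y x ^ 2

section

variable {k l : ℝ}

theorem hasDerivAt_cnDenom_left (hl0 : 0 < l) (hl1 : l < 1) (y x : ℝ) :
    HasDerivAt (fun y => cnDenom k l y x)
      (-(jacobiDn k x ^ 2 * (2 * jacobiSn l y * (jacobiCn l y * jacobiDn l y)))) y := by
  have h := (((hasDerivAt_jacobiSn hl0 hl1 y).pow 2).const_mul (jacobiDn k x ^ 2)).const_sub 1
  refine h.congr_deriv ?_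
  push_cast
  ring

theorem hasDerivAt_cnDenom_right (hk0 : 0 < k) (hk1 : k < 1) (y x : ℝ) :
    HasDerivAt (cnDenom k l y)
      (2 * k ^ 2 * jacobiDn k x * jacobiSn k x * jacobiCn k x * jacobiSn l y ^ 2) x := by
  have h := (((hasDerivAt_jacobiDn hk0 hk1 x).pow 2).mul_const (jacobiSn l y ^ 2)).const_sub 1
  refine h.congr_deriv ?_
  push_cast
  ring

theorem hasDerivAt_cnRe_left (hk0 : 0 < k) (hk1 : k < 1) (hl0 : 0 < l) (hl1 : l < 1) {y : ℝ}
    (hy : jacobiCn l y ≠ 0) (x : ℝ) :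
    HasDerivAt (fun y => cnRe k l y x) (cnReDerivY k l y x) y := by
  have hD := (cnDenom_pos hk0 hk1 hy x).ne'
  have h := ((hasDerivAt_jacobiCn hl0 hl1 y).const_mul (jacobiCn k x)).div
    (hasDerivAt_cnDenom_left (k := k) hl0 hl1 y x) hD
  refine h.congr_deriv ?_
  have e := jacobiSn_sq_add_jacobiCn_sq l y
  unfold cnReDerivY
  congr 1
  unfold cnDenom
  grind

theorem hasDerivAt_cnRe_right (hk0 : 0 < k) (hk1 : k < 1) (hkl : k ^ 2 + l ^ 2 = 1) {y : ℝ}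
    (hy : jacobiCn l y ≠ 0) (x : ℝ) :
    HasDerivAt (cnRe k l y) (cnReDerivX k l y x) x := by
  have hD := (cnDenom_pos hk0 hk1 hy x).ne'
  have h := ((hasDerivAt_jacobiCn hk0 hk1 x).mul_const (jacobiCn l y)).div
    (hasDerivAt_cnDenom_right hk0 hk1 y x) hD
  refine h.congr_deriv ?_
  have e := jacobiSn_sq_add_jacobiCn_sq k x
  have e2 := jacobiDn_sq hk0 hk1 x
  unfold cnReDerivX
  congr 1
  unfold cnDenom
  grind

theorem hasDerivAt_cnIm_left (hk0 : 0 < k) (hk1 : k < 1) (hl0 : 0 < l) (hl1 : l < 1)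
    {y : ℝ} (hy : jacobiCn l y ≠ 0) (x : ℝ) :
    HasDerivAt (fun y => cnIm k l y x) (cnReDerivX k l y x) y := by
  have hD := (cnDenom_pos hk0 hk1 hy x).ne'
  have h := (((hasDerivAt_jacobiSn hl0 hl1 y).mul (hasDerivAt_jacobiDn hl0 hl1 y)).const_mul
    (jacobiSn k x * jacobiDn k x)).neg.div (hasDerivAt_cnDenom_left (k := k) hl0 hl1 y x) hD
  refine h.congr_deriv ?_
  have e2 := jacobiDn_sq hl0 hl1 y
  unfold cnReDerivX
  congr 1
  simp only [Pi.mul_apply, Pi.neg_apply]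
  unfold cnDenom
  grind

theorem hasDerivAt_cnIm_right (hk0 : 0 < k) (hk1 : k < 1) {y : ℝ}
    (hy : jacobiCn l y ≠ 0) (x : ℝ) :
    HasDerivAt (cnIm k l y) (-cnReDerivY k l y x) x := by
  have hD := (cnDenom_pos hk0 hk1 hy x).ne'
  have h := (((hasDerivAt_jacobiSn hk0 hk1 x).mul (hasDerivAt_jacobiDn hk0 hk1 x)).mul_const
    (jacobiSn l y * jacobiDn l y)).neg.div (hasDerivAt_cnDenom_right hk0 hk1 y x) hD
  refine h.congr_deriv ?_
  have e2 := jacobiDn_sq hk0 hk1 x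
  unfold cnReDerivY
  rw [← neg_div]
  congr 1
  simp only [Pi.mul_apply, Pi.neg_apply]
  unfold cnDenom
  grind

theorem continuousOn_uncurry_cnReDerivY (hk0 : 0 < k) (hk1 : k < 1) (hl0 : 0 < l) (hl1 : l < 1) :
    ContinuousOn (Function.uncurry (cnReDerivY k l)) ({y | jacobiCn l y ≠ 0} ×ˢ Set.univ) := by
  have h1 := jacobiSn_continuous hk0 hk1
  have h2 := jacobiCn_continuous hk0 hk1
  have h3 := jacobiDn_continuous hk0 hk1
  have h4 := jacobiSn_continuous hl0 hl1
  have h5 := jacobiCn_continuous hl0 hl1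
  have h6 := jacobiDn_continuous hl0 hl1
  refine ContinuousOn.div ?_ ?_ fun p hp => pow_ne_zero 2 (cnDenom_pos hk0 hk1 hp.1 p.2).ne'
  · fun_prop
  · unfold cnDenom
    fun_prop

theorem continuousOn_uncurry_cnReDerivX (hk0 : 0 < k) (hk1 : k < 1) (hl0 : 0 < l) (hl1 : l < 1) :
    ContinuousOn (Function.uncurry (cnReDerivX k l)) ({y | jacobiCn l y ≠ 0} ×ˢ Set.univ) := by
  have h1 := jacobiSn_continuous hk0 hk1
  have h2 := jacobiCn_continuous hk0 hk1
  have h3 := jacobiDn_continuous hk0 hk1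
  have h4 := jacobiSn_continuous hl0 hl1
  have h5 := jacobiCn_continuous hl0 hl1
  have h6 := jacobiDn_continuous hl0 hl1
  refine ContinuousOn.div ?_ ?_ fun p hp => pow_ne_zero 2 (cnDenom_pos hk0 hk1 hp.1 p.2).ne'
  · fun_prop
  · unfold cnDenom
    fun_prop

theorem continuous_cnReDerivY (hk0 : 0 < k) (hk1 : k < 1) (hl0 : 0 < l) (hl1 : l < 1) {y : ℝ}
    (hy : jacobiCn l y ≠ 0) : Continuous (cnReDerivY k l y) :=
  (continuousOn_uncurry_cnReDerivY hk0 hk1 hl0 hl1).comp_continuous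
    (f := fun x => (y, x)) (by fun_prop) fun _ => ⟨hy, trivial⟩

theorem continuous_cnReDerivX (hk0 : 0 < k) (hk1 : k < 1) (hl0 : 0 < l) (hl1 : l < 1) {y : ℝ}
    (hy : jacobiCn l y ≠ 0) : Continuous (cnReDerivX k l y) :=
  (continuousOn_uncurry_cnReDerivX hk0 hk1 hl0 hl1).comp_continuous
    (f := fun x => (y, x)) (by fun_prop) fun _ => ⟨hy, trivial⟩

theorem continuous_cnRe (hk0 : 0 < k) (hk1 : k < 1) (hkl : k ^ 2 + l ^ 2 = 1) {y : ℝ}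
    (hy : jacobiCn l y ≠ 0) : Continuous (cnRe k l y) :=
  continuous_iff_continuousAt.2 fun x => (hasDerivAt_cnRe_right hk0 hk1 hkl hy x).continuousAt

theorem continuous_cnIm (hk0 : 0 < k) (hk1 : k < 1) {y : ℝ}
    (hy : jacobiCn l y ≠ 0) : Continuous (cnIm k l y) :=
  continuous_iff_continuousAt.2 fun x => (hasDerivAt_cnIm_right hk0 hk1 hy x).continuousAt

theorem isOpen_jacobiCn_ne_zero (hl0 : 0 < l) (hl1 : l < 1) : IsOpen {y | jacobiCn l y ≠ 0} :=
  isOpen_ne.preimage (jacobiCn_continuous hl0 hl1)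

/-- The derivative in `y` of the cosine integral of `Re cn (x + i y)` over a half period, by the
Cauchy-Riemann equations and an integration by parts. -/
theorem hasDerivAt_integral_cnRe_mul_cos (hk0 : 0 < k) (hk1 : k < 1) (hl0 : 0 < l) (hl1 : l < 1)
    (hkl : k ^ 2 + l ^ 2 = 1) {c : ℝ} (hc : Real.cos (c * ellipticK k) = 0) {y : ℝ}
    (hy : jacobiCn l y ≠ 0) :
    HasDerivAt (fun y => ∫ x in -ellipticK k..ellipticK k, cnRe k l y x * Real.cos (c * x))
      (-c * ∫ x in -ellipticK k..ellipticK k, cnIm k l y x * Real.sin (c * x)) y := by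
  have h := hasDerivAt_intervalIntegral_of_continuousOn
    (F := fun y x => cnRe k l y x * Real.cos (c * x))
    (F' := fun y x => cnReDerivY k l y x * Real.cos (c * x))
    (isOpen_jacobiCn_ne_zero hl0 hl1) (-ellipticK k) (ellipticK k)
    (fun y hy => (continuous_cnRe hk0 hk1 hkl hy).mul (by fun_prop))
    ((continuousOn_uncurry_cnReDerivY hk0 hk1 hl0 hl1).mul (by fun_prop))
    (fun y hy x => (hasDerivAt_cnRe_left hk0 hk1 hl0 hl1 hy x).mul_const _) hy
  refine h.congr_deriv ?_
  have hy' := continuous_cnReDerivY hk0 hk1 hl0 hl1 hy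
  have hI := continuous_cnIm (k := k) hk0 hk1 hy
  have hparts := intervalIntegral.integral_eq_sub_of_hasDerivAt
    (a := -ellipticK k) (b := ellipticK k)
    (f := fun x => cnIm k l y x * Real.cos (c * x))
    (f' := fun x => -(cnReDerivY k l y x * Real.cos (c * x)) +
      -c * (cnIm k l y x * Real.sin (c * x)))
    (fun x _ => by
      have := (hasDerivAt_cnIm_right (l := l) hk0 hk1 hy x).mul
        ((hasDerivAt_id x).const_mul c).cos
      refine this.congr_deriv ?_
      simp only [id]
      ring)
    (Continuous.intervalIntegrable (by fun_prop) _ _)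
  rw [intervalIntegral.integral_add (Continuous.intervalIntegrable (by fun_prop) _ _)
    (Continuous.intervalIntegrable (by fun_prop) _ _), intervalIntegral.integral_neg,
    intervalIntegral.integral_const_mul, mul_neg, Real.cos_neg, hc] at hparts
  linarith

theorem hasDerivAt_integral_cnIm_mul_sin (hk0 : 0 < k) (hk1 : k < 1) (hl0 : 0 < l) (hl1 : l < 1)
    (hkl : k ^ 2 + l ^ 2 = 1) (c : ℝ) {y : ℝ} (hy : jacobiCn l y ≠ 0) :
    HasDerivAt (fun y => ∫ x in -ellipticK k..ellipticK k, cnIm k l y x * Real.sin (c * x))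
      (-c * ∫ x in -ellipticK k..ellipticK k, cnRe k l y x * Real.cos (c * x)) y := by
  have h := hasDerivAt_intervalIntegral_of_continuousOn
    (F := fun y x => cnIm k l y x * Real.sin (c * x))
    (F' := fun y x => cnReDerivX k l y x * Real.sin (c * x))
    (isOpen_jacobiCn_ne_zero hl0 hl1) (-ellipticK k) (ellipticK k)
    (fun y hy => (continuous_cnIm hk0 hk1 hy).mul (by fun_prop))
    ((continuousOn_uncurry_cnReDerivX hk0 hk1 hl0 hl1).mul (by fun_prop))
    (fun y hy x => (hasDerivAt_cnIm_left hk0 hk1 hl0 hl1 hy x).mul_const _) hy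
  refine h.congr_deriv ?_
  have hx' := continuous_cnReDerivX hk0 hk1 hl0 hl1 hy
  have hR := continuous_cnRe (k := k) hk0 hk1 hkl hy
  have hparts := intervalIntegral.integral_eq_sub_of_hasDerivAt
    (a := -ellipticK k) (b := ellipticK k)
    (f := fun x => cnRe k l y x * Real.sin (c * x))
    (f' := fun x => cnReDerivX k l y x * Real.sin (c * x) +
      c * (cnRe k l y x * Real.cos (c * x)))
    (fun x _ => by
      have := (hasDerivAt_cnRe_right (l := l) hk0 hk1 hkl hy x).mul
        ((hasDerivAt_id x).const_mul c).sin
      refine this.congr_deriv ?_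
      simp only [id]
      ring)
    (Continuous.intervalIntegrable (by fun_prop) _ _)
  have hK : cnRe k l y (ellipticK k) = 0 := by simp [cnRe, jacobiCn_ellipticK hk0 hk1]
  have hK' : cnRe k l y (-ellipticK k) = 0 := by
    simp [cnRe, jacobiCn_neg hk0 hk1, jacobiCn_ellipticK hk0 hk1]
  rw [intervalIntegral.integral_add (Continuous.intervalIntegrable (by fun_prop) _ _)
    (Continuous.intervalIntegrable (by fun_prop) _ _),
    intervalIntegral.integral_const_mul, hK, hK'] at hparts
  linarith

theorem jacobiCn_pos_of_abs_lt (hl0 : 0 < l) (hl1 : l < 1) {y : ℝ}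
    (hy : y ∈ Set.Ioo (-ellipticK l) (ellipticK l)) : 0 < jacobiCn l y := by
  have h1 := jacobiAm_strictMono hl0 hl1 hy.1
  have h2 := jacobiAm_strictMono hl0 hl1 hy.2
  rw [jacobiAm_neg hl0 hl1, jacobiAm_ellipticK hl0 hl1] at h1
  rw [jacobiAm_ellipticK hl0 hl1] at h2
  exact Real.cos_pos_of_mem_Ioo ⟨h1, h2⟩

/-- On the strip below its first pole, the cosine integral of `Re cn (x + i y)` grows like
`cosh`. -/
theorem integral_cnRe_mul_cos (hk0 : 0 < k) (hk1 : k < 1) (hl0 : 0 < l) (hl1 : l < 1)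
    (hkl : k ^ 2 + l ^ 2 = 1) {c : ℝ} (hc : Real.cos (c * ellipticK k) = 0) {y : ℝ}
    (hy : y ∈ Set.Ioo (-ellipticK l) (ellipticK l)) :
    ∫ x in -ellipticK k..ellipticK k, cnRe k l y x * Real.cos (c * x) =
      (∫ x in -ellipticK k..ellipticK k, jacobiCn k x * Real.cos (c * x)) *
        Real.cosh (c * y) := by
  set G := fun y => ∫ x in -ellipticK k..ellipticK k, cnRe k l y x * Real.cos (c * x) with hG
  set H := fun y => ∫ x in -ellipticK k..ellipticK k, cnIm k l y x * Real.sin (c * x) with hH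
  have hGd : ∀ z ∈ Set.Ioo (-ellipticK l) (ellipticK l), HasDerivAt G (-c * H z) z := fun z hz =>
    hasDerivAt_integral_cnRe_mul_cos hk0 hk1 hl0 hl1 hkl hc (jacobiCn_pos_of_abs_lt hl0 hl1 hz).ne'
  have hHd : ∀ z ∈ Set.Ioo (-ellipticK l) (ellipticK l), HasDerivAt H (-c * G z) z := fun z hz =>
    hasDerivAt_integral_cnIm_mul_sin hk0 hk1 hl0 hl1 hkl c (jacobiCn_pos_of_abs_lt hl0 hl1 hz).ne'
  have hcosh : ∀ z, HasDerivAt (fun z => Real.cosh (c * z)) (c * Real.sinh (c * z)) z := fun z =>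
    (((hasDerivAt_id z).const_mul c).cosh).congr_deriv (by simp only [id]; ring)
  have hsinh : ∀ z, HasDerivAt (fun z => Real.sinh (c * z)) (c * Real.cosh (c * z)) z := fun z =>
    (((hasDerivAt_id z).const_mul c).sinh).congr_deriv (by simp only [id]; ring)
  have h0 : (0 : ℝ) ∈ Set.Ioo (-ellipticK l) (ellipticK l) := by
    have := ellipticK_pos hl0 hl1
    constructor <;> linarith
  have hconst : ∀ Q : ℝ → ℝ,
      (∀ z ∈ Set.Ioo (-ellipticK l) (ellipticK l), HasDerivAt Q 0 z) → Q y = Q 0 := fun Q hQ =>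
    isOpen_Ioo.is_const_of_deriv_eq_zero isPreconnected_Ioo
      (fun z hz => (hQ z hz).differentiableAt.differentiableWithinAt)
      (fun z hz => (hQ z hz).deriv) hy h0
  -- The system `G' = -c H`, `H' = -c G` has two first integrals, which recover `G`.
  have h1 := hconst (fun z => G z * Real.cosh (c * z) + H z * Real.sinh (c * z)) fun z hz =>
    (((hGd z hz).mul (hcosh z)).add ((hHd z hz).mul (hsinh z))).congr_deriv (by ring)
  have h2 := hconst (fun z => G z * Real.sinh (c * z) + H z * Real.cosh (c * z)) fun z hz =>
    (((hGd z hz).mul (hsinh z)).add ((hHd z hz).mul (hcosh z))).congr_deriv (by ring)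
  have hH0 : H 0 = 0 := by simp [hH, cnIm, jacobiSn_zero hl0 hl1]
  have hG0 : G 0 = ∫ x in -ellipticK k..ellipticK k, jacobiCn k x * Real.cos (c * x) := by
    simp [hG, cnRe, cnDenom, jacobiSn_zero hl0 hl1, jacobiCn_zero hl0 hl1]
  simp only [hH0, mul_zero, Real.cosh_zero, Real.sinh_zero] at h1 h2
  rw [← hG0]
  change G y = _
  have h3 := Real.cosh_sq (c * y)
  linear_combination Real.cosh (c * y) * h1 - Real.sinh (c * y) * h2 - G y * h3

/-- A lower bound for `|sn|` which is linear in `|x|`, from Jordan's inequality. -/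
theorem abs_le_mul_abs_jacobiSn (hk0 : 0 < k) (hk1 : k < 1) {x : ℝ}
    (hx : x ∈ Set.Icc (-ellipticK k) (ellipticK k)) :
    |x| ≤ (Real.sqrt (1 - k ^ 2))⁻¹ * (Real.pi / 2) * |jacobiSn k x| := by
  have hpos : ∀ z ∈ Set.Icc 0 (ellipticK k),
      z ≤ (Real.sqrt (1 - k ^ 2))⁻¹ * (Real.pi / 2) * jacobiSn k z := by
    intro z hz
    have hm := (jacobiAm_strictMono hk0 hk1).monotone
    have h1 := hm hz.1
    have h2 := hm hz.2
    rw [jacobiAm_zero hk0 hk1] at h1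
    rw [jacobiAm_ellipticK hk0 hk1] at h2
    have h3 := Real.mul_le_sin h1 h2
    have hk2 : 0 < 1 - k ^ 2 := by nlinarith
    have h4 : z ≤ (Real.sqrt (1 - k ^ 2))⁻¹ * jacobiAm k z := by
      have hc := ellipticF_integrand_continuous hk0 hk1
      have h5 : ellipticF k (jacobiAm k z) ≤
          ∫ _ in (0 : ℝ)..jacobiAm k z, (Real.sqrt (1 - k ^ 2))⁻¹ := by
        refine intervalIntegral.integral_mono h1 (hc.intervalIntegrable _ _) (by simp) fun t => ?_
        refine inv_anti₀ (Real.sqrt_pos.2 hk2) (Real.sqrt_le_sqrt ?_)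
        nlinarith [Real.sin_sq_le_one t, sq_nonneg k]
      rw [ellipticF_jacobiAm hk0 hk1] at h5
      simpa [mul_comm] using h5
    refine h4.trans ?_
    rw [mul_assoc]
    refine mul_le_mul_of_nonneg_left ?_ (by positivity)
    have hp := Real.pi_pos
    calc jacobiAm k z = Real.pi / 2 * (2 / Real.pi * jacobiAm k z) := by field_simp
      _ ≤ Real.pi / 2 * jacobiSn k z := mul_le_mul_of_nonneg_left h3 (by positivity)
  rcases le_total 0 x with h | h
  · rw [abs_of_nonneg h]
    exact (hpos x ⟨h, hx.2⟩).trans (mul_le_mul_of_nonneg_left (le_abs_self _) (by positivity))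
  · rw [abs_of_nonpos h]
    have := hpos (-x) ⟨by linarith, by linarith [hx.1]⟩
    rw [jacobiSn_neg hk0 hk1] at this
    exact this.trans (mul_le_mul_of_nonneg_left (neg_le_abs _) (by positivity))

/-- The functions `cos (c x)` and `dn x` agree to first order at `0`; this is why the one may be
replaced by the other near the pole. -/
theorem abs_cos_sub_jacobiDn_le (hk0 : 0 < k) (hk1 : k < 1) (c : ℝ) :
    ∃ M : ℝ, ∀ x ∈ Set.Icc (-ellipticK k) (ellipticK k),
      |Real.cos (c * x) - jacobiDn k x| ≤ M * jacobiSn k x ^ 2 := by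
  refine ⟨c ^ 2 / 2 * ((Real.sqrt (1 - k ^ 2))⁻¹ * (Real.pi / 2)) ^ 2 + k ^ 2, fun x hx => ?_⟩
  have h1 := Real.one_sub_sq_div_two_le_cos (x := c * x)
  have h2 := Real.cos_le_one (c * x)
  have h3 := abs_le_mul_abs_jacobiSn hk0 hk1 hx
  have h4 := mul_self_le_mul_self (abs_nonneg x) h3
  rw [← sq, ← sq, sq_abs, mul_pow _ |jacobiSn k x|, sq_abs] at h4
  have h5 := jacobiDn_sq hk0 hk1 x
  have h6 := jacobiDn_pos hk0 hk1 x
  have h7 : jacobiDn k x ≤ 1 := by nlinarith [mul_nonneg (sq_nonneg k) (sq_nonneg (jacobiSn k x))]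
  have h8 : 1 - jacobiDn k x ≤ k ^ 2 * jacobiSn k x ^ 2 := by nlinarith
  have h9 : c ^ 2 / 2 * x ^ 2 ≤ c ^ 2 / 2 *
      (((Real.sqrt (1 - k ^ 2))⁻¹ * (Real.pi / 2)) ^ 2 * jacobiSn k x ^ 2) :=
    mul_le_mul_of_nonneg_left h4 (by positivity)
  have h10 : 0 ≤ k ^ 2 * jacobiSn k x ^ 2 := by positivity
  have h11 : 0 ≤ c ^ 2 / 2 * x ^ 2 := by positivity
  rw [abs_le]
  constructor <;> nlinarith

/-- Near the pole at `i K'`, the function `Re cn (x + i y)` acts as `π / k` times an approximate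
identity at `x = 0`. -/
theorem tendsto_integral_cnRe_mul_cos (hk0 : 0 < k) (hk1 : k < 1) (hl0 : 0 < l) (hl1 : l < 1)
    (hkl : k ^ 2 + l ^ 2 = 1) (c : ℝ) :
    Tendsto (fun y => ∫ x in -ellipticK k..ellipticK k, cnRe k l y x * Real.cos (c * x))
      (𝓝[<] ellipticK l) (𝓝 (Real.pi / k)) := by
  obtain ⟨M, hM⟩ := abs_cos_sub_jacobiDn_le hk0 hk1 c
  have hKl := ellipticK_pos hl0 hl1
  have hKk := ellipticK_pos hk0 hk1
  have hs : Tendsto (jacobiSn l) (𝓝[<] ellipticK l) (𝓝 1) := by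
    have := (jacobiSn_continuous hl0 hl1).tendsto (ellipticK l)
    rw [jacobiSn_ellipticK hl0 hl1] at this
    exact this.mono_left nhdsWithin_le_nhds
  have hcn : Tendsto (jacobiCn l) (𝓝[<] ellipticK l) (𝓝 0) := by
    have := (jacobiCn_continuous hl0 hl1).tendsto (ellipticK l)
    rw [jacobiCn_ellipticK hl0 hl1] at this
    exact this.mono_left nhdsWithin_le_nhds
  have hmem : ∀ᶠ y in 𝓝[<] ellipticK l, y ∈ Set.Ioo 0 (ellipticK l) := Ioo_mem_nhdsLT hKl
  have hcpos : ∀ᶠ y in 𝓝[<] ellipticK l, 0 < jacobiCn l y := by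
    filter_upwards [hmem] with y hy
    exact jacobiCn_pos_of_abs_lt hl0 hl1 ⟨by linarith [hy.1], hy.2⟩
  have hspos : ∀ᶠ y in 𝓝[<] ellipticK l, 0 < jacobiSn l y :=
    hs.eventually (lt_mem_nhds one_pos)
  -- With `dn` in place of the cosine, the integral is elementary: see `hint` below.
  have hmain : Tendsto (fun y => 2 * Real.arctan (k * jacobiSn l y / jacobiCn l y) /
      (k * jacobiSn l y)) (𝓝[<] ellipticK l) (𝓝 (Real.pi / k)) := by
    have hks : Tendsto (fun y => k * jacobiSn l y) (𝓝[<] ellipticK l) (𝓝 k) := by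
      simpa using hs.const_mul k
    have hinf : Tendsto (fun y => k * jacobiSn l y / jacobiCn l y) (𝓝[<] ellipticK l) atTop := by
      simp only [div_eq_mul_inv]
      refine hks.pos_mul_atTop hk0 (tendsto_inv_nhdsGT_zero.comp ?_)
      exact tendsto_nhdsWithin_iff.2 ⟨hcn, hcpos⟩
    have hat := (Real.tendsto_arctan_atTop.mono_right nhdsWithin_le_nhds).comp hinf
    have h := (hat.const_mul 2).div hks hk0.ne'
    rwa [mul_div_cancel₀ Real.pi two_ne_zero] at h
  -- The error is at most a multiple of `cn(y) sn(x)² / cnDenom`, where the denominator dominates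
  -- a multiple of `sn(x)²`.
  have herr : Tendsto (fun y => ∫ x in -ellipticK k..ellipticK k,
      cnRe k l y x * (Real.cos (c * x) - jacobiDn k x)) (𝓝[<] ellipticK l) (𝓝 0) := by
    have hb : Tendsto (fun y => jacobiCn l y * M / (k * jacobiSn l y) ^ 2 *
        |ellipticK k - -ellipticK k|) (𝓝[<] ellipticK l) (𝓝 0) := by
      have := (((hcn.mul_const M).div ((hs.const_mul k).pow 2) (by positivity)).mul_const
        |ellipticK k - -ellipticK k|)
      simpa using this
    refine squeeze_zero_norm' ?_ hb
    filter_upwards [hcpos, hspos] with y hc0 hs0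
    refine intervalIntegral.norm_integral_le_of_norm_le_const fun x hx => ?_
    rw [Set.uIoc_of_le (by linarith)] at hx
    have hMx := hM x ⟨hx.1.le, hx.2⟩
    have hD := cnDenom_pos hk0 hk1 hc0.ne' x
    have hDe := cnDenom_eq (l := l) hk0 hk1 y x
    rw [Real.norm_eq_abs, abs_mul, cnRe, abs_div, abs_mul, abs_of_pos hD, abs_of_pos hc0,
      div_mul_eq_mul_div, div_le_div_iff₀ hD (by positivity)]
    have hcn1 : |jacobiCn k x| ≤ 1 := Real.abs_cos_le_one _
    have h1 : |jacobiCn k x| * jacobiCn l y * |Real.cos (c * x) - jacobiDn k x| ≤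
        jacobiCn l y * (M * jacobiSn k x ^ 2) := by
      have h0 : |jacobiCn k x| * jacobiCn l y ≤ jacobiCn l y :=
        mul_le_of_le_one_left hc0.le hcn1
      exact mul_le_mul h0 hMx (abs_nonneg _) hc0.le
    have hM0 : 0 ≤ M * jacobiSn k x ^ 2 := (abs_nonneg _).trans hMx
    by_cases hz : jacobiSn k x = 0
    · rw [hz] at h1
      have hM1 : 0 ≤ M := by
        have hKm := hM (ellipticK k) ⟨by linarith, le_rfl⟩
        rw [jacobiSn_ellipticK hk0 hk1] at hKm
        have := abs_nonneg (Real.cos (c * ellipticK k) - jacobiDn k (ellipticK k))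
        linarith
      have h2 : |jacobiCn k x| * jacobiCn l y * |Real.cos (c * x) - jacobiDn k x| ≤ 0 := by
        simpa using h1
      calc _ ≤ 0 := mul_nonpos_of_nonpos_of_nonneg h2 (by positivity)
        _ ≤ _ := by positivity
    · have hM1 : 0 ≤ M := nonneg_of_mul_nonneg_left hM0 (by positivity)
      calc _ ≤ jacobiCn l y * (M * jacobiSn k x ^ 2) * (k * jacobiSn l y) ^ 2 :=
            mul_le_mul_of_nonneg_right h1 (by positivity)
        _ = jacobiCn l y * M * (k ^ 2 * jacobiSn l y ^ 2 * jacobiSn k x ^ 2) := by ring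
        _ ≤ _ := by
          refine mul_le_mul_of_nonneg_left ?_ (by positivity)
          rw [hDe]
          exact le_add_of_nonneg_left (sq_nonneg _)
  have hsum := hmain.add herr
  rw [add_zero] at hsum
  refine hsum.congr' ?_
  filter_upwards [hcpos, hspos] with y hc0 hs0
  have hR := continuous_cnRe (k := k) hk0 hk1 hkl hc0.ne'
  have hDn := jacobiDn_continuous hk0 hk1
  have hint : ∫ x in -ellipticK k..ellipticK k, cnRe k l y x * jacobiDn k x =
      2 * Real.arctan (k * jacobiSn l y / jacobiCn l y) / (k * jacobiSn l y) := by
    rw [intervalIntegral.integral_eq_sub_of_hasDerivAt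
      (f := fun x => Real.arctan (k * jacobiSn l y / jacobiCn l y * jacobiSn k x) /
        (k * jacobiSn l y)) (fun x _ => ?_) (Continuous.intervalIntegrable (by fun_prop) _ _)]
    · rw [jacobiSn_neg hk0 hk1, jacobiSn_ellipticK hk0 hk1, mul_neg, mul_one, Real.arctan_neg]
      ring
    · have h := (((hasDerivAt_jacobiSn hk0 hk1 x).const_mul
        (k * jacobiSn l y / jacobiCn l y)).arctan).div_const (k * jacobiSn l y)
      refine h.congr_deriv ?_
      have hD := (cnDenom_pos hk0 hk1 hc0.ne' x).ne'
      rw [cnRe]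
      rw [cnDenom_eq hk0 hk1] at hD ⊢
      field_simp
  rw [← hint, ← intervalIntegral.integral_add (Continuous.intervalIntegrable (by fun_prop) _ _)
    (Continuous.intervalIntegrable (by fun_prop) _ _)]
  congr 1
  ext x
  ring

/-- The Fourier integrals of `cn` over a half period. -/
theorem integral_jacobiCn_mul_cos (hk0 : 0 < k) (hk1 : k < 1) {c : ℝ}
    (hc : Real.cos (c * ellipticK k) = 0) :
    ∫ x in -ellipticK k..ellipticK k, jacobiCn k x * Real.cos (c * x) =
      Real.pi / (k * Real.cosh (c * ellipticK' k)) := by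
  have hk2 : 0 < 1 - k ^ 2 := by nlinarith
  set l := Real.sqrt (1 - k ^ 2) with hl
  have hl0 : 0 < l := Real.sqrt_pos.2 hk2
  have hl2 : l ^ 2 = 1 - k ^ 2 := Real.sq_sqrt hk2.le
  have hl1 : l < 1 := by
    by_contra! h
    nlinarith [pow_pos hk0 2]
  have hkl : k ^ 2 + l ^ 2 = 1 := by linarith
  change _ = Real.pi / (k * Real.cosh (c * ellipticK l))
  have h1 := tendsto_integral_cnRe_mul_cos hk0 hk1 hl0 hl1 hkl c
  have h2 : Tendsto (fun y => (∫ x in -ellipticK k..ellipticK k, jacobiCn k x * Real.cos (c * x)) *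
      Real.cosh (c * y)) (𝓝[<] ellipticK l) (𝓝 ((∫ x in -ellipticK k..ellipticK k,
        jacobiCn k x * Real.cos (c * x)) * Real.cosh (c * ellipticK l))) := by
    refine Tendsto.mono_left (Continuous.tendsto ?_ _) nhdsWithin_le_nhds
    have := Real.continuous_cosh
    fun_prop
  have hKl := ellipticK_pos hl0 hl1
  have h3 := tendsto_nhds_unique (h2.congr' ?_) h1
  · have := Real.cosh_pos (c * ellipticK l)
    field_simp at h3 ⊢
    exact h3
  · filter_upwards [Ioo_mem_nhdsLT hKl] with y hy
    exact (integral_cnRe_mul_cos hk0 hk1 hl0 hl1 hkl hc ⟨by linarith [hy.1], hy.2⟩).symm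

end

end

section

variable {k : ℝ}

theorem ellipticK'_pos (hk0 : 0 < k) (hk1 : k < 1) : 0 < ellipticK' k := by
  have hk2 : 0 < 1 - k ^ 2 := by nlinarith
  refine ellipticK_pos (Real.sqrt_pos.2 hk2) ?_
  rw [Real.sqrt_lt' one_pos]
  nlinarith

/-- The frequency `π (s - 1/2) / K` of the `s`-th term in the Fourier series of `cn`. -/
noncomputable def cnFreq (k : ℝ) (s : ℤ) : ℝ := Real.pi * ((s : ℝ) - 1 / 2) / ellipticK k

theorem ellipticNome_pos (k : ℝ) : 0 < ellipticNome k := Real.exp_pos _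

theorem ellipticNome_rpow (k : ℝ) (s : ℤ) :
    ellipticNome k ^ ((s : ℝ) - 1 / 2) = Real.exp (-(cnFreq k s * ellipticK' k)) := by
  rw [ellipticNome, ← Real.exp_mul, cnFreq]
  congr 1
  ring

theorem cnWeight_eq (hk0 : 0 < k) (hk1 : k < 1) (s : ℤ) :
    cnWeight k s =
      1 / (2 * ellipticK k) * (Real.pi / (k * Real.cosh (cnFreq k s * ellipticK' k))) := by
  have hK := ellipticK_pos hk0 hk1
  have h2 : ellipticNome k ^ (-(s : ℝ) + 1 / 2) = Real.exp (cnFreq k s * ellipticK' k) := by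
    rw [show -(s : ℝ) + 1 / 2 = -((s : ℝ) - 1 / 2) by ring, Real.rpow_neg (ellipticNome_pos k).le,
      ellipticNome_rpow, Real.exp_neg, inv_inv]
  rw [cnWeight, h2, ellipticNome_rpow, Real.cosh_eq]
  have h1 := Real.exp_pos (cnFreq k s * ellipticK' k)
  have h3 := Real.exp_pos (-(cnFreq k s * ellipticK' k))
  field_simp
  rw [add_comm]

theorem cnWeight_pos (hk0 : 0 < k) (hk1 : k < 1) (s : ℤ) : 0 < cnWeight k s := by
  rw [cnWeight_eq hk0 hk1]
  have := ellipticK_pos hk0 hk1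
  have := Real.cosh_pos (cnFreq k s * ellipticK' k)
  have := Real.pi_pos
  positivity

theorem cos_cnFreq_mul_ellipticK (hk0 : 0 < k) (hk1 : k < 1) (s : ℤ) :
    Real.cos (cnFreq k s * ellipticK k) = 0 := by
  have hK := (ellipticK_pos hk0 hk1).ne'
  rw [cnFreq, div_mul_cancel₀ _ hK, Real.cos_eq_zero_iff]
  refine ⟨s - 1, ?_⟩
  push_cast
  ring

theorem summable_cnWeight (hk0 : 0 < k) (hk1 : k < 1) : Summable (cnWeight k) := by
  have hK := ellipticK_pos hk0 hk1
  have hK' := ellipticK'_pos hk0 hk1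
  have hp := Real.pi_pos
  set r := Real.exp (-(Real.pi * ellipticK' k / ellipticK k)) with hr
  have hr1 : r < 1 := by
    rw [hr, Real.exp_lt_one_iff, neg_lt_zero]
    positivity
  set C₀ := 1 / (2 * ellipticK k) * (Real.pi / k * 2) *
    Real.exp (Real.pi * ellipticK' k / ellipticK k / 2) with hC
  have hbound : ∀ n : ℕ, ∀ s : ℤ, (n : ℝ) - 1 / 2 ≤ |(s : ℝ) - 1 / 2| →
      cnWeight k s ≤ C₀ * r ^ n := by
    intro n s hs
    have h1 : Real.exp (|cnFreq k s * ellipticK' k|) ≤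
        2 * Real.cosh (cnFreq k s * ellipticK' k) := by
      rw [← Real.cosh_abs, Real.cosh_eq]
      linarith [Real.exp_pos (-|cnFreq k s * ellipticK' k|)]
    have h2 : |cnFreq k s * ellipticK' k| =
        Real.pi * ellipticK' k / ellipticK k * |(s : ℝ) - 1 / 2| := by
      rw [cnFreq, abs_mul, abs_div, abs_mul, abs_of_pos hp, abs_of_pos hK, abs_of_pos hK']
      ring
    have h3 : Real.exp (Real.pi * ellipticK' k / ellipticK k * ((n : ℝ) - 1 / 2)) ≤
        2 * Real.cosh (cnFreq k s * ellipticK' k) := by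
      refine le_trans (Real.exp_le_exp.2 ?_) h1
      rw [h2]
      exact mul_le_mul_of_nonneg_left hs (by positivity)
    have h4 : C₀ * r ^ n = 1 / (2 * ellipticK k) * (Real.pi / k * 2) *
        (Real.exp (Real.pi * ellipticK' k / ellipticK k * ((n : ℝ) - 1 / 2)))⁻¹ := by
      rw [hC, hr, ← Real.exp_nat_mul, mul_assoc _ (Real.exp _), ← Real.exp_add, ← Real.exp_neg]
      congr 2
      ring
    have hch := Real.cosh_pos (cnFreq k s * ellipticK' k)
    rw [cnWeight_eq hk0 hk1, h4]
    have h5 := inv_anti₀ (Real.exp_pos _) h3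
    have h6 := mul_le_mul_of_nonneg_left h5
      (show 0 ≤ 1 / (2 * ellipticK k) * (Real.pi / k * 2) by positivity)
    refine le_trans (le_of_eq ?_) h6
    field_simp
  have hgeo : Summable fun n : ℕ => C₀ * r ^ n :=
    (summable_geometric_of_lt_one (Real.exp_pos _).le hr1).mul_left _
  rw [summable_int_iff_summable_nat_and_neg]
  constructor
  · refine Summable.of_nonneg_of_le (fun n => (cnWeight_pos hk0 hk1 _).le)
      (fun n => hbound n _ ?_) hgeo
    push_cast
    exact le_abs_self _
  · refine Summable.of_nonneg_of_le (fun n => (cnWeight_pos hk0 hk1 _).le)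
      (fun n => hbound n _ ?_) hgeo
    push_cast
    refine le_trans ?_ (neg_le_abs _)
    linarith

/-- The Fourier series of `cn`. -/
theorem hasSum_cnWeight_mul_cos (hk0 : 0 < k) (hk1 : k < 1) (u : ℝ) :
    HasSum (fun s => cnWeight k s * Real.cos (cnFreq k s * u)) (jacobiCn k u) := by
  have hK := ellipticK_pos hk0 hk1
  have : Fact (0 < 2 * ellipticK k) := ⟨by positivity⟩
  have hcn := jacobiCn_continuous hk0 hk1
  have hKc : (ellipticK k : ℂ) ≠ 0 := by exact_mod_cast hK.ne'
  -- Both factors change sign under a shift by `2K`, so their product descends to the circle.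
  set f : ℝ → ℂ := fun u =>
    jacobiCn k u * Complex.exp (Complex.I * (Real.pi * u / (2 * ellipticK k))) with hf
  have hfc : Continuous f := by
    have : Continuous fun u : ℝ => (jacobiCn k u : ℂ) := Complex.continuous_ofReal.comp hcn
    fun_prop
  have hper : Function.Periodic f (2 * ellipticK k) := by
    intro x
    simp only [hf]
    rw [jacobiCn_add_two_mul_ellipticK hk0 hk1]
    have : Complex.I * (Real.pi * ((x + 2 * ellipticK k : ℝ) : ℂ) / (2 * ellipticK k)) =
        Complex.I * (Real.pi * x / (2 * ellipticK k)) + Real.pi * Complex.I := by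
      push_cast
      field_simp
    rw [this, Complex.exp_add, Complex.exp_pi_mul_I]
    push_cast
    ring
  set g : C(AddCircle (2 * ellipticK k), ℂ) :=
    ⟨hper.lift, continuous_coinduced_dom.mpr hfc⟩ with hg
  have hgx : ∀ x : ℝ, g (x : AddCircle (2 * ellipticK k)) = f x := fun x => hper.lift_coe x
  have hcoef : ∀ n : ℤ, fourierCoeff g n = (cnWeight k n : ℂ) := by
    intro n
    rw [fourierCoeff_eq_intervalIntegral _ n (-ellipticK k),
      show -ellipticK k + 2 * ellipticK k = ellipticK k by ring]
    have hi : ∀ x : ℝ, (fourier (-n) (x : AddCircle (2 * ellipticK k))) •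
        g (x : AddCircle (2 * ellipticK k)) =
        ((jacobiCn k x * Real.cos (cnFreq k n * x) : ℝ) : ℂ) -
          Complex.I * ((jacobiCn k x * Real.sin (cnFreq k n * x) : ℝ) : ℂ) := by
      intro x
      rw [hgx, fourier_coe_apply, smul_eq_mul]
      simp only [hf]
      rw [mul_left_comm, ← Complex.exp_add]
      have : 2 * (Real.pi : ℂ) * Complex.I * ((-n : ℤ) : ℂ) * x / ((2 * ellipticK k : ℝ) : ℂ) +
          Complex.I * (Real.pi * x / (2 * ellipticK k)) =
          ((-(cnFreq k n * x) : ℝ) : ℂ) * Complex.I := by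
        rw [cnFreq]
        push_cast
        field_simp
        ring
      rw [this, Complex.exp_mul_I, ← Complex.ofReal_cos, ← Complex.ofReal_sin, Real.cos_neg,
        Real.sin_neg]
      push_cast
      ring
    have hsin : ∫ x in -ellipticK k..ellipticK k, jacobiCn k x * Real.sin (cnFreq k n * x) = 0 := by
      have h := intervalIntegral.integral_comp_neg (a := -ellipticK k) (b := ellipticK k)
        (fun x => jacobiCn k x * Real.sin (cnFreq k n * x))
      simp only [jacobiCn_neg hk0 hk1, mul_neg, Real.sin_neg, intervalIntegral.integral_neg,
        neg_neg] at h
      linarith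
    rw [intervalIntegral.integral_congr (fun x _ => hi x), intervalIntegral.integral_sub
      (Continuous.intervalIntegrable (by fun_prop) _ _)
      (Continuous.intervalIntegrable (by fun_prop) _ _), intervalIntegral.integral_const_mul,
      intervalIntegral.integral_ofReal, intervalIntegral.integral_ofReal, hsin,
      integral_jacobiCn_mul_cos hk0 hk1 (cos_cnFreq_mul_ellipticK hk0 hk1 n),
      cnWeight_eq hk0 hk1, Complex.ofReal_zero, mul_zero, sub_zero, Complex.real_smul,
      ← Complex.ofReal_mul]
  have hsummable : Summable (fourierCoeff g) := by
    have : fourierCoeff g = fun n => (cnWeight k n : ℂ) := funext hcoef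
    rw [this]
    exact_mod_cast summable_cnWeight hk0 hk1
  have h1 := has_pointwise_sum_fourier_series_of_summable hsummable
    (u : AddCircle (2 * ellipticK k))
  have h2 := h1.mul_right (Complex.exp (-(Complex.I * (Real.pi * u / (2 * ellipticK k)))))
  rw [hgx] at h2
  simp only [hf] at h2
  rw [mul_assoc, ← Complex.exp_add, add_neg_cancel, Complex.exp_zero, mul_one] at h2
  have h3 := Complex.hasSum_re h2
  rw [Complex.ofReal_re] at h3
  convert h3 using 2 with s
  rw [hcoef, fourier_coe_apply, smul_eq_mul, mul_assoc, ← Complex.exp_add, Complex.re_ofReal_mul]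
  have : 2 * (Real.pi : ℂ) * Complex.I * (s : ℂ) * u / ((2 * ellipticK k : ℝ) : ℂ) +
      -(Complex.I * (Real.pi * u / (2 * ellipticK k))) =
      ((cnFreq k s * u : ℝ) : ℂ) * Complex.I := by
    rw [cnFreq]
    push_cast
    field_simp
    ring
  rw [this, Complex.exp_ofReal_mul_I_re]

theorem cnPoint_eq_cos (w : ℝ) (s : ℤ) : cnPoint k w s = Real.cos (cnFreq k s * w) := by
  rw [cnPoint, cnFreq]
  congr 1
  ring

/-- The trigonometric moments of the discrete measure are the values `cn (w n)`. -/
theorem hasSum_cnWeight_mul_eval_T (hk0 : 0 < k) (hk1 : k < 1) (w : ℝ) (n : ℤ) :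
    HasSum (fun s => cnWeight k s * (Chebyshev.T ℝ n).eval (cnPoint k w s))
      (jacobiCn k (w * n)) := by
  convert hasSum_cnWeight_mul_cos hk0 hk1 (w * n) using 3 with s
  rw [cnPoint_eq_cos, Chebyshev.T_real_cos]
  congr 1
  ring

theorem hasSum_cnWeight (hk0 : 0 < k) (hk1 : k < 1) : HasSum (cnWeight k) 1 := by
  simpa [jacobiCn_zero hk0 hk1] using hasSum_cnWeight_mul_cos hk0 hk1 0

/-- Density of the points, from density of the subgroup of `ℝ` generated by `π w / K` and `2 π`. -/
theorem closure_range_cnPoint {w : ℝ} (hk0 : 0 < k) (hk1 : k < 1)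
    (hw : Irrational (w / ellipticK k)) :
    closure (Set.range (cnPoint k w)) = Set.Icc (-1) 1 := by
  have hK := (ellipticK_pos hk0 hk1).ne'
  have hp := Real.pi_ne_zero
  apply subset_antisymm
  · refine closure_minimal ?_ isClosed_Icc
    rintro _ ⟨s, rfl⟩
    exact Real.cos_mem_Icc _
  · intro x hx
    have hirr : Irrational (Real.pi * w / ellipticK k / (2 * Real.pi)) := by
      have : Real.pi * w / ellipticK k / (2 * Real.pi) = w / ellipticK k / (2 : ℕ) := by
        push_cast
        field_simp
      rw [this]
      exact hw.div_natCast two_ne_zero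
    have hd := dense_addSubgroupClosure_pair_iff.2 hirr
    set c := Real.pi * w / ellipticK k / 2 with hc
    have hmem := hd (Real.arccos x + c)
    have hcont : Continuous fun t : ℝ => Real.cos (t - c) := by fun_prop
    have h1 := image_closure_subset_closure_image hcont ⟨_, hmem, rfl⟩
    simp only [add_sub_cancel_right, Real.cos_arccos hx.1 hx.2] at h1
    refine closure_mono ?_ h1
    rintro _ ⟨t, ht, rfl⟩
    obtain ⟨a, b, rfl⟩ := AddSubgroup.mem_closure_pair.1 ht
    refine ⟨a, ?_⟩
    simp only [zsmul_eq_mul]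
    rw [cnPoint, ← Real.cos_add_int_mul_two_pi _ b]
    congr 1
    rw [hc]
    ring

end

section

/-! ### The Delsarte-Genin and Szegő transforms -/

theorem aeval_chebyshev_T (n : ℤ) {z : ℂ} (hz : z ≠ 0) :
    aeval ((z + z⁻¹) / 2) (Chebyshev.T ℝ n) = (z ^ n + (z⁻¹) ^ n) / 2 := by
  rw [Polynomial.aeval_def, ← Polynomial.eval_map, Chebyshev.map_T]
  have h1 : (z + z⁻¹) / 2 = Complex.cosh (Complex.log z) := by
    rw [Complex.cosh, Complex.exp_neg, Complex.exp_log hz]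
  rw [h1, Chebyshev.T_complex_cosh, Complex.cosh, Complex.exp_neg, Complex.exp_int_mul,
    Complex.exp_log hz, inv_zpow]

/-- A real polynomial is determined by its values at the points `(z + z⁻¹) / 2`. -/
theorem eq_of_aeval_add_inv_eq {p q : ℝ[X]}
    (h : ∀ z : ℂ, z ≠ 0 → aeval ((z + z⁻¹) / 2) p = aeval ((z + z⁻¹) / 2) q) : p = q := by
  apply Polynomial.map_injective (algebraMap ℝ ℂ) (algebraMap ℝ ℂ).injective
  apply Polynomial.funext
  intro x
  obtain ⟨θ, rfl⟩ := Complex.cos_surjective x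
  have h1 := h (Complex.exp (θ * Complex.I)) (Complex.exp_ne_zero _)
  rw [← Complex.exp_neg, ← neg_mul] at h1
  change aeval (Complex.cos θ) p = aeval (Complex.cos θ) q at h1
  simpa only [Polynomial.eval_map, Polynomial.aeval_def] using h1

theorem isDelsarteGeninTransform_unique {Φ : ℕ → ℝ[X]} {n : ℕ} {S S' : ℝ[X]}
    (h : IsDelsarteGeninTransform Φ n S) (h' : IsDelsarteGeninTransform Φ n S') : S = S' :=
  eq_of_aeval_add_inv_eq fun z hz => (h z hz).trans (h' z hz).symm

theorem isSzegoTransform_unique {Φ : ℕ → ℝ[X]} {n : ℕ} {P P' : ℝ[X]}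
    (h : IsSzegoTransform Φ n P) (h' : IsSzegoTransform Φ n P') : P = P' :=
  eq_of_aeval_add_inv_eq fun z hz => (h z hz).trans (h' z hz).symm

theorem aeval_cnPoly (k w : ℝ) (n : ℕ) (z : ℂ) :
    aeval z (cnPoly k w n) = ∑ s ∈ Finset.range (n + 1), (cnCoeff k w n s : ℂ) * z ^ s := by
  simp [cnPoly]

/-- The Chebyshev form of the Delsarte-Genin transform of the cn-polynomials. -/
theorem isDelsarteGeninTransform_sum_T (k w : ℝ) (n : ℕ) :
    IsDelsarteGeninTransform (cnPoly k w) n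
      (C (2 ^ n * (1 - prevRefl (cnPoly k w) n))⁻¹ * ∑ s ∈ Finset.range (n + 1),
        C (2 * cnCoeff k w n s) * Chebyshev.T ℝ (2 * s - n)) := by
  intro t ht
  rw [map_mul, map_sum, aeval_C, aeval_cnPoly, aeval_cnPoly, Finset.mul_sum, Finset.mul_sum,
    Finset.mul_sum, ← Finset.sum_add_distrib, Finset.sum_div]
  refine Finset.sum_congr rfl fun s _ => ?_
  rw [map_mul, aeval_C, aeval_chebyshev_T _ ht]
  have h1 : t ^ (2 * (s : ℤ) - n) = (t⁻¹) ^ n * (t ^ 2) ^ s := by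
    rw [zpow_sub₀ ht, zpow_natCast, inv_pow, ← pow_mul, ← zpow_natCast t (2 * s)]
    push_cast
    field_simp
  have h2 : (t⁻¹) ^ (2 * (s : ℤ) - n) = t ^ n * ((t ^ 2)⁻¹) ^ s := by
    rw [zpow_sub₀ (inv_ne_zero ht), zpow_natCast, inv_pow, inv_pow, div_inv_eq_mul, ← pow_mul,
      inv_zpow, ← zpow_natCast t (2 * s), mul_comm]
    push_cast
    rfl
  rw [h1, h2]
  simp only [Complex.coe_algebraMap]
  push_cast
  ring

/-- The Chebyshev form of the Szegő transform of the cn-polynomials. -/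
theorem isSzegoTransform_sum_T (k w : ℝ) (n : ℕ) :
    IsSzegoTransform (cnPoly k w) n
      (C (2 ^ n * (1 - prevRefl (cnPoly k w) (2 * n)))⁻¹ * ∑ s ∈ Finset.range (2 * n + 1),
        C (2 * cnCoeff k w (2 * n) s) * Chebyshev.T ℝ (s - n)) := by
  intro t ht
  rw [map_mul, map_sum, aeval_C, aeval_cnPoly, aeval_cnPoly, Finset.mul_sum, Finset.mul_sum,
    Finset.mul_sum, ← Finset.sum_add_distrib, Finset.sum_div]
  refine Finset.sum_congr rfl fun s _ => ?_
  rw [map_mul, aeval_C, aeval_chebyshev_T _ ht]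
  have h1 : t ^ ((s : ℤ) - n) = (t⁻¹) ^ n * t ^ s := by
    rw [zpow_sub₀ ht, zpow_natCast, zpow_natCast, inv_pow]
    field_simp
  have h2 : (t⁻¹) ^ ((s : ℤ) - n) = t ^ n * (t⁻¹) ^ s := by
    rw [zpow_sub₀ (inv_ne_zero ht), zpow_natCast, zpow_natCast, inv_pow, inv_pow, div_inv_eq_mul,
      mul_comm]
  rw [h1, h2]
  simp only [Complex.coe_algebraMap]
  push_cast
  ring

theorem isDelsarteGeninTransform_cnSymmPoly (k w : ℝ) (n : ℕ) :
    IsDelsarteGeninTransform (cnPoly k w) n (cnSymmPoly k w n) :=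
  Classical.epsilon_spec ⟨_, isDelsarteGeninTransform_sum_T k w n⟩

theorem isSzegoTransform_cnIntervalPoly (k w : ℝ) (n : ℕ) :
    IsSzegoTransform (cnPoly k w) n (cnIntervalPoly k w n) :=
  Classical.epsilon_spec ⟨_, isSzegoTransform_sum_T k w n⟩

theorem cnSymmPoly_two_mul (k w : ℝ) (n : ℕ) :
    cnSymmPoly k w (2 * n) =
      C ((1 / 2 : ℝ) ^ n) * (cnIntervalPoly k w n).comp (2 * X ^ 2 - 1) := by
  refine isDelsarteGeninTransform_unique (isDelsarteGeninTransform_cnSymmPoly k w _) fun t ht => ?_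
  have h := isSzegoTransform_cnIntervalPoly k w n (t ^ 2) (pow_ne_zero 2 ht)
  have h1 : aeval ((t + t⁻¹) / 2) (2 * X ^ 2 - 1 : ℝ[X]) = (t ^ 2 + (t ^ 2)⁻¹) / 2 := by
    simp only [map_sub, map_mul, map_pow, aeval_X, map_one, map_ofNat]
    field_simp
    ring
  rw [map_mul, aeval_C, aeval_comp, h1, h]
  simp only [pow_mul, Complex.coe_algebraMap, inv_pow]
  push_cast
  generalize 1 - (prevRefl (cnPoly k w) (2 * n) : ℂ) = D
  rw [show ((2 : ℂ) ^ 2) ^ n = 2 ^ n * 2 ^ n by rw [← pow_mul, ← pow_add, two_mul], mul_assoc,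
    one_div, inv_pow, ← div_div _ ((2 : ℂ) ^ n), inv_mul_eq_div]
  ring

/-! ### The Szegő recurrence of the cn-polynomials -/

/-- The elliptic factorial `sn(w) sn(2w) ⋯ sn(nw)`. -/
noncomputable def snFactorial (k w : ℝ) (n : ℕ) : ℝ :=
  ∏ s ∈ Finset.range n, jacobiSn k (w * ((s : ℝ) + 1))

theorem snFactorial_succ (k w : ℝ) (n : ℕ) :
    snFactorial k w (n + 1) = snFactorial k w n * jacobiSn k (w * ((n : ℝ) + 1)) :=
  Finset.prod_range_succ _ _

theorem snFactorial_ne_zero {k w : ℝ} {N : ℕ}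
    (h : ∀ i < N, jacobiSn k (w * ((i : ℝ) + 1)) ≠ 0) {n : ℕ} (hn : n ≤ N) :
    snFactorial k w n ≠ 0 :=
  Finset.prod_ne_zero_iff.2 fun i hi => h i ((Finset.mem_range.1 hi).trans_le hn)

theorem ellipticBinom_eq_div {k w : ℝ} {N : ℕ}
    (h : ∀ i < N, jacobiSn k (w * ((i : ℝ) + 1)) ≠ 0) {j m : ℕ} (hn : j + m ≤ N) :
    ellipticBinom k w (j + m) j =
      snFactorial k w (j + m) / (snFactorial k w j * snFactorial k w m) := by
  have hm := snFactorial_ne_zero h (show m ≤ N by omega)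
  have hj := snFactorial_ne_zero h (show j ≤ N by omega)
  rw [ellipticBinom, if_pos (Nat.le_add_right _ _), Finset.prod_div_distrib]
  change _ / snFactorial k w j = _
  have key : (∏ s ∈ Finset.range j, jacobiSn k (w * (((j + m : ℕ) : ℝ) - s))) *
      snFactorial k w m = snFactorial k w (j + m) := by
    rw [snFactorial, snFactorial, add_comm j m, Finset.prod_range_add, mul_comm,
      ← Finset.prod_range_reflect _ j]
    congr 1
    refine Finset.prod_congr rfl fun s hs => ?_
    have hs' : s + 1 ≤ j := Finset.mem_range.1 hs
    congr 2
    rw [Nat.sub_sub, add_comm 1 s]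
    push_cast [Nat.cast_sub hs']
    ring
  rw [← key]
  field_simp

theorem ellipticBinom_zero_right (k w : ℝ) (n : ℕ) : ellipticBinom k w n 0 = 1 := by
  simp [ellipticBinom]

theorem ellipticBinom_self {k w : ℝ} {n : ℕ}
    (h : ∀ i < n, jacobiSn k (w * ((i : ℝ) + 1)) ≠ 0) : ellipticBinom k w n n = 1 := by
  have := ellipticBinom_eq_div h (j := n) (m := 0) le_rfl
  rw [add_zero] at this
  rw [this]
  have hn := snFactorial_ne_zero h le_rfl
  rw [show snFactorial k w 0 = 1 from Finset.prod_range_zero _, mul_one, div_self hn]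

/-- The reflection parameters `a_n` of the cn-polynomials. -/
noncomputable def cnRefl (k w : ℝ) (n : ℕ) : ℝ :=
  if Even n then jacobiCn k (w * ((n : ℝ) + 1)) else -jacobiDn k (w * ((n : ℝ) + 1))

section

variable {k w : ℝ}

theorem cnCoeff_zero_right (k w : ℝ) (n : ℕ) :
    cnCoeff k w (n + 1) 0 = -cnRefl k w n := by
  by_cases hn : Even n <;> simp [cnCoeff, cnRefl, hn, Nat.even_add_one, ellipticBinom_zero_right]

theorem cnCoeff_self (hk0 : 0 < k) (hk1 : k < 1) {n : ℕ}
    (h : ∀ i < n, jacobiSn k (w * ((i : ℝ) + 1)) ≠ 0) : cnCoeff k w n n = 1 := by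
  by_cases hn : Even n
  · simp [cnCoeff, hn, jacobiDn_zero hk0 hk1, ellipticBinom_self h]
  · simp [cnCoeff, hn, jacobiCn_zero hk0 hk1, ellipticBinom_self h, pow_succ,
      (Nat.not_even_iff_odd.1 hn).neg_one_pow]

/-- The Szegő recurrence for the middle coefficients. -/
theorem cnCoeff_succ_succ (hk0 : 0 < k) (hk1 : k < 1) {s m : ℕ}
    (h : ∀ i < s + m + 2, jacobiSn k (w * ((i : ℝ) + 1)) ≠ 0) :
    cnCoeff k w (s + m + 2) (s + 1) =
      cnCoeff k w (s + m + 1) s - cnRefl k w (s + m + 1) * cnCoeff k w (s + m + 1) m := by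
  have e1 : ellipticBinom k w (s + m + 2) (s + 1) =
      snFactorial k w (s + m + 2) / (snFactorial k w (s + 1) * snFactorial k w (m + 1)) := by
    have : s + m + 2 = s + 1 + (m + 1) := by omega
    rw [this, ← ellipticBinom_eq_div h (by omega)]
  have e2 : ellipticBinom k w (s + m + 1) s =
      snFactorial k w (s + m + 1) / (snFactorial k w s * snFactorial k w (m + 1)) := by
    rw [add_assoc, ← ellipticBinom_eq_div h (by omega)]
  have e3 : ellipticBinom k w (s + m + 1) m =
      snFactorial k w (s + m + 1) / (snFactorial k w m * snFactorial k w (s + 1)) := by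
    have : s + m + 1 = m + (s + 1) := by omega
    rw [this, ← ellipticBinom_eq_div h (by omega)]
  have hs := snFactorial_ne_zero h (show s ≤ s + m + 2 by omega)
  have hm := snFactorial_ne_zero h (show m ≤ s + m + 2 by omega)
  have hs1 := h s (by omega)
  have hm1 := h m (by omega)
  have a1 : (((s + m + 2 : ℕ) : ℝ) - ((s + 1 : ℕ) : ℝ)) = (m : ℝ) + 1 := by push_cast; ring
  have a2 : (((s + m + 1 : ℕ) : ℝ) - (s : ℝ)) = (m : ℝ) + 1 := by push_cast; ring
  have a3 : (((s + m + 1 : ℕ) : ℝ) - (m : ℝ)) = (s : ℝ) + 1 := by push_cast; ring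
  have a4 : w * (((s + m + 1 : ℕ) : ℝ) + 1) = w * ((s : ℝ) + 1) + w * ((m : ℝ) + 1) := by
    push_cast; ring
  rw [cnCoeff, cnCoeff, cnCoeff, cnRefl, e1, e2, e3, a1, a2, a3,
    show s + m + 2 = s + m + 1 + 1 from rfl, snFactorial_succ k w (s + m + 1),
    snFactorial_succ k w s, snFactorial_succ k w m, a4]
  generalize snFactorial k w (s + m + 1) = F
  generalize w * ((s : ℝ) + 1) = U at *
  generalize w * ((m : ℝ) + 1) = V at *
  by_cases hp : Even (s + m + 1)
  · have key := jacobiCn_mul_jacobiSn_add hk0 hk1 U V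
    -- The parity of `s + m` relates the two signs.
    have hsign : (-1 : ℝ) ^ m = -(-1) ^ s := by
      have := hp.neg_one_pow (α := ℝ)
      rw [pow_succ, pow_add] at this
      rcases neg_one_pow_eq_or ℝ s with h1 | h1 <;> rcases neg_one_pow_eq_or ℝ m with h2 | h2 <;>
        rw [h1, h2] at this ⊢ <;> first | (norm_num; done) | norm_num at this
    simp only [hp, Nat.even_add_one, not_true, if_true, if_false, hsign]
    field_simp
    linear_combination F * (-1) ^ s * key
  · have key := jacobiDn_mul_jacobiSn_add hk0 hk1 U V
    have hsign : (-1 : ℝ) ^ m = (-1) ^ s := by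
      have := (Nat.not_even_iff_odd.1 hp).neg_one_pow (α := ℝ)
      rw [pow_succ, pow_add] at this
      rcases neg_one_pow_eq_or ℝ s with h1 | h1 <;> rcases neg_one_pow_eq_or ℝ m with h2 | h2 <;>
        rw [h1, h2] at this ⊢ <;> first | (norm_num; done) | norm_num at this
    simp only [hp, Nat.even_add_one, not_false_eq_true, if_true, if_false, pow_succ, hsign]
    field_simp
    linear_combination -F * key

/-- The Szegő recurrence `Φ_{n+1}(z) = z Φ_n(z) - a_n Φ_n^*(z)`. -/
theorem aeval_cnPoly_succ (hk0 : 0 < k) (hk1 : k < 1) {n : ℕ}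
    (h : ∀ i < n + 1, jacobiSn k (w * ((i : ℝ) + 1)) ≠ 0) {z : ℂ} (hz : z ≠ 0) :
    aeval z (cnPoly k w (n + 1)) =
      z * aeval z (cnPoly k w n) - cnRefl k w n * (z ^ n * aeval z⁻¹ (cnPoly k w n)) := by
  have hself := cnCoeff_self hk0 hk1 (w := w) (n := n) fun i hi => h i (by omega)
  have hrev : z ^ n * aeval z⁻¹ (cnPoly k w n) =
      ∑ s ∈ Finset.range (n + 1), (cnCoeff k w n (n - s) : ℂ) * z ^ s := by
    rw [aeval_cnPoly, ← Finset.sum_range_reflect, Finset.mul_sum]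
    refine Finset.sum_congr rfl fun s hs => ?_
    have hs' : s ≤ n := Nat.lt_succ_iff.1 (Finset.mem_range.1 hs)
    rw [show n + 1 - 1 - s = n - s by omega, inv_pow, mul_left_comm]
    congr 1
    rw [← div_eq_mul_inv, div_eq_iff (pow_ne_zero _ hz), ← pow_add]
    congr 1
    omega
  rw [hrev, aeval_cnPoly, aeval_cnPoly, Finset.sum_range_succ', Finset.sum_range_succ,
    Finset.sum_range_succ _ n, Finset.sum_range_succ' _ n, cnCoeff_zero_right,
    cnCoeff_self hk0 hk1 h, Nat.sub_zero, hself]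
  have hmid : ∑ s ∈ Finset.range n, (cnCoeff k w (n + 1) (s + 1) : ℂ) * z ^ (s + 1) =
      z * ∑ s ∈ Finset.range n, (cnCoeff k w n s : ℂ) * z ^ s -
        cnRefl k w n *
          ∑ s ∈ Finset.range n, (cnCoeff k w n (n - (s + 1)) : ℂ) * z ^ (s + 1) := by
    rw [Finset.mul_sum, Finset.mul_sum, ← Finset.sum_sub_distrib]
    refine Finset.sum_congr rfl fun s hs => ?_
    obtain ⟨m, rfl⟩ : ∃ m, n = s + m + 1 :=
      ⟨n - s - 1, by have := Finset.mem_range.1 hs; omega⟩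
    rw [show s + m + 1 - (s + 1) = m by omega, cnCoeff_succ_succ hk0 hk1 h]
    push_cast
    ring
  rw [hmid]
  push_cast
  ring

theorem prevRefl_cnPoly_two_mul (k w : ℝ) (n : ℕ) :
    prevRefl (cnPoly k w) (2 * n) = -jacobiDn k (2 * w * n) := by
  rw [prevRefl, cnPoly, Polynomial.eval_finsetSum, Finset.sum_eq_single 0]
  · simp [cnCoeff, ellipticBinom_zero_right]
    congr 1
    ring
  · intro b _ hb
    simp [hb]
  · simp

theorem one_add_jacobiDn_pos (hk0 : 0 < k) (hk1 : k < 1) (u : ℝ) : 0 < 1 + jacobiDn k u := by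
  linarith [jacobiDn_pos hk0 hk1 u]

end

end

section

/-! ### The three-term recurrence and the Chebyshev expansion -/

section

variable {k w : ℝ}

/-- The Szegő transform in terms of `Φ_{2n}` and its reversal. -/
theorem aeval_cnIntervalPoly (k w : ℝ) (n : ℕ) {z : ℂ} (hz : z ≠ 0) :
    aeval ((z + z⁻¹) / 2) (cnIntervalPoly k w n) =
      (aeval z (cnPoly k w (2 * n)) + z ^ (2 * n) * aeval z⁻¹ (cnPoly k w (2 * n))) /
        (2 ^ n * z ^ n * (1 + (jacobiDn k (2 * w * n) : ℂ))) := by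
  rw [isSzegoTransform_cnIntervalPoly k w n z hz, prevRefl_cnPoly_two_mul,
    show z ^ (2 * n) = z ^ n * z ^ n by rw [two_mul, pow_add]]
  push_cast
  rw [sub_neg_eq_add, inv_pow]
  generalize 1 + (jacobiDn k (2 * w * n) : ℂ) = D
  rw [show 2 ^ n * z ^ n * D = z ^ n * (2 ^ n * D) by ring, ← div_div _ (z ^ n)]
  congr 1
  field_simp

/-- The reversed form of the Szegő recurrence. -/
theorem aeval_inv_cnPoly_succ (hk0 : 0 < k) (hk1 : k < 1) {n : ℕ}
    (h : ∀ i < n + 1, jacobiSn k (w * ((i : ℝ) + 1)) ≠ 0) {z : ℂ} (hz : z ≠ 0) :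
    z ^ (n + 1) * aeval z⁻¹ (cnPoly k w (n + 1)) =
      z ^ n * aeval z⁻¹ (cnPoly k w n) - cnRefl k w n * (z * aeval z (cnPoly k w n)) := by
  rw [aeval_cnPoly_succ hk0 hk1 h (inv_ne_zero hz), inv_inv, pow_succ, inv_pow]
  field_simp

theorem cnRefl_two_mul (k w : ℝ) (n : ℕ) :
    cnRefl k w (2 * n) = jacobiCn k (w * (2 * n + 1)) := by
  simp [cnRefl]

theorem cnRefl_two_mul_add_one (k w : ℝ) (n : ℕ) :
    cnRefl k w (2 * n + 1) = -jacobiDn k (2 * w * (n + 1 : ℕ)) := by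
  have h : ¬Even (2 * n + 1) := by simp
  rw [cnRefl, if_neg h]
  congr 2
  push_cast
  ring

/-- Two steps of the Szegő recurrence make the denominator of the Szegő transform cancel. -/
theorem aeval_cnIntervalPoly_succ (hk0 : 0 < k) (hk1 : k < 1) {n : ℕ}
    (h : ∀ i < 2 * n + 2, jacobiSn k (w * ((i : ℝ) + 1)) ≠ 0) {z : ℂ} (hz : z ≠ 0) :
    aeval ((z + z⁻¹) / 2) (cnIntervalPoly k w (n + 1)) =
      (z * aeval z (cnPoly k w (2 * n + 1)) +
        z ^ (2 * n + 1) * aeval z⁻¹ (cnPoly k w (2 * n + 1))) / (2 ^ (n + 1) * z ^ (n + 1)) := by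
  rw [aeval_cnIntervalPoly k w (n + 1) hz, show 2 * (n + 1) = 2 * n + 1 + 1 from rfl,
    aeval_inv_cnPoly_succ hk0 hk1 h hz, aeval_cnPoly_succ hk0 hk1 h hz, cnRefl_two_mul_add_one]
  have hd : (1 + (jacobiDn k (2 * w * (n + 1 : ℕ)) : ℂ)) ≠ 0 := by
    exact_mod_cast (one_add_jacobiDn_pos hk0 hk1 (2 * w * (n + 1 : ℕ))).ne'
  push_cast at hd ⊢
  field_simp
  ring

theorem cnIntervalPoly_zero (hk0 : 0 < k) (hk1 : k < 1) : cnIntervalPoly k w 0 = 1 := by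
  refine eq_of_aeval_add_inv_eq fun z hz => ?_
  rw [aeval_cnIntervalPoly k w 0 hz]
  simp [aeval_cnPoly, cnCoeff, ellipticBinom, jacobiDn_zero hk0 hk1]

theorem cnPoly_zero (hk0 : 0 < k) (hk1 : k < 1) : cnPoly k w 0 = 1 := by
  simp [cnPoly, cnCoeff, ellipticBinom, jacobiDn_zero hk0 hk1]

theorem cnIntervalPoly_one_add (hk0 : 0 < k) (hk1 : k < 1)
    (h : ∀ i < 2, jacobiSn k (w * (((i : ℕ) : ℝ) + 1)) ≠ 0) :
    cnIntervalPoly k w 1 + C (cnB k w 0) * cnIntervalPoly k w 0 = X * cnIntervalPoly k w 0 := by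
  refine eq_of_aeval_add_inv_eq fun z hz => ?_
  have h1 := aeval_cnIntervalPoly_succ (n := 0) hk0 hk1 h hz
  have h2 := aeval_cnPoly_succ (n := 0) hk0 hk1 (fun i hi => h i (by omega)) hz
  have h3 := aeval_inv_cnPoly_succ (n := 0) hk0 hk1 (fun i hi => h i (by omega)) hz
  have h4 := cnRefl_two_mul k w 0
  simp only [zero_add, mul_zero, pow_zero, pow_one, cnPoly_zero hk0 hk1, map_one,
    Nat.cast_zero, mul_one] at h1 h2 h3 h4
  have hb : cnB k w 0 = cnRefl k w 0 := by
    simp [cnB, h4, jacobiDn_zero hk0 hk1]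
    ring
  rw [map_add, map_mul, map_mul, h1, h2, h3, cnIntervalPoly_zero hk0 hk1, hb, aeval_C, aeval_X,
    map_one, Complex.coe_algebraMap]
  field_simp
  ring

theorem cnU_succ_eq (k w : ℝ) (n : ℕ) :
    cnU k w (n + 1) = (1 - cnRefl k w (2 * n) ^ 2) * (1 + cnRefl k w (2 * n + 1)) *
      (1 + jacobiDn k (2 * w * n)) / 4 := by
  rw [cnRefl_two_mul, cnRefl_two_mul_add_one, cnU]
  have h1 : w * (2 * ((n + 1 : ℕ) : ℝ) - 1) = w * (2 * n + 1) := by push_cast; ring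
  have h2 : 2 * w * (((n + 1 : ℕ) : ℝ) - 1) = 2 * w * n := by push_cast; ring
  rw [h1, h2]
  have := jacobiSn_sq_add_jacobiCn_sq k (w * (2 * n + 1))
  linear_combination (1 - jacobiDn k (2 * w * (n + 1 : ℕ))) * (1 + jacobiDn k (2 * w * n)) / 4 *
    this

theorem cnB_succ_eq (k w : ℝ) (n : ℕ) :
    cnB k w (n + 1) = (cnRefl k w (2 * n + 2) * (1 - cnRefl k w (2 * n + 1)) -
      cnRefl k w (2 * n) * (1 + cnRefl k w (2 * n + 1))) / 2 := by
  rw [show 2 * n + 2 = 2 * (n + 1) from rfl, cnRefl_two_mul, cnRefl_two_mul,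
    cnRefl_two_mul_add_one, cnB]
  have h1 : w * (2 * ((n + 1 : ℕ) : ℝ) - 1) = w * (2 * n + 1) := by push_cast; ring
  rw [h1]
  ring

/-- The three-term recurrence, from four steps of the Szegő recurrence. -/
theorem cnIntervalPoly_recurrence (hk0 : 0 < k) (hk1 : k < 1) {n : ℕ}
    (h : ∀ i < 2 * n + 4, jacobiSn k (w * ((i : ℝ) + 1)) ≠ 0) :
    cnIntervalPoly k w (n + 2) + C (cnB k w (n + 1)) * cnIntervalPoly k w (n + 1) +
      C (cnU k w (n + 1)) * cnIntervalPoly k w n = X * cnIntervalPoly k w (n + 1) := by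
  refine eq_of_aeval_add_inv_eq fun z hz => ?_
  have hd : (1 + (jacobiDn k (2 * w * n) : ℂ)) ≠ 0 := by
    exact_mod_cast (one_add_jacobiDn_pos hk0 hk1 (2 * w * n)).ne'
  have p0 := aeval_cnIntervalPoly k w n hz
  have p1 := aeval_cnIntervalPoly_succ (n := n) hk0 hk1 (fun i hi => h i (by omega)) hz
  have p2 := aeval_cnIntervalPoly_succ (n := n + 1) hk0 hk1 (fun i hi => h i (by omega)) hz
  have s1 := aeval_cnPoly_succ (n := 2 * n) hk0 hk1 (fun i hi => h i (by omega)) hz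
  have s2 := aeval_cnPoly_succ (n := 2 * n + 1) hk0 hk1 (fun i hi => h i (by omega)) hz
  have s3 := aeval_cnPoly_succ (n := 2 * n + 2) hk0 hk1 (fun i hi => h i (by omega)) hz
  have r1 := aeval_inv_cnPoly_succ (n := 2 * n) hk0 hk1 (fun i hi => h i (by omega)) hz
  have r2 := aeval_inv_cnPoly_succ (n := 2 * n + 1) hk0 hk1 (fun i hi => h i (by omega)) hz
  have r3 := aeval_inv_cnPoly_succ (n := 2 * n + 2) hk0 hk1 (fun i hi => h i (by omega)) hz
  rw [show 2 * (n + 1) + 1 = 2 * n + 2 + 1 from rfl, s3, r3, s2, r2, s1, r1] at p2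
  rw [s1, r1] at p1
  simp only [map_add, map_mul, aeval_C, aeval_X, Complex.coe_algebraMap, p0, p1, p2, cnU_succ_eq,
    cnB_succ_eq]
  generalize aeval z (cnPoly k w (2 * n)) = A
  generalize z ^ (2 * n) * aeval z⁻¹ (cnPoly k w (2 * n)) = B
  generalize cnRefl k w (2 * n) = α
  generalize cnRefl k w (2 * n + 1) = β
  generalize cnRefl k w (2 * n + 2) = γ
  push_cast
  field_simp
  ring

theorem monic_and_natDegree_of_recurrence {p : ℕ → ℝ[X]} {b u : ℕ → ℝ} (h0 : p 0 = 1)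
    (h1 : p 1 + C (b 0) * p 0 = X * p 0)
    (h2 : ∀ n, p (n + 2) + C (b (n + 1)) * p (n + 1) + C (u (n + 1)) * p n = X * p (n + 1))
    (n : ℕ) : (p n).Monic ∧ (p n).natDegree = n := by
  induction n using Nat.twoStepInduction with
  | zero => simp [h0]
  | one =>
    have : p 1 = X - C (b 0) := by rw [eq_sub_iff_add_eq]; simpa [h0] using h1
    rw [this]
    exact ⟨monic_X_sub_C _, natDegree_X_sub_C _⟩
  | more n ih0 ih1 =>
    have hX : (X * p (n + 1)).Monic := monic_X.mul ih1.1
    have hlt : (C (b (n + 1)) * p (n + 1) + C (u (n + 1)) * p n).natDegree <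
        (X * p (n + 1)).natDegree := by
      have e1 := natDegree_C_mul_le (b (n + 1)) (p (n + 1))
      have e2 := natDegree_C_mul_le (u (n + 1)) (p n)
      have e3 := natDegree_add_le (C (b (n + 1)) * p (n + 1)) (C (u (n + 1)) * p n)
      rw [le_max_iff] at e3
      rw [natDegree_X_mul ih1.1.ne_zero, ih1.2]
      omega
    have he : p (n + 2) = X * p (n + 1) - (C (b (n + 1)) * p (n + 1) + C (u (n + 1)) * p n) := by
      rw [← h2]
      ring
    rw [he]
    refine ⟨hX.sub_of_left (degree_lt_degree hlt), ?_⟩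
    rw [natDegree_sub_eq_left_of_natDegree_lt hlt, natDegree_X_mul ih1.1.ne_zero, ih1.2]

theorem sum_range_two_mul_add_one {M : Type*} [AddCommMonoid M] (n : ℕ) (f : ℕ → M) :
    ∑ s ∈ Finset.range (2 * n + 1), f s =
      f n + ∑ s ∈ Finset.Icc 1 n, (f (n + s) + f (n - s)) := by
  rw [show 2 * n + 1 = n + (n + 1) by omega, Finset.sum_range_add, Finset.sum_range_succ',
    ← Finset.sum_range_reflect, ← Finset.Ico_add_one_right_eq_Icc, Finset.sum_Ico_eq_sum_range,
    Finset.sum_add_distrib, add_zero, add_comm _ (f n), add_left_comm, Nat.add_sub_cancel]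
  congr 1
  rw [add_comm]
  congr 1
  · refine Finset.sum_congr rfl fun s _ => ?_
    rw [add_comm 1 s]
  · refine Finset.sum_congr rfl fun s _ => ?_
    rw [Nat.sub_sub]

/-- The Chebyshev expansion, which groups the terms of `Φ_{2n}` symmetrically about the middle
one. -/
theorem cnIntervalPoly_eq_sum_T {n : ℕ}
    (h : ∀ i < 2 * n, jacobiSn k (w * ((i : ℝ) + 1)) ≠ 0) :
    cnIntervalPoly k w n =
        C ((-1) ^ n * 2 ^ (1 - (n : ℤ)) * (1 + jacobiDn k (2 * w * n))⁻¹) *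
          (C (jacobiDn k (w * n) * ellipticBinom k w (2 * n) n) +
            ∑ s ∈ Finset.Icc 1 n,
              C ((-1) ^ s * ellipticBinom k w (2 * n) (n + s) *
                (jacobiDn k (w * ((n : ℝ) - s)) + jacobiDn k (w * ((n : ℝ) + s)))) *
                Polynomial.Chebyshev.T ℝ (s : ℤ)) := by
  rw [isSzegoTransform_unique (isSzegoTransform_cnIntervalPoly k w n)
    (isSzegoTransform_sum_T k w n), sum_range_two_mul_add_one, prevRefl_cnPoly_two_mul]
  have hc : (2 ^ n * (1 - -jacobiDn k (2 * w * n)))⁻¹ * (2 * (-1) ^ n) =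
      (-1) ^ n * 2 ^ (1 - (n : ℤ)) * (1 + jacobiDn k (2 * w * n))⁻¹ := by
    rw [sub_neg_eq_add, mul_inv, zpow_sub₀ two_ne_zero, zpow_one, zpow_natCast]
    ring
  rw [← hc, C_mul (a := (2 ^ n * (1 - -jacobiDn k (2 * w * n)))⁻¹), mul_assoc (C _) (C _)]
  congr 1
  rw [mul_add, Finset.mul_sum]
  congr 1
  · rw [sub_self, Chebyshev.T_zero, mul_one, ← C_mul]
    congr 1
    have : w * (((2 * n : ℕ) : ℝ) - n) = w * n := by push_cast; ring
    simp only [cnCoeff, even_two_mul, if_true, this]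
    ring
  · refine Finset.sum_congr rfl fun s hs => ?_
    obtain ⟨m, rfl⟩ : ∃ m, n = s + m := ⟨n - s, by have := (Finset.mem_Icc.1 hs).2; omega⟩
    have e1 : ((s + m + s : ℕ) : ℤ) - (s + m : ℕ) = s := by push_cast; ring
    have e2 : ((s + m - s : ℕ) : ℤ) - (s + m : ℕ) = -s := by
      rw [Nat.add_sub_cancel_left]; push_cast; ring
    rw [e1, e2, Chebyshev.T_neg, ← add_mul, ← C_add, ← mul_assoc, ← C_mul]
    congr 2
    have hE : ellipticBinom k w (2 * (s + m)) m = ellipticBinom k w (2 * (s + m)) (s + m + s) := by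
      have a1 : 2 * (s + m) = m + (s + m + s) := by omega
      have a2 : 2 * (s + m) = s + m + s + m := by omega
      have b1 := ellipticBinom_eq_div h (j := m) (m := s + m + s) (by omega)
      have b2 := ellipticBinom_eq_div h (j := s + m + s) (m := m) (by omega)
      rw [← a1] at b1
      rw [← a2] at b2
      rw [b1, b2, mul_comm (snFactorial k w m)]
    have c1 : w * (((2 * (s + m) : ℕ) : ℝ) - ((s + m + s : ℕ) : ℝ)) =
        w * (((s + m : ℕ) : ℝ) - s) := by push_cast; ring
    have c2 : w * (((2 * (s + m) : ℕ) : ℝ) - ((m : ℕ) : ℝ)) =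
        w * (((s + m : ℕ) : ℝ) + s) := by push_cast; ring
    rw [Nat.add_sub_cancel_left]
    simp only [cnCoeff, even_two_mul, if_true, c1, c2, hE]
    have hsq : ((-1 : ℝ) ^ s) * (-1) ^ s = 1 := by rw [← mul_pow]; simp
    rw [pow_add _ (s + m) s, pow_add _ s m]
    linear_combination (-2 * (-1) ^ m * jacobiDn k (w * (((s + m : ℕ) : ℝ) + s)) *
      ellipticBinom k w (2 * (s + m)) (s + m + s)) * hsq

theorem one_sub_jacobiCn_sq_pos {u : ℝ} (h : jacobiSn k u ≠ 0) : 0 < 1 - jacobiCn k u ^ 2 := by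
  have := jacobiSn_sq_add_jacobiCn_sq k u
  have := pow_pos (abs_pos.2 h) 2
  rw [sq_abs] at this
  linarith

theorem jacobiDn_lt_one (hk0 : 0 < k) (hk1 : k < 1) {u : ℝ} (h : jacobiSn k u ≠ 0) :
    jacobiDn k u < 1 := by
  have h1 := jacobiDn_sq hk0 hk1 u
  have h2 := jacobiDn_pos hk0 hk1 u
  have h3 : 0 < k ^ 2 * jacobiSn k u ^ 2 := by positivity
  nlinarith

theorem cnU_succ_pos (hk0 : 0 < k) (hk1 : k < 1) {n : ℕ}
    (h : ∀ i < 2 * n + 2, jacobiSn k (w * ((i : ℝ) + 1)) ≠ 0) : 0 < cnU k w (n + 1) := by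
  rw [cnU_succ_eq, cnRefl_two_mul, cnRefl_two_mul_add_one]
  have h1 : jacobiSn k (w * (2 * n + 1)) ≠ 0 := by
    have := h (2 * n) (by omega)
    push_cast at this
    exact this
  have h2 : jacobiSn k (2 * w * (n + 1 : ℕ)) ≠ 0 := by
    have := h (2 * n + 1) (by omega)
    convert this using 2
    push_cast
    ring
  have h3 := one_sub_jacobiCn_sq_pos h1
  have h4 := jacobiDn_lt_one hk0 hk1 h2
  have h5 := one_add_jacobiDn_pos hk0 hk1 (2 * w * n)
  have h6 : 0 < 1 + -jacobiDn k (2 * w * (n + 1 : ℕ)) := by linarith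
  positivity

end

end

section

/-! ### Orthogonality -/

/-- Favard's argument: if a functional has total mass one and kills `p n` for `n ≥ 1`, then the
three-term recurrence forces orthogonality, with squared norms the products of the `u i`. -/
theorem map_mul_of_recurrence {L : ℝ[X] →ₗ[ℝ] ℝ} {p : ℕ → ℝ[X]} {b u : ℕ → ℝ} (h0 : p 0 = 1)
    (h1 : p 1 + C (b 0) * p 0 = X * p 0)
    (h2 : ∀ n, p (n + 2) + C (b (n + 1)) * p (n + 1) + C (u (n + 1)) * p n = X * p (n + 1))
    (hL0 : L 1 = 1) (hL : ∀ n, L (p (n + 1)) = 0) (n m : ℕ) :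
    L (p n * p m) = if n = m then ∏ i ∈ Finset.Icc 1 n, u i else 0 := by
  have hC : ∀ (c : ℝ) (q : ℝ[X]), L (C c * q) = c * L q := fun c q => by
    rw [← smul_eq_C_mul, map_smul, smul_eq_mul]
  have main : ∀ m n, m ≤ n → L (p m * p n) = if m = n then ∏ i ∈ Finset.Icc 1 m, u i else 0 := by
    intro m
    induction m using Nat.twoStepInduction with
    | zero =>
      rintro (_ | n) _
      · simp [h0, hL0]
      · simp [h0, hL]
    | one =>
      rintro (_ | n) hn
      · omega
      · have e : p 1 * p (n + 1) = p (n + 2) + C (b (n + 1)) * p (n + 1) + C (u (n + 1)) * p n -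
            C (b 0) * p (n + 1) := by
          have : p 1 = X - C (b 0) := by rw [eq_sub_iff_add_eq]; simpa [h0] using h1
          rw [this, h2]
          ring
        rw [e, map_sub, map_add, map_add, hC, hC, hC, hL, hL]
        rcases n with _ | n
        · simp [h0, hL0]
        · simp [hL]
    | more m ih0 ih1 =>
      rintro (_ | n) hn
      · omega
      · have e : p (m + 2) * p (n + 1) = p (m + 1) * p (n + 2) +
            C (b (n + 1)) * (p (m + 1) * p (n + 1)) + C (u (n + 1)) * (p (m + 1) * p n) -
            C (b (m + 1)) * (p (m + 1) * p (n + 1)) - C (u (m + 1)) * (p m * p (n + 1)) := by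
          linear_combination p (n + 1) * h2 m - p (m + 1) * h2 n
        rw [e, map_sub, map_sub, map_add, map_add, hC, hC, hC, hC, ih1 _ (by omega),
          ih1 _ (by omega), ih1 _ (by omega), ih0 _ (by omega)]
        rw [if_neg (by omega), if_neg (by omega), if_neg (show ¬m = n + 1 by omega)]
        by_cases hmn : m + 1 = n
        · subst hmn
          rw [if_pos rfl, if_pos rfl, Finset.prod_Icc_succ_top (by omega : 1 ≤ m + 1 + 1)]
          ring
        · rw [if_neg hmn, if_neg (by omega)]
          ring
  rcases le_total n m with h | h
  · exact main n m h
  · rw [mul_comm, main m n h]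
    by_cases hnm : n = m
    · subst hnm
      rfl
    · rw [if_neg hnm, if_neg (Ne.symm hnm)]

theorem prod_range_erase {M : Type*} [CommMonoid M] (f : ℕ → M) (s m : ℕ) :
    ∏ i ∈ (Finset.range (s + m + 1)).erase s, f i =
      (∏ i ∈ Finset.range s, f i) * ∏ i ∈ Finset.range m, f (s + 1 + i) := by
  induction m with
  | zero => simp [Finset.range_add_one]
  | succ m ih =>
    rw [show s + (m + 1) + 1 = (s + m + 1) + 1 from rfl, Finset.range_add_one,
      Finset.erase_insert_of_ne (by omega), Finset.prod_insert (by simp), ih,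
      Finset.prod_range_succ, mul_comm, mul_assoc, show s + 1 + m = s + m + 1 by omega]

section

variable {k w : ℝ}

theorem prod_jacobiSn_sub (hk0 : 0 < k) (hk1 : k < 1) (w : ℝ) (s m : ℕ) :
    ∏ i ∈ (Finset.range (s + m + 1)).erase s, jacobiSn k (w * s - w * i) =
      (-1) ^ m * snFactorial k w s * snFactorial k w m := by
  have e1 : ∏ i ∈ Finset.range s, jacobiSn k (w * s - w * i) = snFactorial k w s := by
    rw [← Finset.prod_range_reflect, snFactorial]
    refine Finset.prod_congr rfl fun i hi => ?_
    have hi' : i + 1 ≤ s := Finset.mem_range.1 hi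
    congr 1
    rw [Nat.sub_sub, add_comm 1 i]
    push_cast [Nat.cast_sub hi']
    ring
  have e2 : ∏ i ∈ Finset.range m, jacobiSn k (w * s - w * (s + 1 + i : ℕ)) =
      (-1) ^ m * snFactorial k w m := by
    rw [snFactorial, ← Finset.card_range m, ← Finset.prod_const, Finset.card_range,
      ← Finset.prod_mul_distrib]
    refine Finset.prod_congr rfl fun i _ => ?_
    rw [neg_one_mul, ← jacobiSn_neg hk0 hk1]
    congr 1
    push_cast
    ring
  rw [prod_range_erase, e1, e2]
  ring

theorem prod_jacobiSn_add (k w : ℝ) (t n : ℕ) :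
    snFactorial k w t *
      ∏ i ∈ Finset.range (n + 1), jacobiSn k (w * (t + 1 : ℕ) + w * i) =
        snFactorial k w (n + (t + 1)) := by
  rw [show n + (t + 1) = t + (n + 1) by omega, snFactorial, snFactorial,
    Finset.prod_range_add _ t (n + 1)]
  congr 1
  refine Finset.prod_congr rfl fun i _ => ?_
  congr 1
  push_cast
  ring

/-- The products of differences of the nodes `sn² (w i)` are, up to elementary factors, the
products of elliptic factorials in the elliptic binomial coefficients. -/
theorem prod_jacobiSn_sq_sub (hk0 : 0 < k) (hk1 : k < 1)
    (hw : ∀ m : ℤ, m ≠ 0 → jacobiSn k (w * m) ≠ 0) {t m : ℕ} :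
    (∏ i ∈ (Finset.range (t + 1 + m + 1)).erase (t + 1),
        (jacobiSn k (w * (t + 1 : ℕ)) ^ 2 - jacobiSn k (w * i) ^ 2)) *
      (2 * (jacobiCn k (w * (t + 1 : ℕ)) * jacobiDn k (w * (t + 1 : ℕ)))) =
    (∏ i ∈ Finset.range (t + 1 + m + 1),
        (1 - k ^ 2 * jacobiSn k (w * (t + 1 : ℕ)) ^ 2 * jacobiSn k (w * i) ^ 2)) *
      ((-1) ^ m * snFactorial k w (t + 1 + m + (t + 1)) * snFactorial k w m) := by
  set s := t + 1 with hs
  have hmem : s ∈ Finset.range (s + m + 1) := Finset.mem_range.2 (by omega)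
  have h1 : ∏ i ∈ (Finset.range (s + m + 1)).erase s,
      (jacobiSn k (w * s) ^ 2 - jacobiSn k (w * i) ^ 2) =
      (∏ i ∈ (Finset.range (s + m + 1)).erase s,
        (1 - k ^ 2 * jacobiSn k (w * s) ^ 2 * jacobiSn k (w * i) ^ 2)) *
      ((∏ i ∈ (Finset.range (s + m + 1)).erase s, jacobiSn k (w * s + w * i)) *
        ∏ i ∈ (Finset.range (s + m + 1)).erase s, jacobiSn k (w * s - w * i)) := by
    rw [← Finset.prod_mul_distrib, ← Finset.prod_mul_distrib]
    refine Finset.prod_congr rfl fun i _ => ?_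
    rw [jacobiSn_add_mul_jacobiSn_sub hk0 hk1,
      mul_div_cancel₀ _ (one_sub_jacobiSn_mul_pos hk0 hk1 _ _).ne']
  have h2 := Finset.mul_prod_erase _ (fun i : ℕ => jacobiSn k (w * s + w * i)) hmem
  have h3 := Finset.mul_prod_erase _
    (fun i : ℕ => 1 - k ^ 2 * jacobiSn k (w * s) ^ 2 * jacobiSn k (w * i) ^ 2) hmem
  have h4 := prod_jacobiSn_add k w t (s + m)
  have h5 := jacobiSn_add hk0 hk1 (w * s) (w * s)
  rw [eq_div_iff (one_sub_jacobiSn_mul_pos hk0 hk1 _ _).ne'] at h5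
  have h6 := prod_jacobiSn_sub hk0 hk1 w s m
  have hsn : jacobiSn k (w * s) ≠ 0 := by
    have := hw s (by omega)
    exact_mod_cast this
  have hF : snFactorial k w t ≠ 0 := snFactorial_ne_zero (N := t) (fun i _ => by
    have := hw (i + 1) (by omega)
    exact_mod_cast this) le_rfl
  have hFs : snFactorial k w s = snFactorial k w t * jacobiSn k (w * s) := by
    rw [hs, snFactorial_succ]
    push_cast
    rfl
  rw [← hs] at h4
  rw [h1, h6, ← h3]
  rw [← h2] at h4
  rw [hFs]
  rw [← h4]
  refine mul_left_cancel₀ hsn ?_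
  generalize ∏ i ∈ (Finset.range (s + m + 1)).erase s, jacobiSn k (w * s + w * i) = A
  generalize ∏ i ∈ (Finset.range (s + m + 1)).erase s,
    (1 - k ^ 2 * jacobiSn k (w * s) ^ 2 * jacobiSn k (w * i) ^ 2) = B
  linear_combination (-B * A * (-1) ^ m * snFactorial k w t * jacobiSn k (w * s) *
    snFactorial k w m) * h5

theorem jacobiSn_sq_injOn (hk0 : 0 < k) (hk1 : k < 1)
    (hw : ∀ m : ℤ, m ≠ 0 → jacobiSn k (w * m) ≠ 0) (S : Set ℕ) :
    Set.InjOn (fun i : ℕ => jacobiSn k (w * i) ^ 2) S := by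
  intro i _ j _ hij
  simp only at hij
  by_contra hne
  have h := jacobiSn_add_mul_jacobiSn_sub hk0 hk1 (w * i) (w * j)
  rw [hij, sub_self, zero_div] at h
  have h1 := hw (i + j) (by omega)
  have h2 := hw (i - j) (by omega)
  push_cast at h1 h2
  rw [mul_add] at h1
  rw [mul_sub] at h2
  exact mul_ne_zero h1 h2 h

/-- Orthogonality of `P_n` to constants: the sum is the divided difference of order `n` of a
polynomial of degree `n - 1` at the nodes `sn² (w i)`, `0 ≤ i ≤ n`. -/
theorem sum_ellipticBinom_mul_jacobiCn (hk0 : 0 < k) (hk1 : k < 1)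
    (hw : ∀ m : ℤ, m ≠ 0 → jacobiSn k (w * m) ≠ 0) {n : ℕ} (hn : n ≠ 0) :
    jacobiDn k (w * n) * ellipticBinom k w (2 * n) n +
      ∑ s ∈ Finset.Icc 1 n, (-1) ^ s * ellipticBinom k w (2 * n) (n + s) *
        (jacobiDn k (w * ((n : ℝ) - s)) + jacobiDn k (w * ((n : ℝ) + s))) *
          jacobiCn k (w * s) = 0 := by
  obtain ⟨N, rfl⟩ := Nat.exists_eq_succ_of_ne_zero hn
  rw [Nat.succ_eq_add_one]
  have hne : ∀ i < 2 * (N + 1), jacobiSn k (w * ((i : ℝ) + 1)) ≠ 0 := fun i _ => by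
    have := hw (i + 1) (by omega)
    exact_mod_cast this
  set y : ℕ → ℝ := fun i => jacobiSn k (w * i) ^ 2 with hy
  set P : ℝ[X] := ∏ i ∈ Finset.range N, (1 - C (k ^ 2 * y (i + 1)) * X) with hP
  have hdeg : P.natDegree ≤ N := by
    refine (natDegree_prod_le _ _).trans ?_
    refine (Finset.sum_le_card_nsmul _ _ 1 fun i _ => ?_).trans (by simp)
    refine (natDegree_sub_le _ _).trans ?_
    have := natDegree_C_mul_le (k ^ 2 * y (i + 1)) X
    rw [natDegree_X] at this
    simpa using this
  have hdeg' : P.degree < (Finset.range (N + 2)).card := by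
    rw [Finset.card_range]
    refine (degree_le_natDegree).trans_lt ?_
    exact_mod_cast (by omega : P.natDegree < N + 2)
  -- The divided difference of `P` is its coefficient of degree `N + 1`, which vanishes.
  have hLag := Lagrange.coeff_eq_sum (s := Finset.range (N + 2)) (v := y)
    (jacobiSn_sq_injOn hk0 hk1 hw _) hdeg'
  rw [Finset.card_range, coeff_eq_zero_of_natDegree_lt (by omega), Finset.sum_range_succ'] at hLag
  have hPe : ∀ x, P.eval x = ∏ i ∈ Finset.range N, (1 - k ^ 2 * y (i + 1) * x) := fun x => by
    simp [hP, eval_prod]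
  have hy0 : y 0 = 0 := by simp [hy, jacobiSn_zero hk0 hk1]
  have hfac := fun n hn => snFactorial_ne_zero hne (n := n) hn
  have hzero : P.eval (y 0) / ∏ j ∈ (Finset.range (N + 2)).erase 0, (y 0 - y j) =
      (-1) ^ (N + 1) / snFactorial k w (N + 1) ^ 2 := by
    have h1 : P.eval (y 0) = 1 := by
      rw [hPe, hy0]
      simp
    have h2 : ∏ j ∈ (Finset.range (N + 2)).erase 0, (y 0 - y j) =
        (-1) ^ (N + 1) * snFactorial k w (N + 1) ^ 2 := by
      have := prod_range_erase (fun j => y 0 - y j) 0 (N + 1)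
      rw [zero_add] at this
      rw [this, Finset.prod_range_zero, one_mul, snFactorial, ← Finset.prod_pow]
      conv_rhs => rw [← Finset.card_range (N + 1), ← Finset.prod_const, Finset.card_range,
        ← Finset.prod_mul_distrib]
      refine Finset.prod_congr rfl fun i _ => ?_
      rw [hy0]
      simp only [hy]
      push_cast
      rw [add_comm (1 : ℝ), zero_sub, neg_one_mul]
    have hsq : ((-1 : ℝ) ^ (N + 1)) * (-1) ^ (N + 1) = 1 := by rw [← mul_pow]; simp
    have h3 := hfac (N + 1) (by omega)
    rw [h1, h2, div_eq_div_iff (by positivity) (by positivity)]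
    linear_combination (-snFactorial k w (N + 1) ^ 2) * hsq
  have hpos : ∀ t ∈ Finset.range (N + 1),
      P.eval (y (t + 1)) / ∏ j ∈ (Finset.range (N + 2)).erase (t + 1), (y (t + 1) - y j) =
      (-1) ^ (N - t) * (2 * (jacobiCn k (w * (t + 1 : ℕ)) * jacobiDn k (w * (t + 1 : ℕ)))) /
        (1 - k ^ 2 * y (t + 1) * y (N + 1)) /
        (snFactorial k w (N + 1 + (t + 1)) * snFactorial k w (N - t)) := by
    intro t ht
    obtain ⟨m, rfl⟩ : ∃ m, N = t + m :=
      ⟨N - t, by have := Finset.mem_range.1 ht; omega⟩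
    have key := prod_jacobiSn_sq_sub hk0 hk1 hw (t := t) (m := m)
    rw [show t + 1 + m + 1 = t + m + 2 by omega, show t + 1 + m = t + m + 1 by omega] at key
    change (∏ j ∈ (Finset.range (t + m + 2)).erase (t + 1), (y (t + 1) - y j)) * _ =
      (∏ i ∈ Finset.range (t + m + 2), (1 - k ^ 2 * y (t + 1) * y i)) * _ at key
    have hprod : ∏ i ∈ Finset.range (t + m + 2), (1 - k ^ 2 * y (t + 1) * y i) =
        P.eval (y (t + 1)) * (1 - k ^ 2 * y (t + 1) * y (t + m + 1)) := by
      rw [Finset.prod_range_succ, Finset.prod_range_succ', hy0, hPe]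
      rw [mul_zero, sub_zero, mul_one]
      congr 1
      refine Finset.prod_congr rfl fun i _ => ?_
      ring
    rw [hprod] at key
    have hD : 1 - k ^ 2 * y (t + 1) * y (t + m + 1) ≠ 0 :=
      (one_sub_jacobiSn_mul_pos hk0 hk1 _ _).ne'
    have hE : ∏ j ∈ (Finset.range (t + m + 2)).erase (t + 1), (y (t + 1) - y j) ≠ 0 := by
      refine Finset.prod_ne_zero_iff.2 fun j hj h => (Finset.mem_erase.1 hj).1 ?_
      exact (jacobiSn_sq_injOn hk0 hk1 hw Set.univ trivial trivial (sub_eq_zero.1 h)).symm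
    have hF1 := hfac (t + m + 1 + (t + 1)) (by omega)
    have hF2 := hfac m (by omega)
    have hsq : ((-1 : ℝ) ^ m) * (-1) ^ m = 1 := by rw [← mul_pow]; simp
    rw [Nat.add_sub_cancel_left, div_eq_div_iff hE (by positivity), div_mul_eq_mul_div,
      eq_div_iff hD]
    linear_combination (-(-1) ^ m) * key - P.eval (y (t + 1)) *
      (1 - k ^ 2 * y (t + 1) * y (t + m + 1)) * snFactorial k w (t + m + 1 + (t + 1)) *
      snFactorial k w m * hsq
  rw [Finset.sum_congr rfl hpos, hzero] at hLag
  have hE0 : ellipticBinom k w (2 * (N + 1)) (N + 1) =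
      snFactorial k w (2 * (N + 1)) / snFactorial k w (N + 1) ^ 2 := by
    rw [two_mul, ellipticBinom_eq_div hne (by omega), sq]
  rw [← Finset.Ico_add_one_right_eq_Icc, Finset.sum_Ico_eq_sum_range, Nat.add_sub_cancel, hE0]
  have hterm : ∀ t ∈ Finset.range (N + 1),
      (-1) ^ (1 + t) * ellipticBinom k w (2 * (N + 1)) (N + 1 + (1 + t)) *
        (jacobiDn k (w * (((N + 1 : ℕ) : ℝ) - (1 + t : ℕ))) +
          jacobiDn k (w * (((N + 1 : ℕ) : ℝ) + (1 + t : ℕ)))) * jacobiCn k (w * (1 + t : ℕ)) =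
      (-1) ^ (N + 1) * jacobiDn k (w * (N + 1 : ℕ)) * snFactorial k w (2 * (N + 1)) *
      ((-1) ^ (N - t) * (2 * (jacobiCn k (w * (t + 1 : ℕ)) * jacobiDn k (w * (t + 1 : ℕ)))) /
        (1 - k ^ 2 * y (t + 1) * y (N + 1)) /
        (snFactorial k w (N + 1 + (t + 1)) * snFactorial k w (N - t))) := by
    intro t ht
    obtain ⟨m, rfl⟩ : ∃ m, N = t + m :=
      ⟨N - t, by have := Finset.mem_range.1 ht; omega⟩
    have hE : ellipticBinom k w (2 * (t + m + 1)) (t + m + 1 + (t + 1)) =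
        snFactorial k w (2 * (t + m + 1)) /
          (snFactorial k w (t + m + 1 + (t + 1)) * snFactorial k w m) := by
      have : 2 * (t + m + 1) = t + m + 1 + (t + 1) + m := by omega
      rw [this, ellipticBinom_eq_div hne (by omega)]
    have hdn := jacobiDn_add_add_jacobiDn_sub hk0 hk1 (w * (t + m + 1 : ℕ)) (w * (t + 1 : ℕ))
    have hD : 1 - k ^ 2 * y (t + 1) * y (t + m + 1) ≠ 0 :=
      (one_sub_jacobiSn_mul_pos hk0 hk1 _ _).ne'
    have hDe : 1 - k ^ 2 * jacobiSn k (w * (t + m + 1 : ℕ)) ^ 2 *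
        jacobiSn k (w * (t + 1 : ℕ)) ^ 2 = 1 - k ^ 2 * y (t + 1) * y (t + m + 1) := by
      simp only [hy]
      ring
    rw [hDe] at hdn
    have hF1 := hfac (t + m + 1 + (t + 1)) (by omega)
    have hF2 := hfac m (by omega)
    have hsign : (-1 : ℝ) ^ (t + m + 1) * (-1) ^ m = (-1) ^ (1 + t) := by
      rw [← pow_add, show t + m + 1 + m = 1 + t + 2 * m by omega, pow_add _ (1 + t), pow_mul]
      simp
    rw [add_comm 1 t, hE, Nat.add_sub_cancel_left, mul_sub w, mul_add w, add_comm (jacobiDn k _),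
      hdn, add_comm t 1, ← hsign, add_comm 1 t]
    field_simp
  rw [Finset.sum_congr rfl hterm, ← Finset.mul_sum]
  have hsq : ((-1 : ℝ) ^ (N + 1)) * (-1) ^ (N + 1) = 1 := by rw [← mul_pow]; simp
  have hF1 := hfac (N + 1) (by omega)
  generalize (∑ t ∈ Finset.range (N + 1), _ : ℝ) = Q at hLag ⊢
  have hS : Q = -((-1) ^ (N + 1) / snFactorial k w (N + 1) ^ 2) := by linarith
  rw [hS]
  field_simp
  linear_combination (-(jacobiDn k (w * (N + 1 : ℕ)) * snFactorial k w (2 * (N + 1)))) * hsq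

theorem summable_cnWeight_mul_eval (hk0 : 0 < k) (hk1 : k < 1) (w : ℝ) (p : ℝ[X]) :
    Summable fun s => cnWeight k s * p.eval (cnPoint k w s) := by
  obtain ⟨M, hM⟩ := (isCompact_Icc (a := (-1 : ℝ)) (b := 1)).exists_bound_of_continuousOn
    p.continuous.continuousOn
  refine Summable.of_norm_bounded ((summable_cnWeight hk0 hk1).mul_right M) fun s => ?_
  rw [norm_mul, Real.norm_of_nonneg (cnWeight_pos hk0 hk1 s).le]
  exact mul_le_mul_of_nonneg_left (hM _ (Real.cos_mem_Icc _)) (cnWeight_pos hk0 hk1 s).le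

/-- Integration of polynomials against the discrete measure `∑ ρ_s δ_{x_s}`. -/
noncomputable def cnFunctional (hk0 : 0 < k) (hk1 : k < 1) (w : ℝ) : ℝ[X] →ₗ[ℝ] ℝ where
  toFun p := ∑' s, cnWeight k s * p.eval (cnPoint k w s)
  map_add' p q := by
    rw [← (summable_cnWeight_mul_eval hk0 hk1 w p).tsum_add
      (summable_cnWeight_mul_eval hk0 hk1 w q)]
    simp only [eval_add, mul_add]
  map_smul' c p := by
    simp only [eval_smul, smul_eq_mul, mul_left_comm _ c, tsum_mul_left, RingHom.id_apply]

theorem hasSum_cnFunctional (hk0 : 0 < k) (hk1 : k < 1) (w : ℝ) (p : ℝ[X]) :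
    HasSum (fun s => cnWeight k s * p.eval (cnPoint k w s)) (cnFunctional hk0 hk1 w p) :=
  (summable_cnWeight_mul_eval hk0 hk1 w p).hasSum

theorem cnFunctional_T (hk0 : 0 < k) (hk1 : k < 1) (w : ℝ) (n : ℤ) :
    cnFunctional hk0 hk1 w (Chebyshev.T ℝ n) = jacobiCn k (w * n) :=
  (hasSum_cnWeight_mul_eval_T hk0 hk1 w n).tsum_eq

theorem cnFunctional_cnIntervalPoly_succ (hk0 : 0 < k) (hk1 : k < 1)
    (hw : ∀ m : ℤ, m ≠ 0 → jacobiSn k (w * m) ≠ 0) (n : ℕ) :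
    cnFunctional hk0 hk1 w (cnIntervalPoly k w (n + 1)) = 0 := by
  have hC : ∀ (c : ℝ) (q : ℝ[X]), cnFunctional hk0 hk1 w (C c * q) =
      c * cnFunctional hk0 hk1 w q := fun c q => by
    rw [← smul_eq_C_mul, map_smul, smul_eq_mul]
  rw [cnIntervalPoly_eq_sum_T (n := n + 1) fun i _ => by
      have := hw (i + 1) (by omega)
      exact_mod_cast this, hC]
  refine mul_eq_zero_of_right _ ?_
  rw [map_add, map_sum, ← sum_ellipticBinom_mul_jacobiCn hk0 hk1 hw (Nat.succ_ne_zero n)]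
  congr 1
  · rw [← mul_one (C _), ← Chebyshev.T_zero, hC, cnFunctional_T]
    simp [jacobiCn_zero hk0 hk1]
  · refine Finset.sum_congr rfl fun s _ => ?_
    rw [hC, cnFunctional_T]
    simp

end

end

section

/-! ### The limit of the Jacobi functions as the modulus tends to one -/

theorem tendsto_ellipticF_one {φ : ℝ} (hφ : φ ∈ Set.Ioo (-(Real.pi / 2)) (Real.pi / 2)) :
    Tendsto (fun k => ellipticF k φ) (𝓝[<] 1)
      (𝓝 ((Real.log (1 + Real.sin φ) - Real.log (1 - Real.sin φ)) / 2)) := by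
  have hsub : Set.uIcc 0 φ ⊆ Set.Ioo (-(Real.pi / 2)) (Real.pi / 2) := by
    have := Real.pi_div_two_pos
    exact (Set.ordConnected_Ioo).uIcc_subset ⟨by linarith, this⟩ hφ
  have hcos : ∀ t ∈ Set.uIcc 0 φ, 0 < Real.cos t := fun t ht =>
    Real.cos_pos_of_mem_Ioo (hsub ht)
  have hsqrt : ∀ t ∈ Set.uIcc 0 φ, Real.sqrt (1 - Real.sin t ^ 2) = Real.cos t := fun t ht => by
    rw [← Real.cos_sq', Real.sqrt_sq (hcos t ht).le]
  have hcont : ContinuousOn (fun t => (Real.cos t)⁻¹) (Set.uIcc 0 φ) :=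
    Real.continuous_cos.continuousOn.inv₀ fun t ht => (hcos t ht).ne'
  have hint : ∫ t in (0 : ℝ)..φ, (Real.cos t)⁻¹ =
      (Real.log (1 + Real.sin φ) - Real.log (1 - Real.sin φ)) / 2 := by
    rw [intervalIntegral.integral_eq_sub_of_hasDerivAt
      (f := fun t => (Real.log (1 + Real.sin t) - Real.log (1 - Real.sin t)) / 2)
      (fun t ht => ?_) hcont.intervalIntegrable]
    · simp
    · have hc := hcos t ht
      have hcs := Real.sin_sq_add_cos_sq t
      have h1 : 0 < 1 + Real.sin t := by nlinarith
      have h2 : 0 < 1 - Real.sin t := by nlinarith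
      refine (((((Real.hasDerivAt_sin t).const_add 1).log h1.ne').sub
        (((Real.hasDerivAt_sin t).const_sub 1).log h2.ne')).div_const 2).congr_deriv ?_
      field_simp
      linear_combination (2 : ℝ) * hcs
  rw [← hint]
  refine intervalIntegral.tendsto_integral_filter_of_dominated_convergence
    (fun t => (Real.cos t)⁻¹) ?_ ?_ hcont.intervalIntegrable ?_
  · filter_upwards [Ioo_mem_nhdsLT zero_lt_one] with k hk
    exact (ellipticF_integrand_continuous hk.1 hk.2).aestronglyMeasurable
  · filter_upwards [Ioo_mem_nhdsLT zero_lt_one] with k hk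
    refine Eventually.of_forall fun t ht => ?_
    have ht' := Set.uIoc_subset_uIcc ht
    rw [Real.norm_of_nonneg (inv_nonneg.2 (Real.sqrt_nonneg _))]
    refine inv_anti₀ (hcos t ht') ?_
    rw [← hsqrt t ht']
    refine Real.sqrt_le_sqrt ?_
    have : k ^ 2 ≤ 1 := pow_le_one₀ hk.1.le hk.2.le
    nlinarith [sq_nonneg (Real.sin t)]
  · refine Eventually.of_forall fun t ht => ?_
    have ht' := Set.uIoc_subset_uIcc ht
    have hc : ContinuousAt (fun k : ℝ => (Real.sqrt (1 - k ^ 2 * Real.sin t ^ 2))⁻¹) 1 := by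
      refine ContinuousAt.inv₀ (by fun_prop) ?_
      rw [one_pow, one_mul, hsqrt t ht']
      exact (hcos t ht').ne'
    have := hc.tendsto
    rw [one_pow, one_mul, hsqrt t ht'] at this
    exact this.mono_left nhdsWithin_le_nhds

theorem log_one_add_tanh_sub (u : ℝ) :
    (Real.log (1 + Real.tanh u) - Real.log (1 - Real.tanh u)) / 2 = u := by
  have hc := Real.cosh_pos u
  have h1 : 1 + Real.tanh u = Real.exp u / Real.cosh u := by
    rw [Real.tanh_eq_sinh_div_cosh, ← Real.cosh_add_sinh]
    field_simp
  have h2 : 1 - Real.tanh u = Real.exp (-u) / Real.cosh u := by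
    rw [Real.tanh_eq_sinh_div_cosh, ← Real.cosh_sub_sinh]
    field_simp
  rw [h1, h2, Real.log_div (Real.exp_pos _).ne' hc.ne', Real.log_div (Real.exp_pos _).ne' hc.ne',
    Real.log_exp, Real.log_exp]
  ring

/-- As `k → 1`, the amplitude tends to the Gudermannian function; this is read off from the
monotonicity of `F (·, k)` and the limits of its values. -/
theorem tendsto_jacobiAm_one (u : ℝ) :
    Tendsto (fun k => jacobiAm k u) (𝓝[<] 1) (𝓝 (Real.arcsin (Real.tanh u))) := by
  have hlt := Real.tanh_lt_one u
  have hgt := Real.neg_one_lt_tanh u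
  have hsin : Real.sin (Real.arcsin (Real.tanh u)) = Real.tanh u :=
    Real.sin_arcsin hgt.le hlt.le
  have h1 : Real.arcsin (Real.tanh u) < Real.pi / 2 := Real.arcsin_lt_pi_div_two.2 hlt
  have h2 : -(Real.pi / 2) < Real.arcsin (Real.tanh u) := Real.neg_pi_div_two_lt_arcsin.2 hgt
  have hs : ∀ φ ∈ Set.Ioo (-(Real.pi / 2)) (Real.pi / 2), 0 < 1 + Real.sin φ ∧ 0 < 1 - Real.sin φ :=
    fun φ hφ => by
      have hc := Real.cos_pos_of_mem_Ioo hφ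
      have hcs := Real.sin_sq_add_cos_sq φ
      constructor <;> nlinarith
  refine tendsto_order.2 ⟨fun a ha => ?_, fun a ha => ?_⟩
  · obtain ⟨b, hb1, hb2⟩ := exists_between (max_lt ha h2)
    have hb : b ∈ Set.Ioo (-(Real.pi / 2)) (Real.pi / 2) :=
      ⟨(le_max_right _ _).trans_lt hb1, hb2.trans h1⟩
    have hsb : Real.sin b < Real.tanh u := by
      rw [← hsin]
      exact Real.strictMonoOn_sin ⟨hb.1.le, hb.2.le⟩ ⟨h2.le, h1.le⟩ hb2
    have hlim : (Real.log (1 + Real.sin b) - Real.log (1 - Real.sin b)) / 2 < u := by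
      conv_rhs => rw [← log_one_add_tanh_sub u]
      have e1 := Real.log_lt_log (hs b hb).1 (add_lt_add_right hsb 1)
      have e2 := Real.log_lt_log (by linarith) (sub_lt_sub_left hsb 1)
      linarith
    filter_upwards [(tendsto_ellipticF_one hb).eventually (gt_mem_nhds hlim),
      Ioo_mem_nhdsLT zero_lt_one] with k hk hk'
    have := jacobiAm_strictMono hk'.1 hk'.2 hk
    rw [jacobiAm_ellipticF hk'.1 hk'.2] at this
    exact ((le_max_left _ _).trans_lt hb1).trans this
  · obtain ⟨b, hb2, hb1⟩ := exists_between (lt_min ha h1)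
    have hb : b ∈ Set.Ioo (-(Real.pi / 2)) (Real.pi / 2) :=
      ⟨h2.trans hb2, hb1.trans_le (min_le_right _ _)⟩
    have hsb : Real.tanh u < Real.sin b := by
      rw [← hsin]
      exact Real.strictMonoOn_sin ⟨h2.le, h1.le⟩ ⟨hb.1.le, hb.2.le⟩ hb2
    have hlim : u < (Real.log (1 + Real.sin b) - Real.log (1 - Real.sin b)) / 2 := by
      conv_lhs => rw [← log_one_add_tanh_sub u]
      have e1 := Real.log_lt_log (by linarith) (add_lt_add_right hsb 1)
      have e2 := Real.log_lt_log (hs b hb).2 (sub_lt_sub_left hsb 1)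
      linarith
    filter_upwards [(tendsto_ellipticF_one hb).eventually (lt_mem_nhds hlim),
      Ioo_mem_nhdsLT zero_lt_one] with k hk hk'
    have := jacobiAm_strictMono hk'.1 hk'.2 hk
    rw [jacobiAm_ellipticF hk'.1 hk'.2] at this
    exact this.trans (hb1.trans_le (min_le_left _ _))

theorem sin_arcsin_tanh (u : ℝ) : Real.sin (Real.arcsin (Real.tanh u)) = Real.tanh u :=
  Real.sin_arcsin (Real.neg_one_lt_tanh u).le (Real.tanh_lt_one u).le

theorem tendsto_jacobiSn_one (u : ℝ) :
    Tendsto (fun k => jacobiSn k u) (𝓝[<] 1) (𝓝 (Real.tanh u)) := by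
  have := (Real.continuous_sin.tendsto _).comp (tendsto_jacobiAm_one u)
  rwa [sin_arcsin_tanh] at this

theorem sqrt_one_sub_tanh_sq (u : ℝ) : Real.sqrt (1 - Real.tanh u ^ 2) = 1 / Real.cosh u := by
  have hc := Real.cosh_pos u
  have h : 1 - Real.tanh u ^ 2 = (1 / Real.cosh u) ^ 2 := by
    have := Real.cosh_sq u
    rw [Real.tanh_eq_sinh_div_cosh]
    field_simp
    linarith
  rw [h, Real.sqrt_sq (by positivity)]

theorem tendsto_jacobiCn_one (u : ℝ) :
    Tendsto (fun k => jacobiCn k u) (𝓝[<] 1) (𝓝 (1 / Real.cosh u)) := by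
  have := (Real.continuous_cos.tendsto _).comp (tendsto_jacobiAm_one u)
  rwa [Real.cos_arcsin, sqrt_one_sub_tanh_sq] at this

theorem tendsto_jacobiDn_one (u : ℝ) :
    Tendsto (fun k => jacobiDn k u) (𝓝[<] 1) (𝓝 (1 / Real.cosh u)) := by
  have hk : Tendsto (fun k : ℝ => k) (𝓝[<] 1) (𝓝 1) := nhdsWithin_le_nhds
  have := (((hk.pow 2).mul ((tendsto_jacobiSn_one u).pow 2)).const_sub 1).sqrt
  rwa [one_pow, one_mul, sqrt_one_sub_tanh_sq] at this

theorem tanh_eq_exp (u : ℝ) :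
    Real.tanh u = (1 - Real.exp (-2 * u)) / (1 + Real.exp (-2 * u)) := by
  have h : Real.exp (-2 * u) = Real.exp (-u) * Real.exp (-u) := by
    rw [← Real.exp_add]; congr 1; ring
  have h1 := Real.exp_pos (-u)
  rw [Real.tanh_eq_sinh_div_cosh, Real.sinh_eq, Real.cosh_eq, h]
  have h2 : Real.exp u = (Real.exp (-u))⁻¹ := by rw [Real.exp_neg, inv_inv]
  rw [h2]
  field_simp

theorem one_div_cosh_eq_exp (u : ℝ) :
    1 / Real.cosh u = 2 * Real.exp (-u) / (1 + Real.exp (-2 * u)) := by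
  have h : Real.exp (-2 * u) = Real.exp (-u) * Real.exp (-u) := by
    rw [← Real.exp_add]; congr 1; ring
  have h1 := Real.exp_pos (-u)
  have h2 : Real.exp u = (Real.exp (-u))⁻¹ := by rw [Real.exp_neg, inv_inv]
  rw [Real.cosh_eq, h, h2]
  field_simp

theorem tendsto_cnU_one (w : ℝ) (n : ℕ) :
    Tendsto (fun k => cnU k w n) (𝓝[<] 1) (𝓝 (hypU (Real.exp (-2 * w)) n)) := by
  have h := ((((tendsto_jacobiSn_one (w * (2 * n - 1))).pow 2).mul
    ((tendsto_jacobiDn_one (2 * w * n)).const_sub 1)).mul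
    ((tendsto_jacobiDn_one (2 * w * ((n : ℝ) - 1))).const_add 1)).div_const 4
  change Tendsto (fun k => cnU k w n) _ _ at h
  convert h using 2
  rw [tanh_eq_exp, one_div_cosh_eq_exp, one_div_cosh_eq_exp, hypU]
  set q := Real.exp (-2 * w) with hq
  have hq0 : 0 < q := Real.exp_pos _
  have e1 : Real.exp (-2 * (w * (2 * n - 1))) = (q ^ n) ^ 2 / q := by
    rw [hq, ← pow_mul, ← Real.exp_nat_mul, ← Real.exp_sub]
    congr 1
    push_cast
    ring
  have e2 : Real.exp (-(2 * w * n)) = q ^ n := by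
    rw [hq, ← Real.exp_nat_mul]
    congr 1
    ring
  have e3 : Real.exp (-2 * (2 * w * n)) = (q ^ n) ^ 2 := by
    rw [hq, ← pow_mul, ← Real.exp_nat_mul]
    congr 1
    push_cast
    ring
  have e4 : Real.exp (-(2 * w * ((n : ℝ) - 1))) = q ^ n / q := by
    rw [hq, ← Real.exp_nat_mul, ← Real.exp_sub]
    congr 1
    ring
  have e5 : Real.exp (-2 * (2 * w * ((n : ℝ) - 1))) = (q ^ n / q) ^ 2 := by
    rw [← e4, ← Real.exp_nat_mul]
    congr 1
    push_cast
    ring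
  have f1 : q ^ (2 * (n : ℤ) - 1) = (q ^ n) ^ 2 / q := by
    rw [zpow_sub₀ hq0.ne', zpow_one, ← pow_mul, mul_comm n 2]
    norm_cast
  have f2 : q ^ ((n : ℤ) - 1) = q ^ n / q := by
    rw [zpow_sub₀ hq0.ne', zpow_one, zpow_natCast]
  have f3 : q ^ (2 * (n : ℤ) - 2) = (q ^ n / q) ^ 2 := by
    rw [← f2, ← zpow_natCast, ← zpow_mul]
    congr 1
    push_cast
    ring
  have f4 : q ^ (2 * n) = (q ^ n) ^ 2 := by rw [← pow_mul, mul_comm]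
  rw [e1, e2, e3, e4, e5, f1, f2, f3, f4]
  have hQ : 0 < q ^ n := by positivity
  generalize q ^ n = Q at *
  field_simp
  ring

theorem rpow_natCast_sub_half {a : ℝ} (ha : 0 < a) (n : ℕ) :
    (a ^ 2) ^ ((n : ℝ) - 1 / 2) = (a ^ 2) ^ n / a := by
  rw [Real.rpow_sub (by positivity), Real.rpow_natCast, ← Real.sqrt_eq_rpow,
    Real.sqrt_sq ha.le]

theorem tendsto_cnB_one (w : ℝ) (n : ℕ) :
    Tendsto (fun k => cnB k w n) (𝓝[<] 1) (𝓝 (hypB (Real.exp (-2 * w)) n)) := by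
  have h := (((tendsto_jacobiCn_one (w * (2 * n + 1))).mul
    ((tendsto_jacobiDn_one (2 * w * n)).const_add 1)).sub
    ((tendsto_jacobiCn_one (w * (2 * n - 1))).mul
    ((tendsto_jacobiDn_one (2 * w * n)).const_sub 1))).div_const 2
  change Tendsto (fun k => cnB k w n) _ _ at h
  convert h using 2
  rw [one_div_cosh_eq_exp, one_div_cosh_eq_exp, one_div_cosh_eq_exp, hypB]
  set a := Real.exp (-w) with ha
  have ha0 : 0 < a := Real.exp_pos _
  have hqa : Real.exp (-2 * w) = a ^ 2 := by
    rw [ha, ← Real.exp_nat_mul]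
    congr 1
    push_cast
    ring
  have hr := rpow_natCast_sub_half ha0 n
  have e1 : Real.exp (-(w * (2 * n + 1))) = (a ^ 2) ^ n * a := by
    rw [ha, ← pow_mul, ← Real.exp_nat_mul, ← Real.exp_add]
    congr 1
    push_cast
    ring
  have e1' : Real.exp (-2 * (w * (2 * n + 1))) = ((a ^ 2) ^ n * a) ^ 2 := by
    rw [← e1, ← Real.exp_nat_mul]
    congr 1
    push_cast
    ring
  have e2 : Real.exp (-(w * (2 * n - 1))) = (a ^ 2) ^ n / a := by
    rw [ha, ← pow_mul, ← Real.exp_nat_mul, ← Real.exp_sub]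
    congr 1
    push_cast
    ring
  have e2' : Real.exp (-2 * (w * (2 * n - 1))) = ((a ^ 2) ^ n / a) ^ 2 := by
    rw [← e2, ← Real.exp_nat_mul]
    congr 1
    push_cast
    ring
  have e3 : Real.exp (-(2 * w * n)) = (a ^ 2) ^ n := by
    rw [ha, ← pow_mul, ← Real.exp_nat_mul]
    congr 1
    push_cast
    ring
  have e3' : Real.exp (-2 * (2 * w * n)) = ((a ^ 2) ^ n) ^ 2 := by
    rw [← e3, ← Real.exp_nat_mul]
    congr 1
    push_cast
    ring
  have f1 : (a ^ 2) ^ (2 * (n : ℤ) - 1) = ((a ^ 2) ^ n) ^ 2 / a ^ 2 := by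
    rw [zpow_sub₀ (by positivity), zpow_one, ← pow_mul _ n, mul_comm n 2]
    norm_cast
  have f2 : (a ^ 2) ^ (2 * n + 1) = ((a ^ 2) ^ n) ^ 2 * a ^ 2 := by
    rw [pow_succ, ← pow_mul _ n, mul_comm n 2]
  have f4 : (a ^ 2) ^ (2 * n) = ((a ^ 2) ^ n) ^ 2 := by rw [← pow_mul _ n, mul_comm]
  rw [hqa, hr, e1, e1', e2, e2', e3, e3', f1, f2, f4]
  have hQ : 0 < (a ^ 2) ^ n := by positivity
  generalize (a ^ 2) ^ n = Q at *
  field_simp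
  ring

end

section

/-! ### The recurrence of the limiting Askey-Wilson polynomials -/

theorem qShifted_succ (x q : ℝ) (n : ℕ) :
    qShifted x q (n + 1) = qShifted x q n * (1 - x * q ^ n) := Finset.prod_range_succ _ _

theorem qShifted_succ' (x q : ℝ) (n : ℕ) :
    qShifted x q (n + 1) = (1 - x) * qShifted (x * q) q n := by
  rw [qShifted, Finset.prod_range_succ', mul_comm, pow_zero, mul_one, qShifted]
  congr 1
  refine Finset.prod_congr rfl fun i _ => ?_
  rw [pow_succ']
  ring

/-- The basis `∏_{i<j} (1 - 2 a q^i x + a² q^{2i})`, with `q = a²`, of the Askey-Wilson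
polynomials. -/
noncomputable def awBasis (a : ℝ) (j : ℕ) : ℝ[X] :=
  ∏ i ∈ Finset.range j,
    (1 - C (2 * a * (a ^ 2) ^ i) * X + C (a ^ 2 * (a ^ 2) ^ (2 * i)))

/-- The denominators of the terms of the `₄φ₃` series with `q = a²` and parameters
`a, 1, a, -1`. -/
noncomputable def awDenom (a : ℝ) (j : ℕ) : ℝ :=
  ∏ i ∈ Finset.range j, (1 - a ^ 2 * ((a ^ 2) ^ i) ^ 2) * (1 - a ^ 2 * (a ^ 2) ^ i) ^ 2

/-- The terms of the `₄φ₃` series with `q = a²` and parameters `a, 1, a, -1`, without the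
`x`-dependent factor. -/
noncomputable def awTerm (a : ℝ) (n j : ℕ) : ℝ :=
  qShifted ((a ^ 2) ^ n)⁻¹ (a ^ 2) j * qShifted (-(a ^ 2) ^ n) (a ^ 2) j / awDenom a j *
    (a ^ 2) ^ j

/-- The factor which makes the `₄φ₃` series with `q = a²` and parameters `a, 1, a, -1` monic. -/
noncomputable def awScale (a : ℝ) (n : ℕ) : ℝ :=
  awDenom' a n / (a ^ n * (2 ^ n * qShifted (-(a ^ 2) ^ n) (a ^ 2) n))
where
  /-- The product `(a, q, -a; q)_n` with `q = a²`. -/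
  awDenom' (a : ℝ) (n : ℕ) : ℝ :=
    ∏ i ∈ Finset.range n, (1 - a ^ 2 * ((a ^ 2) ^ i) ^ 2) * (1 - a ^ 2 * (a ^ 2) ^ i)

section

variable {a : ℝ}

theorem awBasis_succ (a : ℝ) (j : ℕ) :
    awBasis a (j + 1) =
      awBasis a j * (1 - C (2 * a * (a ^ 2) ^ j) * X + C (a ^ 2 * (a ^ 2) ^ (2 * j))) :=
  Finset.prod_range_succ _ _

theorem X_mul_awBasis (ha : 0 < a) (j : ℕ) :
    X * awBasis a j = C (1 / (2 * a * (a ^ 2) ^ j)) *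
      (C (1 + a ^ 2 * ((a ^ 2) ^ j) ^ 2) * awBasis a j - awBasis a (j + 1)) := by
  have h : C (1 / (2 * a * (a ^ 2) ^ j)) * C (2 * a * (a ^ 2) ^ j) = (1 : ℝ[X]) := by
    rw [← C_mul, one_div, inv_mul_cancel₀ (by positivity), C_1]
  have h2 : (a ^ 2) ^ (2 * j) = ((a ^ 2) ^ j) ^ 2 := by rw [← pow_mul _ j, mul_comm]
  rw [awBasis_succ, h2, C_add, C_1]
  linear_combination (-X * awBasis a j) * h

theorem one_sub_sq_pow_ne_zero (ha : 0 < a) (ha1 : a ≠ 1) (m : ℕ) : 1 - a ^ (m + 1) ≠ 0 := by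
  intro h
  exact ha1 ((pow_eq_one_iff_of_nonneg ha.le m.add_one_ne_zero).1 (sub_eq_zero.1 h).symm)

theorem awDenom_ne_zero (ha : 0 < a) (ha1 : a ≠ 1) (j : ℕ) : awDenom a j ≠ 0 := by
  refine Finset.prod_ne_zero_iff.2 fun i _ => mul_ne_zero ?_ (pow_ne_zero 2 ?_)
  · have := one_sub_sq_pow_ne_zero ha ha1 (4 * i + 1)
    convert this using 2
    ring
  · have := one_sub_sq_pow_ne_zero ha ha1 (2 * i + 1)
    convert this using 2
    ring

theorem awDenom_succ (a : ℝ) (j : ℕ) :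
    awDenom a (j + 1) = awDenom a j *
      ((1 - a ^ 2 * ((a ^ 2) ^ j) ^ 2) * (1 - a ^ 2 * (a ^ 2) ^ j) ^ 2) :=
  Finset.prod_range_succ _ _

theorem awTerm_eq_zero (ha : 0 < a) {n j : ℕ} (h : n < j) : awTerm a n j = 0 := by
  have : qShifted ((a ^ 2) ^ n)⁻¹ (a ^ 2) j = 0 := by
    refine Finset.prod_eq_zero (Finset.mem_range.2 h) ?_
    rw [inv_mul_cancel₀ (by positivity), sub_self]
  rw [awTerm, this]
  simp

theorem qShifted_neg_pos (ha : 0 < a) (n j : ℕ) : 0 < qShifted (-(a ^ 2) ^ n) (a ^ 2) j := by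
  refine Finset.prod_pos fun i _ => ?_
  rw [neg_mul, sub_neg_eq_add]
  positivity

theorem askeyWilsonMonic_eq (ha : 0 < a) {n M : ℕ} (hM : n < M) :
    askeyWilsonMonic a 1 a (-1) (a ^ 2) n =
      C (awScale a n) * ∑ j ∈ Finset.range M, C (awTerm a n j) * awBasis a j := by
  have hsub : ∑ j ∈ Finset.range M, C (awTerm a n j) * awBasis a j =
      ∑ j ∈ Finset.range (n + 1), C (awTerm a n j) * awBasis a j := by
    symm
    refine Finset.sum_subset (Finset.range_subset_range.2 hM) fun j _ hj => ?_
    rw [awTerm_eq_zero ha (by simpa using hj), C_0, zero_mul]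
  have hpar : a * 1 * a * -1 * (a ^ 2) ^ ((n : ℤ) - 1) = -(a ^ 2) ^ n := by
    rw [zpow_sub₀ (by positivity), zpow_one, zpow_natCast]
    field_simp
  have hden : ∀ j, qShifted (a * 1) (a ^ 2) j * qShifted (a * a) (a ^ 2) j *
      qShifted (a * -1) (a ^ 2) j = awScale.awDenom' a j := fun j => by
    rw [qShifted, qShifted, qShifted, ← Finset.prod_mul_distrib, ← Finset.prod_mul_distrib,
      awScale.awDenom']
    refine Finset.prod_congr rfl fun i _ => ?_
    ring
  have hden2 : ∀ j, awScale.awDenom' a j * qShifted (a ^ 2) (a ^ 2) j = awDenom a j := fun j => by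
    rw [qShifted, awScale.awDenom', ← Finset.prod_mul_distrib, awDenom]
    refine Finset.prod_congr rfl fun i _ => ?_
    ring
  rw [askeyWilsonMonic, askeyWilson, hpar, hsub, ← mul_assoc, ← C_mul, hden]
  congr 1
  · rw [awScale]
    congr 1
    have := (qShifted_neg_pos ha n n).ne'
    field_simp
  · refine Finset.sum_congr rfl fun j _ => ?_
    rw [hden, hden2, zpow_neg, zpow_natCast]
    rfl

/-- The ratio of consecutive scaling factors `awScale a (n + 1) / awScale a n` in terms of
`Q = q^n`. -/
noncomputable def awUp (a Q : ℝ) : ℝ :=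
  (1 - a ^ 2 * Q ^ 2) * (1 - a ^ 2 * Q) * (1 + Q) /
    (2 * a * (1 + Q ^ 2) * (1 + a ^ 2 * Q ^ 2))

/-- The recurrence coefficient `hypB (a ^ 2) (n + 1)` in terms of `Q = q^n`. -/
noncomputable def awMid (a Q : ℝ) : ℝ :=
  a * Q * (2 * (a ^ 2 + 1) * (a ^ 2 * Q) - (1 - a ^ 2) * (1 - a ^ 4 * Q ^ 2)) /
    ((1 + a ^ 2 * Q ^ 2) * (1 + a ^ 6 * Q ^ 2))

/-- The recurrence coefficient `hypU (a ^ 2) (n + 1)`, times the ratio of scaling factors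
`awScale a n / awScale a (n + 1)`, in terms of `Q = q^n`. -/
noncomputable def awDown (a Q : ℝ) : ℝ :=
  a / 2 * ((1 - a ^ 2 * Q) * (1 - a ^ 2 * Q ^ 2) * (1 + Q)) /
    ((1 + a ^ 2 * Q ^ 2) * (1 + a ^ 4 * Q ^ 2))

theorem awScale_succ (ha : 0 < a) (n : ℕ) :
    awScale a (n + 1) = awScale a n * awUp a ((a ^ 2) ^ n) := by
  have h1 : awScale.awDenom' a (n + 1) = awScale.awDenom' a n *
      ((1 - a ^ 2 * ((a ^ 2) ^ n) ^ 2) * (1 - a ^ 2 * (a ^ 2) ^ n)) := Finset.prod_range_succ _ _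
  have h2 : qShifted (-(a ^ 2) ^ n) (a ^ 2) n * (1 + ((a ^ 2) ^ n) ^ 2) *
      (1 + a ^ 2 * ((a ^ 2) ^ n) ^ 2) =
      (1 + (a ^ 2) ^ n) * qShifted (-(a ^ 2) ^ (n + 1)) (a ^ 2) (n + 1) := by
    have h := qShifted_succ' (-(a ^ 2) ^ n) (a ^ 2) (n + 1)
    rw [qShifted_succ, qShifted_succ] at h
    rw [show -(a ^ 2) ^ (n + 1) = -(a ^ 2) ^ n * a ^ 2 by ring]
    rw [← sub_neg_eq_add _ ((a ^ 2) ^ n), ← h, pow_succ (a ^ 2) n]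
    ring
  have hp := (qShifted_neg_pos ha n n).ne'
  have hp' := (qShifted_neg_pos ha (n + 1) (n + 1)).ne'
  have hQ : 0 < (a ^ 2) ^ n := by positivity
  rw [awScale, awScale, awUp, h1, div_mul_div_comm, div_eq_div_iff (by positivity) (by positivity)]
  generalize qShifted (-(a ^ 2) ^ (n + 1)) (a ^ 2) (n + 1) = Z at *
  generalize qShifted (-(a ^ 2) ^ n) (a ^ 2) n = Y at *
  generalize (a ^ 2) ^ n = Q at *
  linear_combination (awScale.awDenom' a n * (1 - a ^ 2 * Q ^ 2) * (1 - a ^ 2 * Q) * a ^ n * 2 ^ n *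
    2 * a) * h2

/-- The coefficient of `awBasis a (j + 2)` in the three-term recurrence. All `q`-shifted factorials
are expressed through `(q^{-n}; q)_j` and `(-q^{n+2}; q)_j`, which leaves a rational identity. -/
theorem awTerm_recurrence_add_two (ha : 0 < a) (ha1 : a ≠ 1) (n j : ℕ) :
    awUp a ((a ^ 2) ^ (n + 1)) * awTerm a (n + 2) (j + 2) +
      awMid a ((a ^ 2) ^ n) * awTerm a (n + 1) (j + 2) +
      awDown a ((a ^ 2) ^ n) * awTerm a n (j + 2) =
      1 / (2 * a * (a ^ 2) ^ (j + 2)) *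
        ((1 + a ^ 2 * ((a ^ 2) ^ (j + 2)) ^ 2) * awTerm a (n + 1) (j + 2)) -
      1 / (2 * a * (a ^ 2) ^ (j + 1)) * awTerm a (n + 1) (j + 1) := by
  have hq : a ^ 2 ≠ 0 := by positivity
  have hQ : (a ^ 2) ^ n ≠ 0 := by positivity
  have hJ : (a ^ 2) ^ j ≠ 0 := by positivity
  have g : ∀ m : ℕ, ((a ^ 2) ^ (m + 1))⁻¹ * a ^ 2 = ((a ^ 2) ^ m)⁻¹ := fun m => by
    rw [pow_succ]; field_simp
  have g' : ∀ m : ℕ, -(a ^ 2) ^ m * a ^ 2 = -(a ^ 2) ^ (m + 1) := fun m => by ring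
  have A2 : qShifted ((a ^ 2) ^ (n + 2))⁻¹ (a ^ 2) (j + 2) =
      (1 - ((a ^ 2) ^ (n + 2))⁻¹) * ((1 - ((a ^ 2) ^ (n + 1))⁻¹) *
        qShifted ((a ^ 2) ^ n)⁻¹ (a ^ 2) j) := by
    rw [qShifted_succ', g, qShifted_succ', g]
  have A1 : qShifted ((a ^ 2) ^ (n + 1))⁻¹ (a ^ 2) (j + 2) = (1 - ((a ^ 2) ^ (n + 1))⁻¹) *
        (qShifted ((a ^ 2) ^ n)⁻¹ (a ^ 2) j * (1 - ((a ^ 2) ^ n)⁻¹ * (a ^ 2) ^ j)) := by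
    rw [qShifted_succ', g, qShifted_succ]
  have A1' : qShifted ((a ^ 2) ^ (n + 1))⁻¹ (a ^ 2) (j + 1) = (1 - ((a ^ 2) ^ (n + 1))⁻¹) *
        qShifted ((a ^ 2) ^ n)⁻¹ (a ^ 2) j := by
    rw [qShifted_succ', g]
  have A0 : qShifted ((a ^ 2) ^ n)⁻¹ (a ^ 2) (j + 2) = qShifted ((a ^ 2) ^ n)⁻¹ (a ^ 2) j *
      (1 - ((a ^ 2) ^ n)⁻¹ * (a ^ 2) ^ j) * (1 - ((a ^ 2) ^ n)⁻¹ * (a ^ 2) ^ (j + 1)) := by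
    rw [qShifted_succ, qShifted_succ]
  have B2 : qShifted (-(a ^ 2) ^ (n + 2)) (a ^ 2) (j + 2) =
      qShifted (-(a ^ 2) ^ (n + 2)) (a ^ 2) j * (1 - -(a ^ 2) ^ (n + 2) * (a ^ 2) ^ j) *
        (1 - -(a ^ 2) ^ (n + 2) * (a ^ 2) ^ (j + 1)) := by
    rw [qShifted_succ, qShifted_succ]
  have B1 : qShifted (-(a ^ 2) ^ (n + 1)) (a ^ 2) (j + 2) = (1 - -(a ^ 2) ^ (n + 1)) *
      (qShifted (-(a ^ 2) ^ (n + 2)) (a ^ 2) j * (1 - -(a ^ 2) ^ (n + 2) * (a ^ 2) ^ j)) := by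
    rw [qShifted_succ', g', qShifted_succ]
  have B1' : qShifted (-(a ^ 2) ^ (n + 1)) (a ^ 2) (j + 1) = (1 - -(a ^ 2) ^ (n + 1)) *
      qShifted (-(a ^ 2) ^ (n + 2)) (a ^ 2) j := by
    rw [qShifted_succ', g']
  have B0 : qShifted (-(a ^ 2) ^ n) (a ^ 2) (j + 2) = (1 - -(a ^ 2) ^ n) *
      ((1 - -(a ^ 2) ^ (n + 1)) * qShifted (-(a ^ 2) ^ (n + 2)) (a ^ 2) j) := by
    rw [qShifted_succ', g', qShifted_succ', g']
  have hd2 := awDenom_ne_zero ha ha1 (j + 2)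
  have hd1 := awDenom_ne_zero ha ha1 (j + 1)
  have hd := awDenom_succ a (j + 1)
  have p3 : (a ^ 2) ^ (j + 1) = a ^ 2 * (a ^ 2) ^ j := pow_succ' _ _
  -- Only the largest denominator is kept, so that no factor of it has to be inverted.
  have hinv : (awDenom a (j + 1))⁻¹ = (awDenom a (j + 2))⁻¹ *
      ((1 - a ^ 6 * ((a ^ 2) ^ j) ^ 2) * (1 - a ^ 4 * (a ^ 2) ^ j) ^ 2) := by
    rw [inv_eq_iff_eq_inv, mul_inv, inv_inv, ← div_eq_mul_inv, eq_div_iff, hd, p3]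
    · ring
    · intro h0
      apply hd2
      rw [hd, p3, show (1 - a ^ 2 * (a ^ 2 * (a ^ 2) ^ j) ^ 2) * (1 - a ^ 2 * (a ^ 2 *
        (a ^ 2) ^ j)) ^ 2 = (1 - a ^ 6 * ((a ^ 2) ^ j) ^ 2) * (1 - a ^ 4 * (a ^ 2) ^ j) ^ 2 by ring,
        h0, mul_zero]
  simp only [awTerm, awUp, awMid, awDown, A2, A1, A1', A0, B2, B1, B1', B0,
    div_eq_mul_inv _ (awDenom _ _), hinv]
  generalize (awDenom a (j + 2))⁻¹ = D at *
  generalize qShifted ((a ^ 2) ^ n)⁻¹ (a ^ 2) j = G at *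
  generalize qShifted (-(a ^ 2) ^ (n + 2)) (a ^ 2) j = H at *
  have p1 : (a ^ 2) ^ (n + 1) = a ^ 2 * (a ^ 2) ^ n := pow_succ' _ _
  have p2 : (a ^ 2) ^ (n + 2) = a ^ 4 * (a ^ 2) ^ n := by ring
  have p4 : (a ^ 2) ^ (j + 2) = a ^ 4 * (a ^ 2) ^ j := by ring
  rw [p1, p2, p3, p4]
  have hQ' : 0 < (a ^ 2) ^ n := by positivity
  clear hd2 hd hd1 hinv A2 A1 A1' A0 B2 B1 B1' B0 g g' p1 p2 p3 p4
  generalize (a ^ 2) ^ n = Q at *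
  generalize (a ^ 2) ^ j = J at *
  field_simp
  ring

theorem awTerm_zero_right (a : ℝ) (n : ℕ) : awTerm a n 0 = 1 := by
  simp [awTerm, qShifted, awDenom]

theorem awTerm_one_right (a : ℝ) (n : ℕ) :
    awTerm a n 1 = (1 - ((a ^ 2) ^ n)⁻¹) * (1 + (a ^ 2) ^ n) /
      ((1 - a ^ 2) * (1 - a ^ 2) ^ 2) * a ^ 2 := by
  simp [awTerm, qShifted, awDenom]

theorem awTerm_recurrence_zero (ha : 0 < a) (n : ℕ) :
    awUp a ((a ^ 2) ^ (n + 1)) * awTerm a (n + 2) 0 + awMid a ((a ^ 2) ^ n) * awTerm a (n + 1) 0 +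
      awDown a ((a ^ 2) ^ n) * awTerm a n 0 =
      1 / (2 * a * (a ^ 2) ^ 0) * ((1 + a ^ 2 * ((a ^ 2) ^ 0) ^ 2) * awTerm a (n + 1) 0) := by
  simp only [awTerm_zero_right, awUp, awMid, awDown]
  have p1 : (a ^ 2) ^ (n + 1) = a ^ 2 * (a ^ 2) ^ n := pow_succ' _ _
  rw [p1, pow_zero]
  have hQ : 0 < (a ^ 2) ^ n := by positivity
  generalize (a ^ 2) ^ n = Q at *
  field_simp
  ring

theorem awTerm_recurrence_one (ha : 0 < a) (ha1 : a ≠ 1) (n : ℕ) :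
    awUp a ((a ^ 2) ^ (n + 1)) * awTerm a (n + 2) 1 + awMid a ((a ^ 2) ^ n) * awTerm a (n + 1) 1 +
      awDown a ((a ^ 2) ^ n) * awTerm a n 1 =
      1 / (2 * a * (a ^ 2) ^ 1) * ((1 + a ^ 2 * ((a ^ 2) ^ 1) ^ 2) * awTerm a (n + 1) 1) -
      1 / (2 * a * (a ^ 2) ^ 0) * awTerm a (n + 1) 0 := by
  simp only [awTerm_zero_right, awTerm_one_right, awUp, awMid, awDown]
  have p1 : (a ^ 2) ^ (n + 1) = a ^ 2 * (a ^ 2) ^ n := pow_succ' _ _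
  have p2 : (a ^ 2) ^ (n + 2) = a ^ 4 * (a ^ 2) ^ n := by ring
  have h1 : 1 - a ^ 2 ≠ 0 := one_sub_sq_pow_ne_zero ha ha1 1
  rw [p1, p2, pow_zero, pow_one]
  have hQ : 0 < (a ^ 2) ^ n := by positivity
  generalize (a ^ 2) ^ n = Q at *
  field_simp
  ring

theorem awTerm_recurrence_succ (ha : 0 < a) (ha1 : a ≠ 1) (n j : ℕ) :
    awUp a ((a ^ 2) ^ (n + 1)) * awTerm a (n + 2) (j + 1) +
      awMid a ((a ^ 2) ^ n) * awTerm a (n + 1) (j + 1) +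
      awDown a ((a ^ 2) ^ n) * awTerm a n (j + 1) =
      1 / (2 * a * (a ^ 2) ^ (j + 1)) *
        ((1 + a ^ 2 * ((a ^ 2) ^ (j + 1)) ^ 2) * awTerm a (n + 1) (j + 1)) -
      1 / (2 * a * (a ^ 2) ^ j) * awTerm a (n + 1) j := by
  cases j with
  | zero => exact awTerm_recurrence_one ha ha1 n
  | succ j => exact awTerm_recurrence_add_two ha ha1 n j

theorem hypB_succ (ha : 0 < a) (n : ℕ) : hypB (a ^ 2) (n + 1) = awMid a ((a ^ 2) ^ n) := by
  have f1 : (a ^ 2) ^ (2 * ((n + 1 : ℕ) : ℤ) - 1) = ((a ^ 2) ^ n) ^ 2 * a ^ 2 := by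
    rw [show 2 * ((n + 1 : ℕ) : ℤ) - 1 = ((2 * n + 1 : ℕ) : ℤ) by push_cast; ring, zpow_natCast]
    ring
  have f2 : (a ^ 2) ^ (2 * (n + 1) + 1) = ((a ^ 2) ^ n) ^ 2 * a ^ 6 := by ring
  have f3 : (a ^ 2) ^ (2 * (n + 1)) = ((a ^ 2) ^ n) ^ 2 * a ^ 4 := by ring
  rw [hypB, rpow_natCast_sub_half ha, awMid, f1, f2, f3, pow_succ (a ^ 2) n]
  have hQ : 0 < (a ^ 2) ^ n := by positivity
  generalize (a ^ 2) ^ n = Q at *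
  field_simp

theorem hypU_succ_mul_awScale (ha : 0 < a) (n : ℕ) :
    hypU (a ^ 2) (n + 1) * awScale a n = awScale a (n + 1) * awDown a ((a ^ 2) ^ n) := by
  have f1 : (a ^ 2) ^ (2 * ((n + 1 : ℕ) : ℤ) - 1) = ((a ^ 2) ^ n) ^ 2 * a ^ 2 := by
    rw [show 2 * ((n + 1 : ℕ) : ℤ) - 1 = ((2 * n + 1 : ℕ) : ℤ) by push_cast; ring, zpow_natCast]
    ring
  have f2 : (a ^ 2) ^ (((n + 1 : ℕ) : ℤ) - 1) = (a ^ 2) ^ n := by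
    rw [show ((n + 1 : ℕ) : ℤ) - 1 = (n : ℤ) by push_cast; ring, zpow_natCast]
  have f3 : (a ^ 2) ^ (2 * ((n + 1 : ℕ) : ℤ) - 2) = ((a ^ 2) ^ n) ^ 2 := by
    rw [show 2 * ((n + 1 : ℕ) : ℤ) - 2 = ((2 * n : ℕ) : ℤ) by push_cast; ring, zpow_natCast]
    ring
  have f4 : (a ^ 2) ^ (2 * (n + 1)) = ((a ^ 2) ^ n) ^ 2 * a ^ 4 := by ring
  rw [awScale_succ ha, hypU, awUp, awDown, f1, f2, f3, f4, pow_succ (a ^ 2) n]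
  have hQ : 0 < (a ^ 2) ^ n := by positivity
  generalize (a ^ 2) ^ n = Q at *
  field_simp
  ring

theorem askeyWilsonMonic_zero (ha : 0 < a) : askeyWilsonMonic a 1 a (-1) (a ^ 2) 0 = 1 := by
  rw [askeyWilsonMonic_eq ha zero_lt_one]
  simp [awTerm_zero_right, awBasis, awScale, awScale.awDenom', qShifted]

theorem askeyWilsonMonic_one_add (ha : 0 < a) (ha1 : a ≠ 1) :
    askeyWilsonMonic a 1 a (-1) (a ^ 2) 1 +
      C (hypB (a ^ 2) 0) * askeyWilsonMonic a 1 a (-1) (a ^ 2) 0 =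
      X * askeyWilsonMonic a 1 a (-1) (a ^ 2) 0 := by
  have h1 : 1 - a ^ 2 ≠ 0 := one_sub_sq_pow_ne_zero ha ha1 1
  have hX := X_mul_awBasis ha 0
  have h0 : awBasis a 0 = 1 := Finset.prod_range_zero _
  have hs : awScale a 0 = 1 := by simp [awScale, awScale.awDenom', qShifted]
  have hb : hypB (a ^ 2) 0 = 2 * a / (1 + a ^ 2) := by
    have := rpow_natCast_sub_half ha 0
    rw [hypB, this]
    simp only [pow_zero, Nat.cast_zero, mul_zero, zero_sub, zpow_neg, zpow_one, zero_add, pow_one]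
    field_simp
    ring
  rw [askeyWilsonMonic_zero ha, askeyWilsonMonic_eq ha (show 1 < 2 by norm_num),
    Finset.sum_range_succ, Finset.sum_range_one, awTerm_zero_right, h0, awScale_succ ha 0, hs]
  rw [h0, mul_one, mul_one, zero_add] at hX
  rw [mul_one, hX, hb, mul_one, mul_one]
  have e1 : 1 * awUp a ((a ^ 2) ^ 0) + 2 * a / (1 + a ^ 2) =
      1 / (2 * a * (a ^ 2) ^ 0) * (1 + a ^ 2 * ((a ^ 2) ^ 0) ^ 2) := by
    rw [awUp, pow_zero]
    field_simp
    ring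
  have e2 : 1 * awUp a ((a ^ 2) ^ 0) * awTerm a 1 1 = -(1 / (2 * a * (a ^ 2) ^ 0)) := by
    rw [awUp, awTerm_one_right, pow_zero, pow_one]
    field_simp
    ring
  have e1' := congrArg (C : ℝ → ℝ[X]) e1
  have e2' := congrArg (C : ℝ → ℝ[X]) e2
  simp only [C_add, C_mul, C_neg, C_1, one_mul] at e1' e2' ⊢
  linear_combination e1' + awBasis a 1 * e2'

/-- The monic Askey-Wilson polynomials with `q = a²` and parameters `a, 1, a, -1` satisfy the
limiting recurrence; this is a comparison of coefficients in the basis `awBasis`. -/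
theorem askeyWilsonMonic_recurrence (ha : 0 < a) (ha1 : a ≠ 1) (n : ℕ) :
    askeyWilsonMonic a 1 a (-1) (a ^ 2) (n + 2) +
      C (hypB (a ^ 2) (n + 1)) * askeyWilsonMonic a 1 a (-1) (a ^ 2) (n + 1) +
      C (hypU (a ^ 2) (n + 1)) * askeyWilsonMonic a 1 a (-1) (a ^ 2) n =
      X * askeyWilsonMonic a 1 a (-1) (a ^ 2) (n + 1) := by
  have hX : X * askeyWilsonMonic a 1 a (-1) (a ^ 2) (n + 1) = C (awScale a (n + 1)) *
      (∑ j ∈ Finset.range (n + 3), C (1 / (2 * a * (a ^ 2) ^ j) *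
        ((1 + a ^ 2 * ((a ^ 2) ^ j) ^ 2) * awTerm a (n + 1) j)) * awBasis a j -
      ∑ j ∈ Finset.range (n + 2), C (1 / (2 * a * (a ^ 2) ^ j) * awTerm a (n + 1) j) *
        awBasis a (j + 1)) := by
    rw [askeyWilsonMonic_eq ha (Nat.lt_succ_self (n + 1)), Finset.sum_range_succ _ (n + 2),
      awTerm_eq_zero ha (Nat.lt_succ_self (n + 1)), mul_zero, mul_zero, C_0, zero_mul, add_zero,
      ← Finset.sum_sub_distrib, mul_left_comm, Finset.mul_sum]
    congr 1
    refine Finset.sum_congr rfl fun j _ => ?_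
    rw [mul_left_comm, X_mul_awBasis ha]
    simp only [C_mul]
    ring
  have hL : ∀ f g h : ℕ → ℝ, ∀ r s t : ℝ,
      C r * ∑ j ∈ Finset.range (n + 3), C (f j) * awBasis a j +
      C s * ∑ j ∈ Finset.range (n + 3), C (g j) * awBasis a j +
      C t * ∑ j ∈ Finset.range (n + 3), C (h j) * awBasis a j =
      ∑ j ∈ Finset.range (n + 3), C (r * f j + s * g j + t * h j) * awBasis a j :=
    fun f g h r s t => by
      rw [Finset.mul_sum, Finset.mul_sum, Finset.mul_sum, ← Finset.sum_add_distrib,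
        ← Finset.sum_add_distrib]
      refine Finset.sum_congr rfl fun j _ => ?_
      simp only [C_mul, C_add]
      ring
  rw [hX, askeyWilsonMonic_eq ha (show n + 2 < n + 3 by omega),
    askeyWilsonMonic_eq ha (show n + 1 < n + 3 by omega),
    askeyWilsonMonic_eq ha (show n < n + 3 by omega), ← mul_assoc, ← mul_assoc, ← C_mul, ← C_mul,
    hypU_succ_mul_awScale ha, hypB_succ ha, awScale_succ ha (n + 1), C_mul, C_mul, C_mul,
    mul_comm (C (awMid a _)), mul_assoc, mul_assoc, mul_assoc, ← mul_add, ← mul_add, hL]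
  congr 1
  rw [Finset.sum_range_succ' _ (n + 2), Finset.sum_range_succ' _ (n + 2),
    awTerm_recurrence_zero ha, add_sub_right_comm, ← Finset.sum_sub_distrib]
  congr 1
  refine Finset.sum_congr rfl fun j _ => ?_
  rw [awTerm_recurrence_succ ha ha1, C_sub, sub_mul]

end

end

section

/-! ### Convergence of the polynomials as the modulus tends to one -/

/-- Sequences of monic polynomials built from convergent recurrence coefficients converge
coefficientwise. The hypotheses on the approximating polynomials are needed only eventually. -/
theorem tendsto_coeff_of_recurrence {ι : Type*} {l : Filter ι} {p : ι → ℕ → ℝ[X]}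
    {b u : ι → ℕ → ℝ} {P : ℕ → ℝ[X]} {B U : ℕ → ℝ}
    (h0 : ∀ᶠ k in l, p k 0 = 1)
    (h1 : ∀ᶠ k in l, p k 1 + C (b k 0) * p k 0 = X * p k 0)
    (h2 : ∀ n, ∀ᶠ k in l, p k (n + 2) + C (b k (n + 1)) * p k (n + 1) + C (u k (n + 1)) * p k n =
      X * p k (n + 1))
    (H0 : P 0 = 1) (H1 : P 1 + C (B 0) * P 0 = X * P 0)
    (H2 : ∀ n, P (n + 2) + C (B (n + 1)) * P (n + 1) + C (U (n + 1)) * P n = X * P (n + 1))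
    (hb : ∀ n, Tendsto (fun k => b k n) l (𝓝 (B n)))
    (hu : ∀ n, Tendsto (fun k => u k n) l (𝓝 (U n))) (n j : ℕ) :
    Tendsto (fun k => (p k n).coeff j) l (𝓝 ((P n).coeff j)) := by
  have hX : ∀ (f : ι → ℝ[X]) (F : ℝ[X]), (∀ j, Tendsto (fun k => (f k).coeff j) l (𝓝 (F.coeff j))) →
      ∀ j, Tendsto (fun k => (X * f k).coeff j) l (𝓝 ((X * F).coeff j)) := fun f F h j => by
    cases j with
    | zero => simpa using tendsto_const_nhds
    | succ j => simpa using h j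
  have base : ∀ j, Tendsto (fun k => (p k 0).coeff j) l (𝓝 ((P 0).coeff j)) := fun j => by
    refine tendsto_const_nhds.congr' ?_
    filter_upwards [h0] with k hk
    rw [hk, H0]
  have one : ∀ j, Tendsto (fun k => (p k 1).coeff j) l (𝓝 ((P 1).coeff j)) := fun j => by
    rw [eq_sub_of_add_eq H1, coeff_sub, coeff_C_mul]
    refine ((hX _ _ base j).sub ((hb 0).mul (base j))).congr' ?_
    filter_upwards [h1] with k hk
    rw [eq_sub_of_add_eq hk, coeff_sub, coeff_C_mul]
  induction n using Nat.twoStepInduction generalizing j with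
  | zero => exact base j
  | one => exact one j
  | more n ih ih' =>
    rw [eq_sub_of_add_eq (eq_sub_of_add_eq (H2 n)), coeff_sub, coeff_sub, coeff_C_mul, coeff_C_mul]
    refine (((hX _ _ ih' j).sub ((hu _).mul (ih j))).sub ((hb _).mul (ih' j))).congr' ?_
    filter_upwards [h2 n] with k hk
    rw [eq_sub_of_add_eq (eq_sub_of_add_eq hk), coeff_sub, coeff_sub, coeff_C_mul, coeff_C_mul]

/-- Only finitely many values of `sn` are needed at a time, and these tend to nonzero values of
`tanh`. -/
theorem eventually_jacobiSn_mul_ne_zero {w : ℝ} (hw : w ≠ 0) (N : ℕ) :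
    ∀ᶠ k in 𝓝[<] (1 : ℝ), ∀ i < N, jacobiSn k (w * ((i : ℝ) + 1)) ≠ 0 := by
  have h := (eventually_all_finset (l := 𝓝[<] (1 : ℝ))
    (p := fun i k => jacobiSn k (w * ((i : ℝ) + 1)) ≠ 0) (Finset.range N)).2 fun i _ =>
    (tendsto_jacobiSn_one _).eventually_ne (b₂ := 0) ?_
  · filter_upwards [h] with k hk i hi using hk i (Finset.mem_range.2 hi)
  · rw [Real.tanh_eq_sinh_div_cosh]
    refine div_ne_zero (Real.sinh_ne_zero.2 (mul_ne_zero hw ?_)) (Real.cosh_pos _).ne'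
    positivity

theorem tendsto_coeff_cnIntervalPoly_one {w : ℝ} (hw : w ≠ 0) (n j : ℕ) :
    Tendsto (fun k : ℝ => (cnIntervalPoly k w n).coeff j) (𝓝[<] 1)
      (𝓝 ((askeyWilsonMonic (Real.sqrt (Real.exp (-2 * w))) 1
        (Real.sqrt (Real.exp (-2 * w))) (-1) (Real.exp (-2 * w)) n).coeff j)) := by
  have ha := Real.exp_pos (-w)
  have ha1 : Real.exp (-w) ≠ 1 := by simpa using hw
  have hq : Real.exp (-2 * w) = Real.exp (-w) ^ 2 := by
    rw [← Real.exp_nat_mul]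
    congr 1
    push_cast
    ring
  have hk : ∀ᶠ k in 𝓝[<] (1 : ℝ), k ∈ Set.Ioo (0 : ℝ) 1 := Ioo_mem_nhdsLT zero_lt_one
  have hU := tendsto_cnU_one w
  have hB := tendsto_cnB_one w
  rw [hq] at hU hB ⊢
  rw [Real.sqrt_sq ha.le]
  refine tendsto_coeff_of_recurrence (p := fun k n => cnIntervalPoly k w n)
    (P := askeyWilsonMonic (Real.exp (-w)) 1 (Real.exp (-w)) (-1) (Real.exp (-w) ^ 2))
    (b := fun k n => cnB k w n) (u := fun k n => cnU k w n) ?_ ?_ (fun n => ?_)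
    (askeyWilsonMonic_zero ha) (askeyWilsonMonic_one_add ha ha1)
    (askeyWilsonMonic_recurrence ha ha1) hB hU n j
  · filter_upwards [hk] with k hk using cnIntervalPoly_zero hk.1 hk.2
  · filter_upwards [hk, eventually_jacobiSn_mul_ne_zero hw 2] with k hk h
    exact cnIntervalPoly_one_add hk.1 hk.2 h
  · filter_upwards [hk, eventually_jacobiSn_mul_ne_zero hw (2 * n + 4)] with k hk h
    exact cnIntervalPoly_recurrence hk.1 hk.2 h

end

/-! ### The cn-polynomials on the interval -/

theorem mainTheorem10 (w : ℝ) :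
    -- the elliptic case `0 < k < 1`, `w` not a rational multiple of `K`
    (∀ k : ℝ, 0 < k → k < 1 → Irrational (w / ellipticK k) →
      -- `S_n` and `P_n` exist, are uniquely determined by the transforms, and are related
      (∀ n : ℕ, IsDelsarteGeninTransform (cnPoly k w) n (cnSymmPoly k w n) ∧
        ∀ S : ℝ[X], IsDelsarteGeninTransform (cnPoly k w) n S → S = cnSymmPoly k w n) ∧
      (∀ n : ℕ, IsSzegoTransform (cnPoly k w) n (cnIntervalPoly k w n) ∧
        ∀ P : ℝ[X], IsSzegoTransform (cnPoly k w) n P → P = cnIntervalPoly k w n) ∧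
      (∀ n : ℕ, cnSymmPoly k w (2 * n) =
        C ((1 / 2 : ℝ) ^ n) * (cnIntervalPoly k w n).comp (2 * X ^ 2 - 1)) ∧
      -- `P_n` is monic of degree `n`
      (∀ n : ℕ, (cnIntervalPoly k w n).Monic ∧ (cnIntervalPoly k w n).natDegree = n) ∧
      -- three-term recurrence with explicit coefficients
      cnIntervalPoly k w 0 = 1 ∧
      cnIntervalPoly k w 1 + C (cnB k w 0) * cnIntervalPoly k w 0 = X * cnIntervalPoly k w 0 ∧
      (∀ n : ℕ, cnIntervalPoly k w (n + 2) + C (cnB k w (n + 1)) * cnIntervalPoly k w (n + 1) +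
        C (cnU k w (n + 1)) * cnIntervalPoly k w n = X * cnIntervalPoly k w (n + 1)) ∧
      -- Chebyshev expansion
      (∀ n : ℕ, cnIntervalPoly k w n =
        C ((-1) ^ n * 2 ^ (1 - (n : ℤ)) * (1 + jacobiDn k (2 * w * n))⁻¹) *
          (C (jacobiDn k (w * n) * ellipticBinom k w (2 * n) n) +
            ∑ s ∈ Finset.Icc 1 n,
              C ((-1) ^ s * ellipticBinom k w (2 * n) (n + s) *
                (jacobiDn k (w * ((n : ℝ) - s)) + jacobiDn k (w * ((n : ℝ) + s)))) *
                Polynomial.Chebyshev.T ℝ (s : ℤ))) ∧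
      -- orthogonality with respect to the positive point measure `∑ ρ_s δ_{x_s}` of mass one,
      -- whose point masses are dense in `[-1, 1]`
      (∀ n m : ℕ, HasSum
        (fun s : ℤ => cnWeight k s * (cnIntervalPoly k w n).eval (cnPoint k w s) *
          (cnIntervalPoly k w m).eval (cnPoint k w s))
        (if n = m then ∏ i ∈ Finset.Icc 1 n, cnU k w i else 0)) ∧
      (∀ n : ℕ, 0 < ∏ i ∈ Finset.Icc 1 n, cnU k w i) ∧
      (∀ s : ℤ, 0 < cnWeight k s) ∧
      HasSum (cnWeight k) 1 ∧
      closure (Set.range (cnPoint k w)) = Set.Icc (-1) 1) ∧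
    -- the limit `k → 1`, with `q = e^{-2w}`
    (w ≠ 0 → ∀ n : ℕ,
      Tendsto (fun k : ℝ => cnU k w n) (𝓝[<] 1) (𝓝 (hypU (Real.exp (-2 * w)) n)) ∧
      Tendsto (fun k : ℝ => cnB k w n) (𝓝[<] 1) (𝓝 (hypB (Real.exp (-2 * w)) n)) ∧
      ∀ j : ℕ, Tendsto (fun k : ℝ => (cnIntervalPoly k w n).coeff j) (𝓝[<] 1)
        (𝓝 ((askeyWilsonMonic (Real.sqrt (Real.exp (-2 * w))) 1
          (Real.sqrt (Real.exp (-2 * w))) (-1) (Real.exp (-2 * w)) n).coeff j))) := by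
  refine ⟨fun k hk0 hk1 hirr => ?_, fun hw n => ⟨tendsto_cnU_one w n, tendsto_cnB_one w n,
    tendsto_coeff_cnIntervalPoly_one hw n⟩⟩
  have hsn : ∀ m : ℤ, m ≠ 0 → jacobiSn k (w * m) ≠ 0 := fun m hm =>
    jacobiSn_mul_ne_zero hk0 hk1 hirr hm
  have h : ∀ N : ℕ, ∀ i < N, jacobiSn k (w * ((i : ℝ) + 1)) ≠ 0 := fun N i _ => by
    exact_mod_cast hsn (i + 1) (by omega)
  have h0 : cnIntervalPoly k w 0 = 1 := cnIntervalPoly_zero hk0 hk1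
  have h1 := cnIntervalPoly_one_add hk0 hk1 (h 2)
  have h2 := fun n => cnIntervalPoly_recurrence hk0 hk1 (h (2 * n + 4))
  refine ⟨fun n => ⟨isDelsarteGeninTransform_cnSymmPoly k w n, fun S hS =>
      isDelsarteGeninTransform_unique hS (isDelsarteGeninTransform_cnSymmPoly k w n)⟩,
    fun n => ⟨isSzegoTransform_cnIntervalPoly k w n, fun P hP =>
      isSzegoTransform_unique hP (isSzegoTransform_cnIntervalPoly k w n)⟩,
    cnSymmPoly_two_mul k w, monic_and_natDegree_of_recurrence h0 h1 h2, h0, h1, h2,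
    fun n => cnIntervalPoly_eq_sum_T (h (2 * n)), fun n m => ?_, fun n => ?_,
    cnWeight_pos hk0 hk1, hasSum_cnWeight hk0 hk1, closure_range_cnPoint hk0 hk1 hirr⟩
  · rw [← map_mul_of_recurrence (L := cnFunctional hk0 hk1 w) h0 h1 h2
      (by simpa [jacobiCn_zero hk0 hk1] using cnFunctional_T hk0 hk1 w 0)
      (cnFunctional_cnIntervalPoly_succ hk0 hk1 hsn)]
    simpa only [eval_mul, mul_assoc] using
      hasSum_cnFunctional hk0 hk1 w (cnIntervalPoly k w n * cnIntervalPoly k w m)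
  · refine Finset.prod_pos fun i hi => ?_
    obtain ⟨i, rfl⟩ := Nat.exists_eq_add_of_le' (Finset.mem_Icc.1 hi).1
    exact cnU_succ_pos hk0 hk1 (h _)
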